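/- **Model.** Let $k\in\mathbb N\cup\{\infty\}$ and $t\ge 0$. For $n\ge 1$, attach to each of the $\binom n2$ unordered pairs $e$ of distinct vertices of $\{1,\dots,n\}$ a Poisson point process $\mathcal P_e$ on $\mathbb R_+$ with intensity $\frac1n\,ds$, these processes being independent. The multigraph process $(G^k_{n,s})_{s\ge0}$ starts without edges; at each time $s\in\mathcal P_e$ an edge with label $s$ is added between the two endpoints of $e$, and then, for each endpoint of $e$ whose degree has reached $k$, all the edges incident to this endpoint (including the new one) are removed. For $k=\infty$ no edge is ever removed. **Forbidden degree version of an infinite graph.** For a finite loopless multigraph $G$ whose edges carry distinct real labels, $\Phi(G)$ is the multigraph obtained by adding the edges of $G$ in increasing order of their labels with the same removal rule; $G_s$ denotes the subgraph of edges with label at most $s$. For a locally finite such $G$ and an edge $e$ of $G$, $B_l(G,e)$ is the subgraph induced by the vertices at distance at most $l$ from an endpoint of $e$, and $S_l(G,e)$ is the set of its vertices that are not in $B_{l-1}(G,e)$ (with $B_{-1}=\emptyset$). Let $l(e)\in\mathbb N\cup\{\infty\}$ be the smallest $l$ such that, for every $s$, the answer to the question "is $\tilde e\in\Phi(\tilde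 G_s)$?" is the same for all finite $\tilde G$ with distinct labels, all edges $\tilde e$ of $\tilde G$ and all sets of vertices $\tilde S\subset\tilde B$ of $\tilde G$ such that $\tilde e$ lies in the subgraph induced by $\tilde B$, $\tilde S$ contains all vertices of $\tilde B$ having a neighbour outside $\tilde B$, and (induced subgraph on $\tilde B$, $\tilde S$, $\tilde e$) is isomorphic, with labels, to $(B_l(G,e),S_l(G,e),e)$. Let $\Omega^+$ be the set of locally finite $G$ with distinct labels such that $l(e)<\infty$ for all edges $e$. For $G\in\Omega^+$, $\Phi(G)$ has the same vertices as $G$, and its edges are the edges $e$ of $G$ that are present in $\Phi(B_{l(e)}(G,e))$. A *propagation path* of length $l$ starting at $v_0$ in $G$ is a self-avoiding path $v_0,e_1,v_1,\dots,e_l,v_l$ together with edges $\tilde e_1,\dots,\tilde e_{l-1}$ with decreasing labels such that $\tilde e_i$ is incident to $v_i$ and $\tilde e_i\ne e_{j}$ for $i\neq j$. **Limit.** Let $T^\infty_t$ be the Galton–Watson tree with Poisson offspring distribution of mean $t$, whose edges carry labels that are, conditionally on the tree, independent and uniform on $[0,t]$. When $T^\infty_t\in\Omega^+$, let $T^k_t$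 be the connected component of the root in $\Phi(T^\infty_t)$, rooted at the root of $T^\infty_t$. **Local topology.** For a multigraph $G$ with labelled edges and an $m$-tuple $r=(r_1,\dots,r_m)$ of vertices, the $j$-ball of $(G,r)$ is the union over $i$ of the subgraphs induced by the vertices at distance at most $j$ from $r_i$, rooted at $r$. Two $m$-rooted graphs are $j$-isomorphic if there is an isomorphism between their $j$-balls preserving roots (in order) and edge labels; their pseudo-distance is $2^{-j}$ for the largest such $j$ ($0$ if they are $j$-isomorphic for all $j$, and $1$ if for none). Random locally finite $m$-rooted graphs $X_n$ converge in distribution to $X$ for the local topology if $\mathbb E[F(X_n)]\to\mathbb E[F(X)]$ for every bounded real function $F$ that is continuous for this pseudo-distance and measurable for the $\sigma$-algebra generated by the isomorphism types of the finite balls together with the positions of their labels in Borel subsets of $\mathbb R$. **Theorem.** For every $k\in\mathbb N\cup\{\infty\}$ and $t\ge0$: 1. Almost surely, in $T^\infty_t$ the lengths of the propagation paths starting at any given vertex are bounded, and $T^\infty_t\in\Omega^+$; hence $T^k_t$ is almost surely well defined. 2. For every integer $m\ge0$, if $v_1,\dots,v_m$ are independent uniform vertices of $\{1,\dots,n\}$,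 independent of the processes $(\mathcal P_e)_e$, then, as $n\to\infty$, $(G^k_{n,t},(v_1,\dots,v_m))$, with its edge labels, converges in distribution for the local topology to the disjoint union of $m$ independent copies of $T^k_t$, rooted at their $m$ roots. In particular ($m=1$), $(G^k_{n,t},v)$ converges in distribution to $T^k_t$ for a uniform vertex $v$. -/

import Mathlib

open MeasureTheory ProbabilityTheory Filter Topology
open scoped NNReal ENNReal

namespace ForbiddenDegree

noncomputable section

/-! ### Multigraphs with labelled edges -/

/-- A labelled edge on `V`: an unordered pair of vertices together with a label (its time of
addition). Parallel edges are distinguished by their labels. -/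
abbrev LEdge (V : Type) : Type := Sym2 V × ℝ

/-- A loopless multigraph with edges labelled by real numbers. Its vertices form a subset of the
ambient type `V`; several edges (with different labels) may join the same two vertices. -/
structure LGraph (V : Type) where
  verts : Set V
  edges : Set (LEdge V)
  mem_verts : ∀ e ∈ edges, ∀ v ∈ e.1, v ∈ verts
  loopless : ∀ e ∈ edges, ¬ e.1.IsDiag

/-- The image of a labelled edge under a map of vertices; the label is kept. -/
def LEdge.map {V W : Type} (φ : V → W) (e : LEdge V) : LEdge W := (e.1.map φ, e.2)

namespace LGraph

variable {V W : Type}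

/-- Two vertices are neighbours when at least one edge joins them. -/
def Adj (G : LGraph V) (u w : V) : Prop := ∃ s : ℝ, (s(u, w), s) ∈ G.edges

/-- Every vertex is incident to finitely many edges (counted with multiplicity). -/
def LocallyFinite (G : LGraph V) : Prop :=
  ∀ v ∈ G.verts, {e | e ∈ G.edges ∧ v ∈ e.1}.Finite

/-- No two edges have the same label. -/
def DistinctLabels (G : LGraph V) : Prop :=
  ∀ e ∈ G.edges, ∀ f ∈ G.edges, e.2 = f.2 → e = f

/-- The graph has finitely many vertices and edges. -/
def IsFinite (G : LGraph V) : Prop := G.verts.Finite ∧ G.edges.Finite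

/-- The induced subgraph on the vertices lying in `B`. -/
def induce (G : LGraph V) (B : Set V) : LGraph V where
  verts := G.verts ∩ B
  edges := {e | e ∈ G.edges ∧ ∀ v ∈ e.1, v ∈ B}
  mem_verts := fun e he v hv => ⟨G.mem_verts e he.1 v hv, he.2 v hv⟩
  loopless := fun e he => G.loopless e he.1

/-- The same vertices, with only those edges satisfying `p`. -/
def filterEdges (G : LGraph V) (p : LEdge V → Prop) : LGraph V where
  verts := G.verts
  edges := {e | e ∈ G.edges ∧ p e}
  mem_verts := fun e he => G.mem_verts e he.1
  loopless := fun e he => G.loopless e he.1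

/-- `G_t`: the subgraph of `G` restricted to the edges with label at most `t`. -/
def upTo (G : LGraph V) (t : ℝ) : LGraph V := G.filterEdges (fun e => e.2 ≤ t)

/-- The vertices at graph distance at most `j` from `v`. -/
def ball (G : LGraph V) (v : V) : ℕ → Set V
  | 0 => {v}
  | j + 1 => {w | w ∈ G.ball v j ∨ ∃ u ∈ G.ball v j, G.Adj u w}

/-- The connected component of `v`. -/
def component (G : LGraph V) (v : V) : LGraph V := G.induce (⋃ j, G.ball v j)

/-- The vertices of the ball `B_l(G, e)` around an edge: the union of the balls around its two
endpoints. -/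
def edgeBall (G : LGraph V) (e : LEdge V) (l : ℕ) : Set V := {w | ∃ v ∈ e.1, w ∈ G.ball v l}

/-- The sphere `S_l(G, e) = B_l(G, e) \ B_{l-1}(G, e)`, where `B_{-1} = ∅`. -/
def edgeSphere (G : LGraph V) (e : LEdge V) : ℕ → Set V
  | 0 => G.edgeBall e 0
  | l + 1 => G.edgeBall e (l + 1) \ G.edgeBall e l

/-- `φ` is an isomorphism of multigraphs with labelled edges from `G` onto `H` (the labels are
preserved). -/
def IsIso (φ : V → W) (G : LGraph V) (H : LGraph W) : Prop :=
  Set.BijOn φ G.verts H.verts ∧ LEdge.map φ '' G.edges = H.edges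

/-- The disjoint union of a finite family of labelled multigraphs. -/
def disjointUnion {m : ℕ} (G : Fin m → LGraph V) : LGraph (Fin m × V) where
  verts := {p | p.2 ∈ (G p.1).verts}
  edges := {e | ∃ i, ∃ f ∈ (G i).edges, e = LEdge.map (Prod.mk i) f}
  mem_verts := by
    rintro _ ⟨i, f, hf, rfl⟩ v hv
    obtain ⟨a, ha, rfl⟩ := Sym2.mem_map.1 hv
    exact (G i).mem_verts f hf a ha
  loopless := by
    rintro _ ⟨i, f, hf, rfl⟩ hd
    exact (G i).loopless f hf
      ((Sym2.isDiag_map (fun a b h => (Prod.mk.inj h).2)).1 hd)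

end LGraph

/-! ### The forbidden degree version of a labelled multigraph -/

/-- The degree of `w` with respect to a set of labelled edges, with multiplicity. -/
def degree {V : Type} (H : Set (LEdge V)) (w : V) : ℕ∞ := {f | f ∈ H ∧ w ∈ f.1}.encard

/-- One step of the dynamics with forbidden degree `k`: the edge `e` is added to `H`, and then, for
every endpoint `w` of `e` that has reached degree `k`, all the edges incident to `w` (including `e`)
are removed. If both endpoints reach degree `k`, edges are removed on both sides. -/
def step {V : Type} (k : ℕ∞) (H : Set (LEdge V)) (e : LEdge V) : Set (LEdge V) :=
  {f | f ∈ insert e H ∧ ∀ w ∈ e.1, w ∈ f.1 → degree (insert e H) w < k}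

open Classical in
/-- The forbidden degree version of a finite set of labelled edges: start without edges and add the
edges one at a time in increasing order of their labels, with the removal rule of `step`. -/
def phiFin {V : Type} (k : ℕ∞) (S : Set (LEdge V)) : Set (LEdge V) :=
  if h : S.Finite then
    (h.toFinset.toList.mergeSort (fun a b => decide (a.2 ≤ b.2))).foldl (step k) ∅
  else ∅

namespace LGraph

variable {V W : Type}

/-- `(G_B, B, S)` is a neighbourhood with boundary of the edge `e` in `G`. -/
structure IsNbhd (G : LGraph V) (e : LEdge V) (B S : Set V) : Prop where
  edge_mem : e ∈ G.edges
  subset_verts : B ⊆ G.verts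
  ends_mem : ∀ v ∈ e.1, v ∈ B
  boundary_subset : S ⊆ B
  boundary : ∀ v ∈ B, ∀ w, w ∉ B → G.Adj v w → v ∈ S

/-- `(H, f, B', S')` belongs to the class attached to the neighbourhood with boundary `(G_B, B, S)`
of `e`: `H` is a finite graph with distinct labels and `(B', S')` is a neighbourhood with boundary
of its edge `f` isomorphic to that of `e`. -/
def IsExtension (G : LGraph V) (e : LEdge V) (B S : Set V)
    (H : LGraph W) (f : LEdge W) (B' S' : Set W) : Prop :=
  H.IsFinite ∧ H.DistinctLabels ∧ H.IsNbhd f B' S' ∧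
    ∃ φ : V → W, IsIso φ (G.induce B) (H.induce B') ∧ φ '' S = S' ∧ LEdge.map φ e = f

/-- The knowledge of `(G_B, B, S)` is sufficient to know whether the edge `e` is present in the
forbidden degree version at time `t`: the answer is the same in all finite graphs that contain an
isomorphic copy of this neighbourhood with boundary. -/
def Sufficient (k : ℕ∞) (G : LGraph V) (e : LEdge V) (B S : Set V) (t : ℝ) : Prop :=
  (∀ (W : Type) (H : LGraph W) (f : LEdge W) (B' S' : Set W),
      G.IsExtension e B S H f B' S' → f ∈ phiFin k (H.upTo t).edges) ∨
  (∀ (W : Type) (H : LGraph W) (f : LEdge W) (B' S' : Set W),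
      G.IsExtension e B S H f B' S' → f ∉ phiFin k (H.upTo t).edges)

/-- The knowledge of `(B_l(G, e), S_l(G, e))` is sufficient, at all times, to know whether `e` is
present in the forbidden degree version of `G`. -/
def Determined (k : ℕ∞) (G : LGraph V) (e : LEdge V) (l : ℕ) : Prop :=
  ∀ t : ℝ, G.Sufficient k e (G.edgeBall e l) (G.edgeSphere e l) t

/-- `Ω⁺`: locally finite graphs with distinct labels in which the status of every edge is determined
by one of its balls, i.e. `l(e) < ∞` for all edges `e`. -/
def IsOmegaPlus (k : ℕ∞) (G : LGraph V) : Prop :=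
  G.LocallyFinite ∧ G.DistinctLabels ∧ ∀ e ∈ G.edges, ∃ l, G.Determined k e l

/-- The forbidden degree version `Φ(G)` of a graph `G ∈ Ω⁺`: the edge `e` is kept when it is present
in the forbidden degree version of the finite graph `B_{l(e)}(G, e)`, where `l(e)` is the least
radius determining the status of `e`. (Outside `Ω⁺`, edges with `l(e) = ∞` are dropped.) -/
def phi (k : ℕ∞) (G : LGraph V) : LGraph V :=
  G.filterEdges (fun e => ∃ l, IsLeast {l | G.Determined k e l} l ∧
    e ∈ phiFin k (G.induce (G.edgeBall e l)).edges)

/-- A propagation path of length `l` in `G` starting at `a`: a self-avoiding path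
`a = v_0, e_1, v_1, …, e_l, v_l` together with edges `e'_1, …, e'_{l-1}` with decreasing labels such
that `e'_i` is incident to `v_i` and `e'_i ≠ e_j` for `i ≠ j`. Values of `v`, `e`, `e'` at other
indices are irrelevant. -/
structure IsPropagationPath (G : LGraph V) (a : V) (l : ℕ)
    (v : ℕ → V) (e e' : ℕ → LEdge V) : Prop where
  start : v 0 = a
  start_mem : a ∈ G.verts
  self_avoiding : Set.InjOn v (Set.Iic l)
  path : ∀ i, i < l → e (i + 1) ∈ G.edges ∧ (e (i + 1)).1 = s(v i, v (i + 1))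
  incident : ∀ i, 1 ≤ i → i < l → e' i ∈ G.edges ∧ v i ∈ (e' i).1
  ne : ∀ i j, 1 ≤ i → i < l → 1 ≤ j → j ≤ l → i ≠ j → e' i ≠ e j
  decreasing : ∀ i j, 1 ≤ i → i < j → j < l → (e' j).2 < (e' i).2

/-- `Ω⁻`: locally finite graphs with distinct labels in which, for every vertex `a`, the lengths of
the propagation paths starting at `a` are bounded. -/
def IsOmegaMinus (G : LGraph V) : Prop :=
  G.LocallyFinite ∧ G.DistinctLabels ∧
    ∀ a ∈ G.verts, ∃ L : ℕ, ∀ l v e e', G.IsPropagationPath a l v e e' → l ≤ L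

theorem LocallyFinite.of_le {G H : LGraph V} (hG : G.LocallyFinite)
    (hv : H.verts ⊆ G.verts) (he : H.edges ⊆ G.edges) : H.LocallyFinite :=
  fun v hvH => (hG v (hv hvH)).subset fun _ h => ⟨he h.1, h.2⟩

theorem LocallyFinite.disjointUnion {m : ℕ} {G : Fin m → LGraph V}
    (hG : ∀ i, (G i).LocallyFinite) : (disjointUnion G).LocallyFinite := by
  rintro ⟨i, a⟩ ha
  refine ((hG i a ha).image (LEdge.map (Prod.mk i))).subset ?_
  rintro _ ⟨⟨j, f, hf, rfl⟩, hv⟩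
  obtain ⟨b, hb, hab⟩ := Sym2.mem_map.1 hv
  obtain ⟨rfl, rfl⟩ := Prod.mk.inj hab
  exact ⟨f, ⟨hf, hb⟩, rfl⟩

end LGraph

/-! ### Rooted graphs and the local topology -/

/-- A locally finite multigraph with labelled edges, with an ordered `m`-tuple of roots (a given
vertex can appear several times). -/
structure RGraph (m : ℕ) : Type 1 where
  V : Type
  graph : LGraph V
  root : Fin m → V
  root_mem : ∀ i, root i ∈ graph.verts
  locallyFinite : graph.LocallyFinite

namespace RGraph

variable {m : ℕ}

/-- Isomorphism of rooted multigraphs with labelled edges. -/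
def Iso (x y : RGraph m) : Prop :=
  ∃ φ : x.V → y.V, LGraph.IsIso φ x.graph y.graph ∧ ∀ i, φ (x.root i) = y.root i

theorem mem_ball_root {V : Type} (G : LGraph V) (v : V) (j : ℕ) : v ∈ G.ball v j := by
  induction j with
  | zero => rfl
  | succ j ih => exact Or.inl ih

/-- The `j`-ball of a rooted graph: the union over the roots `r_i` of the subgraphs of `x` induced
by the vertices at distance at most `j` from `r_i`, with the same roots. -/
def ball (x : RGraph m) (j : ℕ) : RGraph m where
  V := x.V
  graph :=
    { verts := x.graph.verts ∩ ⋃ i, x.graph.ball (x.root i) j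
      edges := {e | e ∈ x.graph.edges ∧ ∃ i, ∀ v ∈ e.1, v ∈ x.graph.ball (x.root i) j}
      mem_verts := fun e he v hv => ⟨x.graph.mem_verts e he.1 v hv, by
        obtain ⟨i, hi⟩ := he.2
        exact Set.mem_iUnion.2 ⟨i, hi v hv⟩⟩
      loopless := fun e he => x.graph.loopless e he.1 }
  root := x.root
  root_mem := fun i => ⟨x.root_mem i, Set.mem_iUnion.2 ⟨i, mem_ball_root _ _ _⟩⟩
  locallyFinite := x.locallyFinite.of_le (fun _ h => h.1) (fun _ h => h.1)

/-- Two rooted graphs are `j`-isomorphic when their `j`-balls are isomorphic. -/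
def JIso (j : ℕ) (x y : RGraph m) : Prop := (x.ball j).Iso (y.ball j)

open Classical in
/-- The local pseudo-distance: `2 ^ (-j)` with `j` the largest integer such that the two rooted
graphs are `j`-isomorphic (`0` if they are `j`-isomorphic for all `j`; `1` if there is no
such `j`). -/
def locDist (x y : RGraph m) : ℝ :=
  if ∀ j, JIso j x y then 0 else (1 / 2 : ℝ) ^ sSup {j | JIso j x y}

/-- Continuity of a real function for the local pseudo-distance. -/
def LocallyContinuous (F : RGraph m → ℝ) : Prop :=
  ∀ x, ∀ ε > 0, ∃ δ > 0, ∀ y, locDist x y < δ → |F y - F x| < ε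

/-- The event that the `j`-ball is isomorphic to a given finite rooted multigraph (with vertices
`0, …, N - 1`, edges `0, …, M - 1` with endpoints `ends`, and roots `ρ`) in such a way that, for all
`a`, the label of the edge `a` lies in `A a`. -/
def cylinder (j N M : ℕ) (ends : Fin M → Sym2 (Fin N)) (ρ : Fin m → Fin N)
    (A : Fin M → Set ℝ) : Set (RGraph m) :=
  {x | ∃ (φ : Fin N → x.V) (lab : Fin M → ℝ),
    Set.BijOn φ Set.univ (x.ball j).graph.verts ∧
    Set.BijOn (fun a => ((ends a).map φ, lab a)) Set.univ (x.ball j).graph.edges ∧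
    (∀ i, φ (ρ i) = x.root i) ∧ ∀ a, lab a ∈ A a}

/-- The natural σ-algebra on rooted labelled multigraphs, generated by the isomorphism types of the
finite balls together with the labels of their edges (with the Borel σ-algebra for the labels). -/
instance : MeasurableSpace (RGraph m) :=
  MeasurableSpace.generateFrom
    {C | ∃ (j N M : ℕ) (ends : Fin M → Sym2 (Fin N)) (ρ : Fin m → Fin N) (A : Fin M → Set ℝ),
      (∀ a, MeasurableSet (A a)) ∧ C = cylinder j N M ends ρ A}

end RGraph

/-- Convergence in distribution, for the local topology, of the random rooted graphs `X n` to `Y`: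
these are random variables, and `E[F(X n)] → E[F(Y)]` for every bounded measurable function `F`
which is continuous for the local pseudo-distance. -/
structure ConvergesLocally {m : ℕ} {Ω : ℕ → Type*} [∀ n, MeasurableSpace (Ω n)]
    (μ : ∀ n, Measure (Ω n)) (X : ∀ n, Ω n → RGraph m)
    {Ω' : Type*} [MeasurableSpace Ω'] (ν : Measure Ω') (Y : Ω' → RGraph m) : Prop where
  aemeasurable : ∀ n, AEMeasurable (X n) (μ n)
  aemeasurable_limit : AEMeasurable Y ν
  tendsto : ∀ F : RGraph m → ℝ, Measurable F → (∃ C, ∀ x, |F x| ≤ C) →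
    RGraph.LocallyContinuous F →
    Tendsto (fun n => ∫ ω, F (X n ω) ∂(μ n)) atTop (𝓝 (∫ ω, F (Y ω) ∂ν))

/-! ### Poisson processes and the random multigraph with forbidden degree -/

/-- Locally finite subsets of `ℝ₊`. -/
def PointConfig : Type :=
  {S : Set ℝ // S ⊆ Set.Ici 0 ∧ ∀ T : ℝ, (S ∩ Set.Iic T).Finite}

/-- The number of points of a configuration in `B`. -/
def PointConfig.count (B : Set ℝ) (c : PointConfig) : ℕ∞ := (c.1 ∩ B).encard

/-- The σ-algebra generated by the numbers of points in Borel sets. -/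
instance : MeasurableSpace PointConfig :=
  ⨆ (B : Set ℝ) (_ : MeasurableSet B), MeasurableSpace.comap (PointConfig.count B) inferInstance

/-- `P` is a Poisson point process on `ℝ₊` with constant intensity `r`: the number of points in a
Borel set of finite length `λ` is Poisson with mean `r * λ`, and the numbers of points in disjoint
Borel sets are independent. -/
structure IsPoissonProcess (r : ℝ≥0) {Ω : Type*} [MeasurableSpace Ω] (P : Ω → PointConfig)
    (μ : Measure Ω) : Prop where
  measurable : Measurable P
  law : ∀ B : Set ℝ, MeasurableSet B → volume (B ∩ Set.Ici 0) ≠ ∞ → ∀ j : ℕ,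
    μ {ω | (P ω).count B = j} = poissonMeasure (r * (volume (B ∩ Set.Ici 0)).toNNReal) {j}
  indep : ∀ (s : ℕ) (B : Fin s → Set ℝ), (∀ i, MeasurableSet (B i)) →
    Pairwise (fun i j => Disjoint (B i) (B j)) →
    iIndepFun (fun i ω => (P ω).count (B i)) μ

/-- The possible (unlabelled) edges on `n` vertices: the unordered pairs of distinct vertices. -/
abbrev PairEdge (n : ℕ) : Type := {e : Sym2 (Fin n) // ¬ e.IsDiag}

/-- The labelled Erdős–Rényi multigraph `G^∞_{n,t}`: one edge with label `s` for each point `s ≤ t`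
of the process attached to a pair. -/
def erGraph {n : ℕ} (t : ℝ) (P : PairEdge n → PointConfig) : LGraph (Fin n) where
  verts := Set.univ
  edges := {e | ∃ a : PairEdge n, e.1 = a.1 ∧ e.2 ∈ (P a).1 ∧ e.2 ≤ t}
  mem_verts := fun _ _ _ _ => trivial
  loopless := by
    rintro e ⟨a, ha, -⟩
    rw [ha]
    exact a.2

theorem erGraph_edges_finite {n : ℕ} (t : ℝ) (P : PairEdge n → PointConfig) :
    (erGraph t P).edges.Finite := by
  refine (Set.finite_iUnion fun a : PairEdge n =>
    ((P a).2.2 t).image fun s : ℝ => ((a.1, s) : LEdge (Fin n))).subset ?_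
  rintro ⟨e, s⟩ ⟨a, ha, hs, hst⟩
  obtain rfl : e = a.1 := ha
  exact Set.mem_iUnion.2 ⟨a, s, ⟨hs, hst⟩, rfl⟩

/-- The random multigraph with forbidden degree `k` at time `t`, `G^k_{n,t}`: the edges are added at
the points of the processes up to time `t`, with the removal rule of `step`. -/
def forbiddenGraph {n : ℕ} (k : ℕ∞) (t : ℝ) (P : PairEdge n → PointConfig) : LGraph (Fin n) :=
  (erGraph t P).filterEdges (fun e => e ∈ phiFin k (erGraph t P).edges)

/-- `(G^k_{n,t}, (v_1, …, v_m))`. -/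
def rootedForbiddenGraph {n m : ℕ} (k : ℕ∞) (t : ℝ) (P : PairEdge n → PointConfig)
    (v : Fin m → Fin n) : RGraph m where
  V := Fin n
  graph := forbiddenGraph k t P
  root := v
  root_mem := fun _ => trivial
  locallyFinite := fun _ _ => (erGraph_edges_finite t P).subset fun _ h => h.1.1

/-! ### The Poisson Galton–Watson tree and its forbidden degree version -/

/-- The Galton–Watson tree built from the marks `M`: the vertices are finite words, the children of
`u` are the words `i :: u` with `i < (M u).1`, and the edge between `u` and its child `i :: u` has
label `t * (M (i :: u)).2`. -/
def pgwTree (t : ℝ) (M : List ℕ → ℕ × ℝ) : LGraph (List ℕ) where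
  verts := {u | ∀ i w, (i :: w) <:+ u → i < (M w).1}
  edges := {e | ∃ i u, (∀ j w, (j :: w) <:+ (i :: u) → j < (M w).1) ∧
    e = (s(u, i :: u), t * (M (i :: u)).2)}
  mem_verts := by
    rintro _ ⟨i, u, h, rfl⟩ v hv
    rcases Sym2.mem_iff.1 hv with rfl | rfl
    · exact fun j w hw => h j w (hw.trans (List.suffix_cons i _))
    · exact h
  loopless := by
    rintro _ ⟨i, u, h, rfl⟩ hd
    have := congrArg List.length (Sym2.mk_isDiag_iff.1 hd)
    simp at this

theorem pgwTree_locallyFinite (t : ℝ) (M : List ℕ → ℕ × ℝ) : (pgwTree t M).LocallyFinite := by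
  intro v _
  have hfin : (insert v ((fun i => i :: v) '' Set.Iio (M v).1)).Finite :=
    ((Set.finite_Iio _).image _).insert _
  refine (hfin.image fun w : List ℕ => ((s(w.tail, w), t * (M w).2) : LEdge (List ℕ))).subset ?_
  rintro _ ⟨⟨i, u, h, rfl⟩, hv⟩
  refine ⟨i :: u, ?_, rfl⟩
  rcases Sym2.mem_iff.1 hv with rfl | rfl
  · exact Or.inr ⟨i, h i _ (List.suffix_refl _), rfl⟩
  · exact Or.inl rfl

/-- `T^k_t`: the connected component of the root in the forbidden degree version of the labelled
Galton–Watson tree. -/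
def forbiddenTree (k : ℕ∞) (t : ℝ) (M : List ℕ → ℕ × ℝ) : LGraph (List ℕ) :=
  ((pgwTree t M).phi k).component []

/-- The disjoint union of the `m` trees `T^k_t` built from the marks `M 0, …, M (m - 1)`, rooted at
their `m` roots. -/
def rootedForbiddenForest {m : ℕ} (k : ℕ∞) (t : ℝ) (M : Fin m → List ℕ → ℕ × ℝ) : RGraph m where
  V := Fin m × List ℕ
  graph := LGraph.disjointUnion fun i => forbiddenTree k t (M i)
  root := fun i => (i, [])
  root_mem := fun i => by
    refine ⟨fun j w h => ?_, Set.mem_iUnion.2 ⟨0, rfl⟩⟩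
    simp at h
  locallyFinite := LGraph.LocallyFinite.disjointUnion fun i =>
    (pgwTree_locallyFinite t (M i)).of_le (fun _ h => h.1) (fun _ h => h.1.1)

end

end ForbiddenDegree

/-! Locality comes from following a discrepancy. Suppose that two finite graphs contain the same
ball around an edge and that the edge is present in only one of the two dynamics. At an interior
vertex, the state at time `s` depends only on the states just before `s` and on the edge added at
`s`. So a first disagreement at a vertex at time `s` forces a strictly earlier first disagreement at
a neighbour, where an edge labelled `s` has just been added. Iterating inside the ball gives
vertices with strictly decreasing times, that is, a propagation path almost as long as the radius.
Bounded propagation paths therefore make the status of every edge a function of a finite ball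
(`exists_propagationPath`, `IsOmegaMinus.isOmegaPlus`).

In the Galton–Watson tree a self-avoiding path descends after boundedly many steps. Along the
descent one chooses at each step a child and a side edge, which costs a factor `E[N²]` in
expectation (`N` Poisson), while the `n` side labels are independent, uniform and decreasing.
Cutting `[0, 1]` into `K` cells, there are polynomially many nonincreasing sequences of cells and
each has probability at most about `K⁻ⁿ`. For `K > 2 E[N²]` the bound tends to `0`
(`measure_downChain_le`).

For the convergence, it is enough to show `E[F(Y) + C] ≤ liminf E[F(X_n) + C]` when `F + C ≥ 0`,
since this applies to `F` and to `-F`. Neither tightness nor an upper bound is needed, because both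
sides are probability measures. Truncate the limiting forest at height `J`, place its words
uniformly in the vertex set, and overwrite an independent configuration so that the placed forest is
exactly what is seen at the words of height less than `J`. Two facts are combined.

From below: for fixed marks and large `J`, locality shows that the ball of radius `d` of the
forbidden degree graph is that of the limit, whatever lies beyond the forest (`exists_jIso_level`).
As almost all placements are injective when `n → ∞`, the mean over the placements is asymptotically
at least `F(Y) + C` (`le_liminf_exploredMean`).

From above: for a given placement, the law of the overwritten configuration is explicitly comparable
with the true law restricted to the event that this placed forest is explored. The constant is the
weight `∏ 1 / c_p !` over the interior words, up to the probability of the given roots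
(`Good.weight_le`). The weights of the forests explored in one configuration from given roots add up
to at most one. Indeed, if the vertices are ordered by an independent uniform permutation around
each vertex, a forest has its children sorted with probability at least its weight, and at most one
explored forest is sorted (`tsum_weight_le`). Hence the mean over the placements is at most
`E[F(X_n) + C]`, for all `n` and `J` (`lintegral_exploredMean_le`).

Fatou's lemma, in `n` and then in `J`, concludes. Measurability is obtained from versions of the
graphs built from countably many measurable labels and events, equal to the original ones almost
surely. -/

namespace ForbiddenDegree

/-! ### The finite dynamics -/

/-- The labels of the edges of `S` are pairwise distinct. -/
def LabelsInj {V : Type} (S : Set (LEdge V)) : Prop := Set.InjOn Prod.snd S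

theorem LabelsInj.mono {V : Type} {S T : Set (LEdge V)} (h : LabelsInj T) (hST : S ⊆ T) :
    LabelsInj S := Set.InjOn.mono hST h

theorem LGraph.DistinctLabels.labelsInj {V : Type} {G : LGraph V} (h : G.DistinctLabels) :
    LabelsInj G.edges := fun e he f hf hef => h e he f hf hef

section Dynamics

variable {V W : Type} {k : ℕ∞}

theorem phiFin_empty : phiFin k (∅ : Set (LEdge V)) = ∅ := by
  simp [phiFin]

/-- With distinct labels the sorted list does not depend on the order in which `toList` enumerates
the set, so an edge of largest label is simply appended. Together with `phiFin_empty`, this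
recursion replaces the list-based definition from here on. -/
theorem phiFin_insert {S : Set (LEdge V)} {e : LEdge V} (hS : S.Finite) (hd : LabelsInj S)
    (hmax : ∀ f ∈ S, f.2 < e.2) : phiFin k (insert e S) = step k (phiFin k S) e := by
  classical
  have heS : e ∉ S := fun h => lt_irrefl _ (hmax e h)
  have hi : (insert e S).Finite := hS.insert e
  rw [phiFin, phiFin, dif_pos hi, dif_pos hS]
  set le : LEdge V → LEdge V → Bool := fun a b => decide (a.2 ≤ b.2) with hle
  have htrans : ∀ a b c : LEdge V, le a b → le b c → le a c := by
    intro a b c; simp only [hle, decide_eq_true_eq]; exact le_trans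
  have htotal : ∀ a b : LEdge V, le a b || le b a := by
    intro a b; simp only [hle, Bool.or_eq_true, decide_eq_true_eq]; exact le_total _ _
  have key : hi.toFinset.toList.mergeSort le = hS.toFinset.toList.mergeSort le ++ [e] := by
    have hins : hi.toFinset = insert e hS.toFinset := by ext; simp
    have hperm : (hi.toFinset.toList.mergeSort le).Perm
        (hS.toFinset.toList.mergeSort le ++ [e]) := by
      refine (List.mergeSort_perm _ _).trans ?_
      rw [hins]
      refine (Finset.toList_insert (by simpa using heS)).trans ?_
      refine List.Perm.trans ?_ List.perm_append_comm
      exact List.Perm.cons e (List.mergeSort_perm _ _).symm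
    refine hperm.eq_of_pairwise (le := fun a b => le a b = true) ?_ ?_ ?_
    · intro a b ha hb hab hba
      simp only [hle, decide_eq_true_eq] at hab hba
      have h2 := le_antisymm hab hba
      have ha' : a = e ∨ a ∈ S := by simpa using ha
      have hb' : b = e ∨ b ∈ S := by simpa [or_comm] using hb
      rcases ha' with rfl | ha' <;> rcases hb' with rfl | hb'
      · rfl
      · exact absurd h2 (hmax b hb').ne'
      · exact absurd h2 (hmax a ha').ne
      · exact hd ha' hb' h2
    · exact List.pairwise_mergeSort htrans htotal _
    · rw [List.pairwise_append]
      refine ⟨List.pairwise_mergeSort htrans htotal _, by simp, ?_⟩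
      intro a ha b hb
      obtain rfl : b = e := by simpa using hb
      have : a ∈ S := by simpa using ha
      simpa [hle] using (hmax a this).le
  rw [key, List.foldl_append]
  rfl

/-- Induction on a finite set of edges with distinct labels, by increasing labels. -/
theorem label_induction {p : Set (LEdge V) → Prop} (h0 : p ∅)
    (h1 : ∀ S e, S.Finite → LabelsInj S → (∀ f ∈ S, f.2 < e.2) → p S → p (insert e S))
    {S : Set (LEdge V)} (hS : S.Finite) (hd : LabelsInj S) : p S := by
  classical
  lift S to Finset (LEdge V) using hS
  induction S using Finset.induction_on_max_value (fun e : LEdge V => e.2) with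
  | empty => simpa using h0
  | insert a s ha hmax ih =>
    rw [Finset.coe_insert] at hd ⊢
    have hd' : LabelsInj (s : Set (LEdge V)) := hd.mono (Set.subset_insert _ _)
    refine h1 _ _ s.finite_toSet hd' ?_ (ih hd')
    intro f hf
    refine lt_of_le_of_ne (hmax f hf) fun h => ?_
    have := hd (Set.mem_insert_of_mem _ hf) (Set.mem_insert _ _) h
    exact ha (this ▸ hf)

theorem step_subset (H : Set (LEdge V)) (e : LEdge V) : step k H e ⊆ insert e H := fun _ h => h.1

theorem phiFin_subset {S : Set (LEdge V)} (hS : S.Finite) (hd : LabelsInj S) :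
    phiFin k S ⊆ S := by
  refine label_induction (p := fun S => phiFin k S ⊆ S) (by rw [phiFin_empty]) ?_ hS hd
  intro S e hS hd hmax ih
  rw [phiFin_insert hS hd hmax]
  exact (step_subset _ _).trans (Set.insert_subset_insert ih)

/-- Vertices incident to at least one edge of `S`. -/
def support (S : Set (LEdge V)) : Set V := {v | ∃ e ∈ S, v ∈ e.1}

theorem support_mono {S T : Set (LEdge V)} (h : S ⊆ T) : support S ⊆ support T :=
  fun _ ⟨e, he, hv⟩ => ⟨e, h he, hv⟩

theorem degree_image {H : Set (LEdge V)} {f : LEdge V → LEdge W} {φ : V → W}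
    (hf : Set.InjOn f H) {w : V} (hw : w ∈ support H) (hφ : Set.InjOn φ (support H))
    (hfφ : ∀ e ∈ H, (f e).1 = e.1.map φ) : degree (f '' H) (φ w) = degree H w := by
  have : {g | g ∈ f '' H ∧ φ w ∈ g.1} = f '' {g | g ∈ H ∧ w ∈ g.1} := by
    ext g
    constructor
    · rintro ⟨⟨e, he, rfl⟩, hm⟩
      rw [hfφ e he, Sym2.mem_map] at hm
      obtain ⟨a, ha, hae⟩ := hm
      have : a = w := hφ ⟨e, he, ha⟩ hw hae
      exact ⟨e, ⟨he, this ▸ ha⟩, rfl⟩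
    · rintro ⟨e, ⟨he, hm⟩, rfl⟩
      exact ⟨⟨e, he, rfl⟩, by rw [hfφ e he]; exact Sym2.mem_map.2 ⟨w, hm, rfl⟩⟩
  rw [degree, degree, this]
  exact Set.InjOn.encard_image (hf.mono fun _ h => h.1)

theorem step_image {H : Set (LEdge V)} {e : LEdge V} {f : LEdge V → LEdge W} {φ : V → W}
    (hf : Set.InjOn f (insert e H)) (hφ : Set.InjOn φ (support (insert e H)))
    (hfφ : ∀ g ∈ insert e H, (f g).1 = g.1.map φ) :
    step k (f '' H) (f e) = f '' step k H e := by
  have hmem : ∀ g ∈ insert e H, ∀ w ∈ support (insert e H), (φ w ∈ (f g).1 ↔ w ∈ g.1) := by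
    intro g hg w hw
    rw [hfφ g hg, Sym2.mem_map]
    constructor
    · rintro ⟨a, ha, hae⟩
      exact hφ ⟨g, hg, ha⟩ hw hae ▸ ha
    · exact fun h => ⟨w, h, rfl⟩
  have he : e ∈ insert e H := Set.mem_insert _ _
  ext g
  constructor
  · rintro ⟨hg, hdeg⟩
    rw [← Set.image_insert_eq] at hg hdeg
    obtain ⟨g, hg, rfl⟩ := hg
    refine ⟨g, ⟨hg, fun w hwe hwg => ?_⟩, rfl⟩
    have hw : w ∈ support (insert e H) := ⟨e, he, hwe⟩
    rw [← degree_image hf hw hφ hfφ]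
    exact hdeg _ ((hmem e he w hw).2 hwe) ((hmem g hg w hw).2 hwg)
  · rintro ⟨g, ⟨hg, hdeg⟩, rfl⟩
    refine ⟨by rw [← Set.image_insert_eq]; exact ⟨g, hg, rfl⟩, fun w hwe hwg => ?_⟩
    rw [hfφ e he, Sym2.mem_map] at hwe
    obtain ⟨a, ha, rfl⟩ := hwe
    have hw : a ∈ support (insert e H) := ⟨e, he, ha⟩
    rw [← Set.image_insert_eq, degree_image hf hw hφ hfφ]
    exact hdeg a ha ((hmem g hg a hw).1 hwg)

/-- The dynamics commutes with maps of edges that are induced by an injective map of vertices and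
preserve the order of the labels. -/
theorem phiFin_image {S : Set (LEdge V)} {f : LEdge V → LEdge W} {φ : V → W}
    (hS : S.Finite) (hd : LabelsInj S) (hφ : Set.InjOn φ (support S))
    (hfφ : ∀ e ∈ S, (f e).1 = e.1.map φ)
    (hlab : ∀ e ∈ S, ∀ g ∈ S, e.2 < g.2 → (f e).2 < (f g).2) :
    phiFin k (f '' S) = f '' phiFin k S := by
  revert hφ hfφ hlab
  refine label_induction (p := fun S => Set.InjOn φ (support S) →
    (∀ e ∈ S, (f e).1 = e.1.map φ) → (∀ e ∈ S, ∀ g ∈ S, e.2 < g.2 → (f e).2 < (f g).2) →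
    phiFin k (f '' S) = f '' phiFin k S) ?_ ?_ hS hd
  · intro _ _ _
    simp [phiFin_empty]
  · intro S e hS hd hmax ih hφ hfφ hlab
    have hsub : S ⊆ insert e S := Set.subset_insert _ _
    have hdi : LabelsInj (insert e S) := by
      rintro a (rfl | ha) b (rfl | hb) hab
      · rfl
      · exact absurd hab (hmax b hb).ne'
      · exact absurd hab (hmax a ha).ne
      · exact hd ha hb hab
    have hlabinj : ∀ a ∈ insert e S, ∀ b ∈ insert e S, (f a).2 = (f b).2 → a = b := by
      intro a ha b hb hab
      rcases lt_trichotomy a.2 b.2 with h | h | h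
      · exact absurd hab (hlab a ha b hb h).ne
      · exact hdi ha hb h
      · exact absurd hab (hlab b hb a ha h).ne'
    have hinj : Set.InjOn f (insert e S) := fun a ha b hb hab =>
      hlabinj a ha b hb (congrArg Prod.snd hab)
    have hd' : LabelsInj (f '' S) := by
      rintro _ ⟨a, ha, rfl⟩ _ ⟨b, hb, rfl⟩ hab
      rw [hlabinj a (hsub ha) b (hsub hb) hab]
    have hmax' : ∀ g ∈ f '' S, g.2 < (f e).2 := by
      rintro _ ⟨a, ha, rfl⟩
      exact hlab a (hsub ha) e (Set.mem_insert _ _) (hmax a ha)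
    have hss : insert e (phiFin k S) ⊆ insert e S :=
      Set.insert_subset_insert (phiFin_subset hS hd)
    rw [Set.image_insert_eq, phiFin_insert (hS.image f) hd' hmax',
      ih (hφ.mono (support_mono hsub)) (fun a ha => hfφ a (hsub ha))
        (fun a ha b hb => hlab a (hsub ha) b (hsub hb)),
      phiFin_insert hS hd hmax, step_image (hinj.mono hss)
        (hφ.mono (support_mono hss)) (fun a ha => hfφ a (hss ha))]

end Dynamics

/-! ### Bounded propagation implies locality -/

section Time

variable {V : Type} {k : ℕ∞} {S : Set (LEdge V)}

/-- The time `s'` stands for the left limit at `s`: no label lies strictly between them, so at most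
one step of the dynamics separates the two states. Such an `s'` is provided by `exists_gap`. -/
theorem phiFin_upTo_of_mem (hS : S.Finite) (hd : LabelsInj S) {s s' : ℝ} (hs : s' < s)
    (hgap : ∀ f ∈ S, f.2 < s → f.2 ≤ s') {h : LEdge V} (hh : h ∈ S) (hhs : h.2 = s) :
    phiFin k {e | e ∈ S ∧ e.2 ≤ s} = step k (phiFin k {e | e ∈ S ∧ e.2 ≤ s'}) h := by
  have : {e | e ∈ S ∧ e.2 ≤ s} = insert h {e | e ∈ S ∧ e.2 ≤ s'} := by
    ext f
    simp only [Set.mem_ofPred_eq, Set.mem_insert_iff]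
    constructor
    · rintro ⟨hf, hfs⟩
      rcases hfs.lt_or_eq with h1 | h1
      · exact Or.inr ⟨hf, hgap f hf h1⟩
      · exact Or.inl (hd hf hh (h1.trans hhs.symm))
    · rintro (rfl | ⟨hf, hfs⟩)
      · exact ⟨hh, hhs.le⟩
      · exact ⟨hf, hfs.trans hs.le⟩
  rw [this, phiFin_insert (hS.subset fun _ h => h.1) (hd.mono fun _ h => h.1)]
  rintro f ⟨-, hf⟩
  rw [hhs]
  exact hf.trans_lt hs

theorem phiFin_upTo_of_not_mem {s s' : ℝ} (hs : s' < s)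
    (hgap : ∀ f ∈ S, f.2 < s → f.2 ≤ s') (hh : ∀ h ∈ S, h.2 ≠ s) :
    phiFin k {e | e ∈ S ∧ e.2 ≤ s} = phiFin k {e | e ∈ S ∧ e.2 ≤ s'} := by
  congr 1
  ext f
  constructor
  · rintro ⟨hf, hfs⟩
    exact ⟨hf, hgap f hf (lt_of_le_of_ne hfs (hh f hf))⟩
  · rintro ⟨hf, hfs⟩
    exact ⟨hf, hfs.trans hs.le⟩

theorem exists_gap {L : Set ℝ} (hL : L.Finite) (s : ℝ) : ∃ s' < s, ∀ x ∈ L, x < s → x ≤ s' := by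
  induction L, hL using Set.Finite.induction_on with
  | empty => exact ⟨s - 1, by linarith, by simp⟩
  | @insert a L ha hL ih =>
    obtain ⟨s', hs', h⟩ := ih
    by_cases has : a < s
    · refine ⟨max a s', max_lt has hs', ?_⟩
      rintro x (rfl | hx) hxs
      · exact le_max_left _ _
      · exact (h x hx hxs).trans (le_max_right _ _)
    · refine ⟨s', hs', ?_⟩
      rintro x (rfl | hx) hxs
      · exact absurd hxs has
      · exact h x hx hxs

end Time

namespace LGraph

variable {V W W' : Type} {k : ℕ∞}

theorem ball_subset_succ (G : LGraph V) (v : V) (j : ℕ) : G.ball v j ⊆ G.ball v (j + 1) :=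
  fun _ h => Or.inl h

theorem ball_mono (G : LGraph V) (v : V) : Monotone (G.ball v) :=
  monotone_nat_of_le_succ (ball_subset_succ G v)

theorem edgeBall_mono (G : LGraph V) (e : LEdge V) : Monotone (G.edgeBall e) :=
  fun _ _ h _ ⟨v, hv, hw⟩ => ⟨v, hv, ball_mono G v h hw⟩

theorem Adj.symm {G : LGraph V} {u w : V} (h : G.Adj u w) : G.Adj w u := by
  obtain ⟨s, hs⟩ := h
  exact ⟨s, by rwa [Sym2.eq_swap]⟩

theorem adj_of_edge {G : LGraph V} {g : LEdge V} (hg : g ∈ G.edges) {u w : V}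
    (h : g.1 = s(u, w)) : G.Adj u w := ⟨g.2, by rw [← h]; exact hg⟩

theorem edgeBall_succ_of_adj {G : LGraph V} {e : LEdge V} {l : ℕ} {u w : V}
    (hu : u ∈ G.edgeBall e l) (h : G.Adj u w) : w ∈ G.edgeBall e (l + 1) := by
  obtain ⟨v, hv, hw⟩ := hu
  exact ⟨v, hv, Or.inr ⟨u, hw, h⟩⟩

theorem mem_edgeBall_zero {G : LGraph V} {e : LEdge V} {v : V} (h : v ∈ e.1) :
    v ∈ G.edgeBall e 0 := ⟨v, h, rfl⟩

theorem ball_subset_verts {G : LGraph V} {v : V} (hv : v ∈ G.verts) (j : ℕ) :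
    G.ball v j ⊆ G.verts := by
  induction j with
  | zero => rintro _ rfl; exact hv
  | succ j ih =>
    rintro w (h | ⟨u, hu, s, hs⟩)
    · exact ih h
    · exact G.mem_verts _ hs w (Sym2.mem_mk_right _ _)

theorem edgeBall_subset_verts {G : LGraph V} {e : LEdge V} (he : e ∈ G.edges) (l : ℕ) :
    G.edgeBall e l ⊆ G.verts := by
  rintro w ⟨v, hv, hw⟩
  exact ball_subset_verts (G.mem_verts e he v hv) l hw

theorem edgeSphere_subset (G : LGraph V) (e : LEdge V) (l : ℕ) :
    G.edgeSphere e l ⊆ G.edgeBall e l := by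
  cases l with
  | zero => exact subset_rfl
  | succ l => exact Set.sdiff_subset

theorem not_mem_edgeSphere {G : LGraph V} {e : LEdge V} {i l : ℕ} {v : V} (h : i < l)
    (hv : v ∈ G.edgeBall e i) : v ∉ G.edgeSphere e l := by
  cases l with
  | zero => omega
  | succ l => exact fun h' => h'.2 (edgeBall_mono G e (Nat.lt_succ_iff.1 h) hv)

theorem edges_injOn_map {φ : V → W} {G : LGraph V} (hφ : Set.InjOn φ G.verts) :
    Set.InjOn (LEdge.map φ) G.edges := by
  rintro ⟨a, s⟩ ha ⟨b, s'⟩ hb h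
  obtain ⟨h1, h2⟩ := Prod.mk.inj h
  simp only at h1 h2
  subst h2
  have : a = b := by
    induction a with | _ x y
    induction b with | _ z w
    have hx := G.mem_verts _ ha x (by simp)
    have hy := G.mem_verts _ ha y (by simp)
    have hz := G.mem_verts _ hb z (by simp)
    have hw := G.mem_verts _ hb w (by simp)
    simp only [Sym2.map_mk, Sym2.eq_iff] at h1 ⊢
    rcases h1 with ⟨h1, h2⟩ | ⟨h1, h2⟩
    · exact Or.inl ⟨hφ hx hz h1, hφ hy hw h2⟩
    · exact Or.inr ⟨hφ hx hw h1, hφ hy hz h2⟩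
  rw [this]

/-- `φ` identifies the graph `A` with boundary `S` with a subgraph of the finite graph `H` that
contains all the edges of `H` at the interior vertices. -/
structure Embeds (A : LGraph V) (S : Set V) (H : LGraph W) (φ : V → W) : Prop where
  finite : H.edges.Finite
  labels : LabelsInj H.edges
  inj : Set.InjOn φ A.verts
  map_mem : ∀ g ∈ A.edges, LEdge.map φ g ∈ H.edges
  interior : ∀ v ∈ A.verts, v ∉ S → ∀ h ∈ H.edges, φ v ∈ h.1 →
    ∃ g ∈ A.edges, v ∈ g.1 ∧ LEdge.map φ g = h

/-- An edge of `H` at the image of a vertex outside `S` cannot leave `B'`, since the boundary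
condition would put this image in `S' = φ '' S`. It therefore lies in the induced subgraph and comes
from `G`. This is all that the discrepancy argument needs to know about extensions. -/
theorem IsExtension.embeds {G : LGraph V} {e : LEdge V} {B S : Set V} {H : LGraph W}
    {f : LEdge W} {B' S' : Set W} (hS : S ⊆ G.verts ∩ B) (h : G.IsExtension e B S H f B' S') :
    ∃ φ : V → W, Embeds (G.induce B) S H φ ∧ LEdge.map φ e = f := by
  obtain ⟨hfin, hdist, hn, φ, ⟨hbij, hedges⟩, hSS, hef⟩ := h
  refine ⟨φ, ⟨hfin.2, hdist.labelsInj, hbij.injOn, fun g hg => ?_, ?_⟩, hef⟩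
  · have : LEdge.map φ g ∈ (H.induce B').edges := hedges ▸ Set.mem_image_of_mem _ hg
    exact this.1
  · intro v hv hvS h hh hvh
    have hh' : h ∈ (H.induce B').edges := by
      refine ⟨hh, fun w hw => ?_⟩
      by_contra hwB
      have hvB : φ v ∈ B' := (hbij.mapsTo hv).2
      have hne : φ v ≠ w := fun h => hwB (h ▸ hvB)
      have hadj : H.Adj (φ v) w :=
        adj_of_edge hh ((Sym2.mem_and_mem_iff hne).1 ⟨hvh, hw⟩)
      have := hn.boundary _ hvB w hwB hadj
      rw [← hSS] at this
      obtain ⟨u, hu, huv⟩ := this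
      exact hvS (hbij.injOn (hS hu) hv huv ▸ hu)
    rw [← hedges] at hh'
    obtain ⟨g, hg, rfl⟩ := hh'
    refine ⟨g, hg, ?_, rfl⟩
    obtain ⟨u, hu, huv⟩ := Sym2.mem_map.1 hvh
    exact hbij.injOn ((G.induce B).mem_verts g hg u hu) hv huv ▸ hu

/-- The copy of the edge `g` is present at time `s`. -/
def Present (k : ℕ∞) (H : LGraph W) (φ : V → W) (s : ℝ) (g : LEdge V) : Prop :=
  LEdge.map φ g ∈ phiFin k (H.upTo s).edges

namespace Embeds

variable {A : LGraph V} {S : Set V} {H : LGraph W} {φ : V → W}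

theorem upTo_finite (h : Embeds A S H φ) (s : ℝ) : (H.upTo s).edges.Finite :=
  h.finite.subset fun _ h => h.1

theorem upTo_labels (h : Embeds A S H φ) (s : ℝ) : LabelsInj (H.upTo s).edges :=
  h.labels.mono fun _ h => h.1

theorem label_le (h : Embeds A S H φ) {s : ℝ} {g : LEdge V} (hg : Present k H φ s g) :
    g.2 ≤ s := (phiFin_subset (h.upTo_finite s) (h.upTo_labels s) hg).2

theorem mem_edges (h : Embeds A S H φ) {s : ℝ} {f : LEdge W}
    (hf : f ∈ phiFin k (H.upTo s).edges) : f ∈ H.edges :=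
  (phiFin_subset (h.upTo_finite s) (h.upTo_labels s) hf).1

/-- The presence of an edge between interior vertices at the time `s` is a function of the states of
the edges at its endpoints just before `s`. -/
theorem present_iff (h : Embeds A S H φ) {s s' : ℝ} (hs : s' < s)
    (hgap : ∀ f ∈ H.edges, f.2 < s → f.2 ≤ s') {g : LEdge V} (hg : g ∈ A.edges)
    (hint : ∀ v ∈ g.1, v ∉ S) :
    Present k H φ s g ↔ (g.2 = s ∨ Present k H φ s' g) ∧ ∀ u ∈ g.1,
      (∃ a ∈ A.edges, a.2 = s ∧ u ∈ a.1) →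
      {b | b ∈ A.edges ∧ u ∈ b.1 ∧ (b.2 = s ∨ Present k H φ s' b)}.encard < k := by
  by_cases hex : ∃ x ∈ H.edges, x.2 = s
  · obtain ⟨x, hx, hxs⟩ := hex
    have hlab : ∀ b ∈ A.edges, (LEdge.map φ b = x ↔ b.2 = s) := by
      intro b hb
      refine ⟨fun h' => ?_, fun h' => h.labels (h.map_mem b hb) hx (h'.trans hxs.symm)⟩
      rw [← hxs, ← h']; rfl
    have hstep : phiFin k (H.upTo s).edges = step k (phiFin k (H.upTo s').edges) x :=
      phiFin_upTo_of_mem h.finite h.labels hs hgap hx hxs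
    have hA : ∀ u ∈ g.1, u ∈ A.verts := A.mem_verts g hg
    -- Both endpoints are interior, so all edges of `H` at them come from `A` and the degree can be
    -- counted in `A`. The right-hand side then involves `H` only through `Present` at time `s'`.
    have hdeg : ∀ u ∈ g.1, degree (insert x (phiFin k (H.upTo s').edges)) (φ u) =
        {b | b ∈ A.edges ∧ u ∈ b.1 ∧ (b.2 = s ∨ Present k H φ s' b)}.encard := by
      intro u hu
      rw [degree, ← Set.InjOn.encard_image ((edges_injOn_map h.inj).mono fun _ h => h.1)]
      congr 1
      ext f
      constructor
      · rintro ⟨hf, huf⟩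
        have hfH : f ∈ H.edges := by
          rcases hf with rfl | hf
          · exact hx
          · exact h.mem_edges hf
        obtain ⟨b, hb, hub, rfl⟩ := h.interior u (hA u hu) (hint u hu) f hfH huf
        refine ⟨b, ⟨hb, hub, ?_⟩, rfl⟩
        rcases hf with hf | hf
        · exact Or.inl ((hlab b hb).1 hf)
        · exact Or.inr hf
      · rintro ⟨b, ⟨hb, hub, hbs⟩, rfl⟩
        refine ⟨?_, Sym2.mem_map.2 ⟨u, hub, rfl⟩⟩
        rcases hbs with hbs | hbs
        · exact Or.inl ((hlab b hb).2 hbs)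
        · exact Or.inr hbs
    rw [Present, hstep]
    refine and_congr (or_congr (hlab g hg) Iff.rfl) ?_
    constructor
    · rintro h' u hu ⟨a, ha, has, hua⟩
      rw [← hdeg u hu]
      refine h' _ ?_ (Sym2.mem_map.2 ⟨u, hu, rfl⟩)
      rw [← (hlab a ha).2 has]
      exact Sym2.mem_map.2 ⟨u, hua, rfl⟩
    · rintro h' w hwx hwg
      obtain ⟨u, hu, rfl⟩ := Sym2.mem_map.1 hwg
      obtain ⟨a, ha, hua, rfl⟩ := h.interior u (hA u hu) (hint u hu) x hx hwx
      rw [hdeg u hu]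
      exact h' u hu ⟨a, ha, hxs, hua⟩
  · push Not at hex
    have hno : ∀ a ∈ A.edges, a.2 ≠ s := fun a ha => hex _ (h.map_mem a ha)
    have heq : phiFin k (H.upTo s).edges = phiFin k (H.upTo s').edges :=
      phiFin_upTo_of_not_mem hs hgap hex
    rw [Present, heq]
    constructor
    · exact fun h' => ⟨Or.inr h', fun u _ ⟨a, ha, has, _⟩ => absurd has (hno a ha)⟩
    · rintro ⟨h' | h', -⟩
      · exact absurd h' (hno g hg)
      · exact h'

end Embeds

/-- The states at time `s` of some edge of `A` at `v` differ in `H` and `K`. -/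
def Disc (k : ℕ∞) (A : LGraph V) (H : LGraph W) (φ : V → W) (K : LGraph W') (ψ : V → W')
    (s : ℝ) (v : V) : Prop :=
  ∃ g ∈ A.edges, v ∈ g.1 ∧ ¬ (Present k H φ s g ↔ Present k K ψ s g)

/-- The time `s` is the first one at which the states of some edge of `A` at `v` differ. -/
def FirstDisc (k : ℕ∞) (A : LGraph V) (H : LGraph W) (φ : V → W) (H' : LGraph W') (φ' : V → W')
    (s : ℝ) (v : V) : Prop :=
  Disc k A H φ H' φ' s v ∧ ∀ s' < s, ¬ Disc k A H φ H' φ' s' v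

section Disc

variable {A : LGraph V} {S : Set V} {H : LGraph W} {φ : V → W} {H' : LGraph W'} {φ' : V → W'}

/-- States only change at labels, so the discrepancy is already there at the largest label not
exceeding `t`. One such label exists because the edge is present in one of the two graphs. This
reduces the search for a first discrepancy to a finite set of times. -/
theorem Disc.exists_label (hE : Embeds A S H φ) (hE' : Embeds A S H' φ') {t : ℝ} {v : V}
    (h : Disc k A H φ H' φ' t v) :
    ∃ s ∈ Prod.snd '' H.edges ∪ Prod.snd '' H'.edges, s ≤ t ∧ Disc k A H φ H' φ' s v := by
  set L := Prod.snd '' H.edges ∪ Prod.snd '' H'.edges with hL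
  have hLfin : L.Finite := (hE.finite.image _).union (hE'.finite.image _)
  have hne : (L ∩ Set.Iic t).Nonempty := by
    obtain ⟨g, hg, hvg, hne⟩ := h
    have : Present k H φ t g ∨ Present k H' φ' t g := by tauto
    rcases this with h | h
    · exact ⟨g.2, Or.inl ⟨_, hE.map_mem g hg, rfl⟩, hE.label_le h⟩
    · exact ⟨g.2, Or.inr ⟨_, hE'.map_mem g hg, rfl⟩, hE'.label_le h⟩
  obtain ⟨s, ⟨hsL, hst⟩, hmax⟩ := (hLfin.subset Set.inter_subset_left).exists_maximalFor id
    (L ∩ Set.Iic t) hne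
  have hmax' : ∀ x ∈ L, x ≤ t → x ≤ s := by
    intro x hx hxt
    by_contra hlt
    exact hlt (hmax ⟨hx, hxt⟩ (not_le.1 hlt).le)
  refine ⟨s, hsL, hst, ?_⟩
  have h1 : (H.upTo t).edges = (H.upTo s).edges := by
    ext f
    exact ⟨fun hf => ⟨hf.1, hmax' _ (Or.inl ⟨f, hf.1, rfl⟩) hf.2⟩,
      fun hf => ⟨hf.1, le_trans hf.2 hst⟩⟩
  have h2 : (H'.upTo t).edges = (H'.upTo s).edges := by
    ext f
    exact ⟨fun hf => ⟨hf.1, hmax' _ (Or.inr ⟨f, hf.1, rfl⟩) hf.2⟩,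
      fun hf => ⟨hf.1, le_trans hf.2 hst⟩⟩
  unfold Disc Present at h ⊢
  rwa [h1, h2] at h

theorem Disc.exists_first (hE : Embeds A S H φ) (hE' : Embeds A S H' φ') {t : ℝ} {v : V}
    (h : Disc k A H φ H' φ' t v) : ∃ s ≤ t, FirstDisc k A H φ H' φ' s v := by
  obtain ⟨s, hs, hst, hd⟩ := h.exists_label hE hE'
  have hLfin : (Prod.snd '' H.edges ∪ Prod.snd '' H'.edges).Finite :=
    (hE.finite.image _).union (hE'.finite.image _)
  obtain ⟨s₀, ⟨hs₀, hd₀⟩, hmin⟩ := (hLfin.subset (Set.inter_subset_left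
    (t := {s | Disc k A H φ H' φ' s v}))).exists_minimalFor id _ ⟨s, hs, hd⟩
  have hmin' : ∀ x ∈ Prod.snd '' H.edges ∪ Prod.snd '' H'.edges, Disc k A H φ H' φ' x v →
      s₀ ≤ x := by
    intro x hx hxd
    by_contra hlt
    exact hlt (hmin ⟨hx, hxd⟩ (not_le.1 hlt).le)
  refine ⟨s₀, (hmin' s hs hd).trans hst, hd₀, fun s' hs' hd' => ?_⟩
  obtain ⟨x, hx, hxs, hxd⟩ := hd'.exists_label hE hE'
  exact absurd (hmin' x hx hxd) (not_le.2 (hxs.trans_lt hs'))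

theorem FirstDisc.unique {s s' : ℝ} {v : V} (h : FirstDisc k A H φ H' φ' s v)
    (h' : FirstDisc k A H φ H' φ' s' v) : s = s' := by
  rcases lt_trichotomy s s' with hlt | heq | hlt
  · exact absurd h.1 (h'.2 s hlt)
  · exact heq
  · exact absurd h'.1 (h.2 _ hlt)

/-- A discrepancy at an interior vertex comes from an earlier discrepancy at a neighbour. -/
theorem FirstDisc.propagate (hE : Embeds A S H φ) (hE' : Embeds A S H' φ') {s : ℝ} {v : V}
    (hvS : v ∉ S) (h : FirstDisc k A H φ H' φ' s v) :
    ∃ (w : V) (g a : LEdge V) (σ : ℝ), g ∈ A.edges ∧ g.1 = s(v, w) ∧ g.2 ≤ s ∧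
      (w ∉ S → a ∈ A.edges ∧ w ∈ a.1 ∧ a.2 = s ∧ σ < s ∧ FirstDisc k A H φ H' φ' σ w) := by
  obtain ⟨⟨g, hg, hvg, hne⟩, hfirst⟩ := h
  obtain ⟨w, hw⟩ := Sym2.mem_iff_exists.1 hvg
  have hgs : g.2 ≤ s := by
    have : Present k H φ s g ∨ Present k H' φ' s g := by tauto
    rcases this with h | h
    · exact hE.label_le h
    · exact hE'.label_le h
  by_cases hwS : w ∈ S
  -- Once the boundary is reached nothing is claimed about `a` and `σ`, so their values are
  -- arbitrary.
  · exact ⟨w, g, g, 0, hg, hw, hgs, fun h => absurd hwS h⟩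
  have hLfin : (Prod.snd '' H.edges ∪ Prod.snd '' H'.edges).Finite :=
    (hE.finite.image _).union (hE'.finite.image _)
  obtain ⟨s', hs', hgap⟩ := exists_gap hLfin s
  have hint : ∀ u ∈ g.1, u ∉ S := by
    intro u hu
    rw [hw, Sym2.mem_iff] at hu
    rcases hu with rfl | rfl <;> assumption
  have hv' : ∀ b ∈ A.edges, v ∈ b.1 → (Present k H φ s' b ↔ Present k H' φ' s' b) := by
    intro b hb hvb
    by_contra hcon
    exact hfirst s' hs' ⟨b, hb, hvb, hcon⟩
  rw [hE.present_iff hs' (fun f hf => hgap _ (Or.inl ⟨f, hf, rfl⟩)) hg hint,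
    hE'.present_iff hs' (fun f hf => hgap _ (Or.inr ⟨f, hf, rfl⟩)) hg hint, hw] at hne
  simp only [Sym2.ball, hv' g hg hvg] at hne
  have hset : ∀ u, (∀ b ∈ A.edges, u ∈ b.1 → (Present k H φ s' b ↔ Present k H' φ' s' b)) →
      {b | b ∈ A.edges ∧ u ∈ b.1 ∧ (b.2 = s ∨ Present k H φ s' b)} =
      {b | b ∈ A.edges ∧ u ∈ b.1 ∧ (b.2 = s ∨ Present k H' φ' s' b)} := by
    intro u hu
    ext b
    simp only [Set.mem_ofPred_eq]
    constructor
    · rintro ⟨h1, h2, h3⟩; exact ⟨h1, h2, by rwa [← hu b h1 h2]⟩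
    · rintro ⟨h1, h2, h3⟩; exact ⟨h1, h2, by rwa [hu b h1 h2]⟩
  rw [hset v hv'] at hne
  -- The state of `g` and the degree at `v` agree just before `s`, so the two answers can only
  -- differ through the condition at `w`. That condition is active only if an edge is added at `w`
  -- at time `s`, and it differs only if there was already a discrepancy at `w`.
  have hex : ∃ a ∈ A.edges, a.2 = s ∧ w ∈ a.1 := by
    by_contra hno
    exact hne (by simp only [hno, false_imp_iff])
  obtain ⟨a, ha, has, hwa⟩ := hex
  have hdw : Disc k A H φ H' φ' s' w := by
    by_contra hno
    refine hne ?_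
    rw [hset w]
    intro b hb hwb
    by_contra hcon
    exact hno ⟨b, hb, hwb, hcon⟩
  obtain ⟨σ, hσ, hfd⟩ := hdw.exists_first hE hE'
  exact ⟨w, g, a, σ, hg, hw, hgs, fun _ => ⟨ha, hwa, has, hσ.trans_lt hs', hfd⟩⟩

end Disc

/-- If the state of an edge is not determined by its ball of radius `l + 1`, there is a propagation
path of length `l` starting at one of its endpoints. -/
theorem exists_propagationPath {G : LGraph V} {e : LEdge V} (he : e ∈ G.edges) {l : ℕ}
    (h : ¬ G.Determined k e (l + 1)) :
    ∀ a ∈ e.1, ∃ v p p', G.IsPropagationPath a l v p p' := by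
  intro a ha
  unfold Determined at h
  push Not at h
  obtain ⟨t, ht⟩ := h
  unfold Sufficient at ht
  push Not at ht
  obtain ⟨⟨W₁, H₁, f₁, B₁, S₁, hext₁, hf₁⟩, ⟨W₂, H₂, f₂, B₂, S₂, hext₂, hf₂⟩⟩ := ht
  set B := G.edgeBall e (l + 1) with hB
  set S := G.edgeSphere e (l + 1) with hS
  have hBv : B ⊆ G.verts := edgeBall_subset_verts he _
  have hSB : S ⊆ G.verts ∩ B := fun x hx =>
    ⟨hBv (edgeSphere_subset G e _ hx), edgeSphere_subset G e _ hx⟩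
  obtain ⟨φ₁, hE₁, rfl⟩ := hext₁.embeds hSB
  obtain ⟨φ₂, hE₂, rfl⟩ := hext₂.embeds hSB
  have heA : e ∈ (G.induce B).edges :=
    ⟨he, fun v hv => edgeBall_mono G e (Nat.zero_le _) (mem_edgeBall_zero hv)⟩
  have hdisc : Disc k (G.induce B) H₁ φ₁ H₂ φ₂ t a := ⟨e, heA, ha, fun hiff => hf₁ (hiff.2 hf₂)⟩
  obtain ⟨s₀, -, hs₀⟩ := hdisc.exists_first hE₁ hE₂
  have hnext : ∀ x : V × ℝ, x.1 ∉ S ∧ FirstDisc k (G.induce B) H₁ φ₁ H₂ φ₂ x.2 x.1 →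
      ∃ (w : V) (g b : LEdge V) (σ : ℝ), g ∈ (G.induce B).edges ∧ g.1 = s(x.1, w) ∧ g.2 ≤ x.2 ∧
      (w ∉ S → b ∈ (G.induce B).edges ∧ w ∈ b.1 ∧ b.2 = x.2 ∧ σ < x.2 ∧
        FirstDisc k (G.induce B) H₁ φ₁ H₂ φ₂ σ w) :=
    fun x hx => FirstDisc.propagate hE₁ hE₂ hx.1 hx.2
  have : Nonempty V := ⟨a⟩
  have : Nonempty (LEdge V) := ⟨e⟩
  choose! w g b σ hgA hgv hgs hrest using hnext
  -- The chain of vertices together with their first discrepancy times. Each step increases the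
  -- distance to `e` by at most one, so the first `l` steps stay off the sphere of radius `l + 1`
  -- and the propagation never stops there.
  let X : ℕ → V × ℝ := fun i => Nat.rec (a, s₀) (fun _ x => (w x, σ x)) i
  have hXs : ∀ i, X (i + 1) = (w (X i), σ (X i)) := fun i => rfl
  have hX : ∀ i, i ≤ l → (X i).1 ∈ G.edgeBall e i ∧
      FirstDisc k (G.induce B) H₁ φ₁ H₂ φ₂ (X i).2 (X i).1 := by
    intro i
    induction i with
    | zero => exact fun _ => ⟨mem_edgeBall_zero ha, hs₀⟩
    | succ i ih =>
      intro hi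
      obtain ⟨h1, h2⟩ := ih (by omega)
      have hP := And.intro (not_mem_edgeSphere (by omega : i < l + 1) h1) h2
      have hmem : (X (i + 1)).1 ∈ G.edgeBall e (i + 1) :=
        edgeBall_succ_of_adj h1 (adj_of_edge (hgA _ hP).1 (hgv _ hP))
      exact ⟨hmem, (hrest _ hP (not_mem_edgeSphere (by omega) hmem)).2.2.2.2⟩
  have hP : ∀ i, i ≤ l → (X i).1 ∉ S ∧ FirstDisc k (G.induce B) H₁ φ₁ H₂ φ₂ (X i).2 (X i).1 :=
    fun i hi => ⟨not_mem_edgeSphere (by omega) (hX i hi).1, (hX i hi).2⟩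
  have hR : ∀ i, i < l → b (X i) ∈ (G.induce B).edges ∧ (X (i + 1)).1 ∈ (b (X i)).1 ∧
      (b (X i)).2 = (X i).2 ∧ (X (i + 1)).2 < (X i).2 := by
    intro i hi
    obtain ⟨h1, h2, h3, h4, -⟩ := hrest _ (hP i hi.le) (hP (i + 1) hi).1
    exact ⟨h1, h2, h3, h4⟩
  have hdec : ∀ i j, i < j → j ≤ l → (X j).2 < (X i).2 := by
    intro i j hij
    induction j, hij using Nat.le_induction with
    | base => exact fun hj => (hR i (by omega)).2.2.2
    | succ j hij ih => exact fun hj => (hR j (by omega)).2.2.2.trans (ih (by omega))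
  -- Self-avoidance: a vertex has a single first discrepancy time, and the times strictly decrease
  -- along the chain.
  have hinj : ∀ i j, i ≤ l → j ≤ l → (X i).1 = (X j).1 → i = j := by
    intro i j hi hj hij
    have heq : (X i).2 = (X j).2 := FirstDisc.unique (hX i hi).2 (hij ▸ (hX j hj).2)
    rcases lt_trichotomy i j with h | h | h
    · exact absurd heq (hdec i j h hj).ne'
    · exact h
    · exact absurd heq (hdec j i h hi).ne
  refine ⟨fun i => (X i).1, fun i => g (X (i - 1)), fun i => b (X (i - 1)),
    rfl, hBv (edgeBall_mono G e (Nat.zero_le _) (mem_edgeBall_zero ha)),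
    fun i hi j hj hij => hinj i j hi hj hij, ?_, ?_, ?_, ?_⟩
  · intro i hi
    exact ⟨(hgA _ (hP i hi.le)).1, hgv _ (hP i hi.le)⟩
  · intro i h1 hi
    obtain ⟨i, rfl⟩ := Nat.exists_eq_succ_of_ne_zero (by omega : i ≠ 0)
    obtain ⟨h1, h2, -, -⟩ := hR i (by omega)
    exact ⟨h1.1, h2⟩
  · intro i j h1 hi h1' hj hij heq
    obtain ⟨i, rfl⟩ := Nat.exists_eq_succ_of_ne_zero (by omega : i ≠ 0)
    obtain ⟨j, rfl⟩ := Nat.exists_eq_succ_of_ne_zero (by omega : j ≠ 0)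
    simp only [Nat.succ_sub_one] at heq
    obtain ⟨-, h2, h3, -⟩ := hR i (by omega)
    -- A path edge further along has a label at most its own discrepancy time, hence smaller than
    -- the label of the side edge. An earlier path edge does not contain the vertex carrying the
    -- side edge, by self-avoidance.
    rcases lt_or_gt_of_ne hij with h | h
    · have h4 := hgs _ (hP j (by omega))
      rw [← heq, h3] at h4
      exact absurd h4 (not_le.2 (hdec i j (by omega) (by omega)))
    · rw [heq, hgv _ (hP j (by omega)), Sym2.mem_iff] at h2
      rcases h2 with h2 | h2
      · have := hinj (i + 1) j (by omega) (by omega) h2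
        omega
      · have := hinj (i + 1) (j + 1) (by omega) (by omega) h2
        omega
  · intro i j h1 hij hj
    obtain ⟨i, rfl⟩ := Nat.exists_eq_succ_of_ne_zero (by omega : i ≠ 0)
    obtain ⟨j, rfl⟩ := Nat.exists_eq_succ_of_ne_zero (by omega : j ≠ 0)
    simp only [Nat.succ_sub_one]
    rw [(hR i (by omega)).2.2.1, (hR j (by omega)).2.2.1]
    exact hdec i j (by omega) (by omega)

/-- Bounded propagation paths make the state of every edge local. -/
theorem IsOmegaMinus.isOmegaPlus {G : LGraph V} (h : G.IsOmegaMinus) (k : ℕ∞) :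
    G.IsOmegaPlus k := by
  refine ⟨h.1, h.2.1, fun e he => ?_⟩
  obtain ⟨a, ha⟩ : ∃ a, a ∈ e.1 := ⟨e.1.out.1, e.1.out_fst_mem⟩
  obtain ⟨L, hL⟩ := h.2.2 a (G.mem_verts e he a ha)
  -- There is no propagation path of length `L + 1`, and a radius one more than that length is
  -- enough.
  refine ⟨L + 1 + 1, ?_⟩
  by_contra hcon
  obtain ⟨v, p, p', hp⟩ := exists_propagationPath he hcon a ha
  have := hL _ _ _ _ hp
  omega

end LGraph

/-! ### Stability of balls under local isomorphisms -/

namespace RGraph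

variable {m : ℕ}

theorem ball_root_subset_verts (x : RGraph m) (i : Fin m) (j : ℕ) :
    x.graph.ball (x.root i) j ⊆ x.graph.verts :=
  LGraph.ball_subset_verts (x.root_mem i) j

/-- A map that is injective on the ball of radius `d + 1` and induces bijections between the edges
at the vertices of the balls of radius `d` is an isomorphism between these balls. -/
theorem jIso_of_local {x y : RGraph m} {φ : x.V → y.V} {d : ℕ}
    (hroot : ∀ i, φ (x.root i) = y.root i)
    (hinj : Set.InjOn φ (⋃ i, x.graph.ball (x.root i) (d + 1)))
    (hmap : ∀ i, ∀ p ∈ x.graph.ball (x.root i) d, ∀ g ∈ x.graph.edges, p ∈ g.1 →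
      LEdge.map φ g ∈ y.graph.edges)
    (hlift : ∀ i, ∀ p, ∀ r ≤ d, p ∈ x.graph.ball (x.root i) r →
      φ p ∈ y.graph.ball (y.root i) r → ∀ h ∈ y.graph.edges, φ p ∈ h.1 →
      ∃ g ∈ x.graph.edges, p ∈ g.1 ∧ LEdge.map φ g = h) : JIso d x y := by
  have hball : ∀ i, ∀ r ≤ d, y.graph.ball (y.root i) r = φ '' x.graph.ball (x.root i) r := by
    intro i r
    induction r with
    | zero =>
      intro _
      change {y.root i} = φ '' {x.root i}
      rw [Set.image_singleton, hroot]
    | succ r ih =>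
      intro hr
      have ih := ih (by omega)
      apply Set.Subset.antisymm
      · rintro w (hw | ⟨u, hu, s, hs⟩)
        · rw [ih] at hw
          exact Set.image_mono (LGraph.ball_subset_succ _ _ _) hw
        · have hu' := hu
          rw [ih] at hu
          obtain ⟨p, hp, rfl⟩ := hu
          obtain ⟨g, hg, hpg, hgs⟩ := hlift i p r (by omega) hp hu' _ hs (Sym2.mem_mk_left _ _)
          obtain ⟨q, hq⟩ := Sym2.mem_iff_exists.1 hpg
          have : s(φ p, φ q) = s(φ p, w) := by
            have := congrArg Prod.fst hgs
            simpa [LEdge.map, hq] using this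
          rw [Sym2.congr_right] at this
          exact ⟨q, Or.inr ⟨p, hp, LGraph.adj_of_edge hg hq⟩, this⟩
      · rintro _ ⟨q, hq | ⟨p, hp, s, hs⟩, rfl⟩
        · exact LGraph.ball_subset_succ _ _ _ (ih ▸ Set.mem_image_of_mem φ hq)
        · refine Or.inr ⟨φ p, ih ▸ Set.mem_image_of_mem φ hp, s, ?_⟩
          exact hmap i p (LGraph.ball_mono _ _ (by omega) hp) _ hs (Sym2.mem_mk_left _ _)
  refine ⟨φ, ⟨⟨?_, ?_, ?_⟩, ?_⟩, hroot⟩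
  · rintro p ⟨hp, hp'⟩
    obtain ⟨i, hi⟩ := Set.mem_iUnion.1 hp'
    have : φ p ∈ y.graph.ball (y.root i) d := hball i d le_rfl ▸ Set.mem_image_of_mem φ hi
    exact ⟨ball_root_subset_verts y i d this, Set.mem_iUnion.2 ⟨i, this⟩⟩
  · refine hinj.mono ?_
    rintro p ⟨-, hp⟩
    obtain ⟨i, hi⟩ := Set.mem_iUnion.1 hp
    exact Set.mem_iUnion.2 ⟨i, LGraph.ball_subset_succ _ _ _ hi⟩
  · rintro w ⟨-, hw⟩
    obtain ⟨i, hi⟩ := Set.mem_iUnion.1 hw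
    rw [hball i d le_rfl] at hi
    obtain ⟨p, hp, rfl⟩ := hi
    exact ⟨p, ⟨ball_root_subset_verts x i d hp, Set.mem_iUnion.2 ⟨i, hp⟩⟩, rfl⟩
  · ext h
    constructor
    · rintro ⟨g, ⟨hg, i, hi⟩, rfl⟩
      refine ⟨hmap i _ (hi _ g.1.out_fst_mem) g hg g.1.out_fst_mem, i, fun w hw => ?_⟩
      obtain ⟨q, hq, rfl⟩ := Sym2.mem_map.1 hw
      exact hball i d le_rfl ▸ Set.mem_image_of_mem φ (hi q hq)
    · rintro ⟨hh, i, hi⟩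
      have h0 := hi _ h.1.out_fst_mem
      have h0' := h0
      rw [hball i d le_rfl] at h0
      obtain ⟨p, hp, hpe⟩ := h0
      obtain ⟨g, hg, hpg, rfl⟩ := hlift i p d le_rfl hp (hpe ▸ h0') h hh
        (hpe ▸ h.1.out_fst_mem)
      refine ⟨g, ⟨hg, i, fun q hq => ?_⟩, rfl⟩
      -- The other endpoint of the lifted edge is only known to be at distance at most `d + 1`. This
      -- is why injectivity is required on the larger ball.
      have hq1 : q ∈ x.graph.ball (x.root i) (d + 1) := by
        by_cases hpq : p = q
        · exact LGraph.ball_subset_succ _ _ _ (hpq ▸ hp)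
        · exact Or.inr ⟨p, hp, LGraph.adj_of_edge hg ((Sym2.mem_and_mem_iff hpq).1 ⟨hpg, hq⟩)⟩
      have h2 := hi (φ q) (Sym2.mem_map.2 ⟨q, hq, rfl⟩)
      rw [hball i d le_rfl] at h2
      obtain ⟨q', hq', hqq⟩ := h2
      have := hinj (Set.mem_iUnion.2 ⟨i, LGraph.ball_subset_succ _ _ _ hq'⟩)
        (Set.mem_iUnion.2 ⟨i, hq1⟩) hqq
      exact this ▸ hq'

/-- All edges at the vertices of a ball of radius `d` belong to the ball of radius `d + 1`, so an
isomorphism of the larger balls satisfies the hypotheses of `jIso_of_local`. -/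
theorem JIso.of_succ {x y : RGraph m} {d : ℕ} (h : JIso (d + 1) x y) : JIso d x y := by
  obtain ⟨φ, ⟨hbij, hedges⟩, hroot⟩ := h
  have hend : ∀ (z : RGraph m) (i : Fin m) (r : ℕ), r ≤ d → ∀ p ∈ z.graph.ball (z.root i) r,
      ∀ g ∈ z.graph.edges, p ∈ g.1 → g ∈ (z.ball (d + 1)).graph.edges := by
    intro z i r hr p hp g hg hpg
    refine ⟨hg, i, fun q hq => LGraph.ball_mono _ _ (by omega : r + 1 ≤ d + 1) ?_⟩
    by_cases hpq : p = q
    · exact LGraph.ball_subset_succ _ _ _ (hpq ▸ hp)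
    · exact Or.inr ⟨p, hp, LGraph.adj_of_edge hg ((Sym2.mem_and_mem_iff hpq).1 ⟨hpg, hq⟩)⟩
  have hsub : ∀ (i : Fin m), x.graph.ball (x.root i) (d + 1) ⊆ (x.ball (d + 1)).graph.verts :=
    fun i p hp => ⟨ball_root_subset_verts x i _ hp, Set.mem_iUnion.2 ⟨i, hp⟩⟩
  refine jIso_of_local hroot (hbij.injOn.mono (Set.iUnion_subset hsub)) ?_ ?_
  · intro i p hp g hg hpg
    have := Set.mem_image_of_mem (LEdge.map φ) (hend x i d le_rfl p hp g hg hpg)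
    rw [hedges] at this
    exact this.1
  · intro i p r hr hp hφp h hh hph
    have h1 := hend y i r hr _ hφp h hh hph
    rw [← hedges] at h1
    obtain ⟨g, hg, rfl⟩ := h1
    refine ⟨g, hg.1, ?_, rfl⟩
    obtain ⟨q, hq, hqp⟩ := Sym2.mem_map.1 hph
    have := hbij.injOn ((x.ball (d + 1)).graph.mem_verts g hg q hq)
      (hsub i (LGraph.ball_mono _ _ (by omega : r ≤ d + 1) hp)) hqp
    exact this ▸ hq

theorem JIso.of_le {x y : RGraph m} {i j : ℕ} (hij : i ≤ j) (h : JIso j x y) : JIso i x y := by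
  induction j, hij using Nat.le_induction with
  | base => exact h
  | succ j hj ih => exact ih h.of_succ

theorem locDist_le_of_jIso {x y : RGraph m} {d : ℕ} (h : JIso d x y) :
    locDist x y ≤ (1 / 2 : ℝ) ^ d := by
  unfold locDist
  split_ifs with hall
  · positivity
  · refine pow_le_pow_of_le_one (by norm_num) (by norm_num) (le_csSup ?_ h)
    push Not at hall
    obtain ⟨j, hj⟩ := hall
    -- Boundedness matters because the supremum of an unbounded set of integers is `0` by
    -- convention. It holds because a failure at `j` persists at all larger radii.
    refine ⟨j, fun i hi => ?_⟩
    by_contra hlt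
    exact hj (JIso.of_le (not_le.1 hlt).le hi)

theorem LocallyContinuous.exists_jIso {F : RGraph m → ℝ} (hF : LocallyContinuous F)
    (x : RGraph m) {ε : ℝ} (hε : 0 < ε) : ∃ d, ∀ y, JIso d x y → |F y - F x| < ε := by
  obtain ⟨δ, hδ, h⟩ := hF x ε hε
  obtain ⟨d, hd⟩ := exists_pow_lt_of_lt_one hδ (by norm_num : (1 / 2 : ℝ) < 1)
  exact ⟨d, fun y hy => h y ((locDist_le_of_jIso hy).trans_lt hd)⟩

end RGraph

theorem LEdge.map_id {V : Type} : LEdge.map (id : V → V) = id := by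
  funext e
  simp [LEdge.map]

/-! ### The status of a determined edge in a graph containing its ball -/

namespace LGraph

variable {V W : Type} {k : ℕ∞}

theorem finite_ball {G : LGraph V} (hG : G.LocallyFinite) {v : V} (hv : v ∈ G.verts) (j : ℕ) :
    (G.ball v j).Finite := by
  classical
  induction j with
  | zero => exact Set.finite_singleton v
  | succ j ih =>
    refine (ih.union (ih.biUnion fun u hu =>
      (hG u (ball_subset_verts hv j hu)).biUnion fun e _ => e.1.toFinset.finite_toSet)).subset ?_
    rintro w (h | ⟨u, hu, s, hs⟩)
    · exact Or.inl h
    · refine Or.inr (Set.mem_biUnion hu (Set.mem_biUnion (x := (s(u, w), s))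
        ⟨hs, Sym2.mem_mk_left _ _⟩ ?_))
      simp

theorem finite_edgeBall {G : LGraph V} (hG : G.LocallyFinite) {e : LEdge V} (he : e ∈ G.edges)
    (l : ℕ) : (G.edgeBall e l).Finite := by
  classical
  refine ((e.1.toFinset.finite_toSet).biUnion fun v (hv : v ∈ (e.1.toFinset : Set V)) =>
    finite_ball hG (G.mem_verts e he v (by simpa using hv)) l).subset ?_
  rintro w ⟨v, hv, hw⟩
  exact Set.mem_biUnion (by simpa using hv) hw

theorem finite_induce_edges {G : LGraph V} (hG : G.LocallyFinite) {B : Set V} (hB : B.Finite)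
    (hBv : B ⊆ G.verts) : (G.induce B).edges.Finite := by
  refine (hB.biUnion fun v hv => hG v (hBv hv)).subset ?_
  rintro e ⟨he, hv⟩
  exact Set.mem_biUnion (hv _ e.1.out_fst_mem) ⟨he, e.1.out_fst_mem⟩

/-- The induced ball is an extension of its own neighbourhood with boundary. Both graphs therefore
fall under the same alternative of `Sufficient`, applied at a time beyond all labels so that `upTo`
discards nothing. -/
theorem Determined.mem_iff_of_isExtension {G : LGraph V} {e : LEdge V} {l : ℕ}
    (hd : G.Determined k e l) (hG : G.LocallyFinite) (hlab : G.DistinctLabels) (he : e ∈ G.edges)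
    {H : LGraph W} {f : LEdge W} {B' S' : Set W}
    (h : G.IsExtension e (G.edgeBall e l) (G.edgeSphere e l) H f B' S') :
    f ∈ phiFin k H.edges ↔ e ∈ phiFin k (G.induce (G.edgeBall e l)).edges := by
  set B := G.edgeBall e l with hB
  have hBv : B ⊆ G.verts := edgeBall_subset_verts he l
  have hfin : (G.induce B).edges.Finite := finite_induce_edges hG (finite_edgeBall hG he l) hBv
  have hself : G.IsExtension e B (G.edgeSphere e l) (G.induce B) e B (G.edgeSphere e l) := by
    refine ⟨⟨(finite_edgeBall hG he l).subset fun _ h => h.2, hfin⟩,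
      fun a ha b hb => hlab a ha.1 b hb.1, ⟨⟨he, fun v hv => ?_⟩, fun v hv => ⟨hBv hv, hv⟩,
        fun v hv => ?_, edgeSphere_subset _ _ _, ?_⟩, id, ⟨?_, ?_⟩, Set.image_id _, ?_⟩
    · exact edgeBall_mono G e (Nat.zero_le _) (mem_edgeBall_zero hv)
    · exact edgeBall_mono G e (Nat.zero_le _) (mem_edgeBall_zero hv)
    · rintro v hv w hw ⟨s, hs⟩
      exact absurd (hs.2 w (Sym2.mem_mk_right _ _)) hw
    · have : ((G.induce B).induce B).verts = (G.induce B).verts := by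
        ext v; exact ⟨fun h => h.1, fun h => ⟨h, h.2⟩⟩
      rw [this]
      exact Set.bijOn_id _
    · rw [LEdge.map_id, Set.image_id]
      ext g
      exact ⟨fun h => ⟨h, h.2⟩, fun h => h.1⟩
    · rw [LEdge.map_id, id]
  obtain ⟨t, ht⟩ : ∃ t, t ∈ upperBounds (Prod.snd '' H.edges ∪ Prod.snd '' (G.induce B).edges) :=
    ((h.1.2.image _).union (hfin.image _)).bddAbove
  have h1 : (H.upTo t).edges = H.edges := by
    ext a; exact ⟨fun h => h.1, fun h => ⟨h, ht (Or.inl ⟨a, h, rfl⟩)⟩⟩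
  have h2 : ((G.induce B).upTo t).edges = (G.induce B).edges := by
    ext a; exact ⟨fun h => h.1, fun h => ⟨h, ht (Or.inr ⟨a, h, rfl⟩)⟩⟩
  rw [← h1, ← h2]
  rcases hd t with hs | hs
  · exact iff_of_true (hs _ _ _ _ _ h) (hs _ _ _ _ _ hself)
  · exact iff_of_false (hs _ _ _ _ _ h) (hs _ _ _ _ _ hself)

/-- `φ` embeds the part of `G` of level at most `J` in `H`, and `H` has no other edge at the
vertices of level less than `J`. -/
structure LevelEmbeds (G : LGraph V) (lev : V → ℕ) (J : ℕ) (H : LGraph W) (φ : V → W) : Prop where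
  finite : H.IsFinite
  labels : H.DistinctLabels
  inj : Set.InjOn φ {v | v ∈ G.verts ∧ lev v ≤ J}
  lev_adj : ∀ u w, G.Adj u w → lev w ≤ lev u + 1
  map_mem : ∀ g ∈ G.edges, ∀ v ∈ g.1, lev v < J → LEdge.map φ g ∈ H.edges
  interior : ∀ v ∈ G.verts, lev v < J → ∀ h ∈ H.edges, φ v ∈ h.1 →
    ∃ g ∈ G.edges, v ∈ g.1 ∧ LEdge.map φ g = h

theorem lev_le_of_mem_ball {G : LGraph V} {lev : V → ℕ}
    (hadj : ∀ u w, G.Adj u w → lev w ≤ lev u + 1) {v : V} {r : ℕ} {w : V}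
    (h : w ∈ G.ball v r) : lev w ≤ lev v + r := by
  induction r generalizing w with
  | zero => obtain rfl : w = v := h; omega
  | succ r ih =>
    rcases h with h | ⟨u, hu, huw⟩
    · have := ih h; omega
    · have := ih hu
      have := hadj u w huw
      omega

/-- The ball of radius `l` around `e` only reaches level `d + l < J`. There `H` has no edges other
than the images of those of `G`, so the image of the ball is an extension in the sense of
`IsExtension`. -/
theorem LevelEmbeds.mem_phiFin_iff {G : LGraph V} {lev : V → ℕ} {J : ℕ} {H : LGraph W}
    {φ : V → W} (h : LevelEmbeds G lev J H φ) (hG : G.LocallyFinite) (hlab : G.DistinctLabels)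
    {e : LEdge V} (he : e ∈ G.edges) {d l : ℕ} (hed : ∀ v ∈ e.1, lev v ≤ d)
    (hJ : d + l < J) (hd : G.Determined k e l) :
    LEdge.map φ e ∈ phiFin k H.edges ↔ e ∈ phiFin k (G.induce (G.edgeBall e l)).edges := by
  have hlev : ∀ v ∈ G.edgeBall e l, lev v ≤ d + l := by
    rintro w ⟨v, hv, hw⟩
    have := lev_le_of_mem_ball h.lev_adj hw
    have := hed v hv
    omega
  set B := G.edgeBall e l with hB
  have hBv : B ⊆ G.verts := edgeBall_subset_verts he l
  have hBJ : B ⊆ {v | v ∈ G.verts ∧ lev v ≤ J} :=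
    fun v hv => ⟨hBv hv, (hlev v hv).trans hJ.le⟩
  have hends : ∀ v ∈ e.1, v ∈ B := fun v hv =>
    edgeBall_mono G e (Nat.zero_le _) (mem_edgeBall_zero hv)
  have hmapB : ∀ g ∈ G.edges, ∀ v ∈ g.1, v ∈ B → LEdge.map φ g ∈ H.edges := fun g hg v hv hvB =>
    h.map_mem g hg v hv ((hlev v hvB).trans_lt hJ)
  have hHv : ∀ v ∈ B, v ∈ G.verts ∧ lev v < J := fun v hv => ⟨hBv hv, (hlev v hv).trans_lt hJ⟩
  -- every vertex of the ball is incident to an edge of the graph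
  have hinc : ∀ v ∈ B, ∃ g ∈ G.edges, v ∈ g.1 := by
    rintro w ⟨v, hv, hw⟩
    have : ∀ r, ∀ w ∈ G.ball v r, ∃ g ∈ G.edges, w ∈ g.1 := by
      intro r
      induction r with
      | zero => rintro _ rfl; exact ⟨e, he, hv⟩
      | succ r ih =>
        rintro w (h | ⟨u, hu, s, hs⟩)
        · exact ih w h
        · exact ⟨_, hs, Sym2.mem_mk_right _ _⟩
    exact this _ _ hw
  refine hd.mem_iff_of_isExtension hG hlab he (B' := φ '' B) (S' := φ '' G.edgeSphere e l)
    ⟨h.finite, h.labels, ⟨?_, ?_, ?_, ?_, ?_⟩, φ, ⟨?_, ?_⟩, rfl, rfl⟩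
  · exact hmapB e he _ e.1.out_fst_mem (hends _ e.1.out_fst_mem)
  · rintro _ ⟨v, hv, rfl⟩
    obtain ⟨g, hg, hvg⟩ := hinc v hv
    exact H.mem_verts _ (hmapB g hg v hvg hv) _ (Sym2.mem_map.2 ⟨v, hvg, rfl⟩)
  · intro w hw
    obtain ⟨v, hv, rfl⟩ := Sym2.mem_map.1 hw
    exact ⟨v, hends v hv, rfl⟩
  · exact Set.image_mono (edgeSphere_subset G e l)
  · rintro _ ⟨v, hv, rfl⟩ w hw ⟨s, hs⟩
    by_contra hvS
    have hvS' : v ∉ G.edgeSphere e l := fun h => hvS ⟨v, h, rfl⟩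
    obtain ⟨g, hg, hvg, hgs⟩ := h.interior v (hHv v hv).1 (hHv v hv).2 _ hs (Sym2.mem_mk_left _ _)
    obtain ⟨u, hu⟩ := Sym2.mem_iff_exists.1 hvg
    have : s(φ v, φ u) = s(φ v, w) := by
      have := congrArg Prod.fst hgs
      simpa [LEdge.map, hu] using this
    rw [Sym2.congr_right] at this
    refine hw ⟨u, ?_, this⟩
    -- A vertex off the sphere lies in the ball of radius one less, so its neighbours stay in the
    -- ball. For radius `0` the sphere is the whole ball and there is nothing to prove.
    cases l with
    | zero => exact absurd hv hvS'
    | succ l =>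
      have : v ∈ G.edgeBall e l := by
        by_contra hcon
        exact hvS' ⟨hv, hcon⟩
      exact edgeBall_succ_of_adj this (adj_of_edge hg hu)
  · refine ⟨?_, h.inj.mono fun v hv => hBJ hv.2, ?_⟩
    · rintro v ⟨-, hv⟩
      obtain ⟨g, hg, hvg⟩ := hinc v hv
      exact ⟨H.mem_verts _ (hmapB g hg v hvg hv) _ (Sym2.mem_map.2 ⟨v, hvg, rfl⟩), v, hv, rfl⟩
    · rintro _ ⟨-, v, hv, rfl⟩
      exact ⟨v, ⟨hBv hv, hv⟩, rfl⟩
  · ext f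
    constructor
    · rintro ⟨g, ⟨hg, hgB⟩, rfl⟩
      refine ⟨hmapB g hg _ g.1.out_fst_mem (hgB _ g.1.out_fst_mem), fun w hw => ?_⟩
      obtain ⟨v, hv, rfl⟩ := Sym2.mem_map.1 hw
      exact ⟨v, hgB v hv, rfl⟩
    · rintro ⟨hf, hfB⟩
      obtain ⟨v, hv, hvf⟩ := hfB _ f.1.out_fst_mem
      obtain ⟨g, hg, hvg, rfl⟩ := h.interior v (hHv v hv).1 (hHv v hv).2 f hf
        (hvf ▸ f.1.out_fst_mem)
      refine ⟨g, ⟨hg, fun u hu => ?_⟩, rfl⟩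
      obtain ⟨u', hu', huu⟩ := hfB (φ u) (Sym2.mem_map.2 ⟨u, hu, rfl⟩)
      have hul : lev u ≤ J := by
        by_cases hvu : v = u
        · exact hvu ▸ (hHv v hv).2.le
        · have := h.lev_adj v u (adj_of_edge hg ((Sym2.mem_and_mem_iff hvu).1 ⟨hvg, hu⟩))
          have := hlev v hv
          omega
      exact h.inj (hBJ hu') ⟨G.mem_verts g hg u hu, hul⟩ huu ▸ hu'

theorem mem_phi_iff_isLeast {G : LGraph V} {e : LEdge V} (he : e ∈ G.edges) {l : ℕ}
    (hl : IsLeast {l | G.Determined k e l} l) :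
    e ∈ (G.phi k).edges ↔ e ∈ phiFin k (G.induce (G.edgeBall e l)).edges := by
  constructor
  · rintro ⟨-, l', hl', h⟩
    rwa [hl.unique hl']
  · exact fun h => ⟨he, l, hl, h⟩

/-- Levels beyond which all embeddings preserve the status of a given edge. -/
theorem IsOmegaPlus.exists_level {G : LGraph V} (hG : G.IsOmegaPlus k) {lev : V → ℕ}
    {e : LEdge V} (he : e ∈ G.edges) : ∃ J₀, ∀ J ≥ J₀, ∀ (W : Type) (H : LGraph W) (φ : V → W),
      LevelEmbeds G lev J H φ → (LEdge.map φ e ∈ phiFin k H.edges ↔ e ∈ (G.phi k).edges) := by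
  classical
  have hex := hG.2.2 e he
  have hleast : IsLeast {l | G.Determined k e l} (Nat.find hex) :=
    ⟨Nat.find_spec hex, fun l hl => Nat.find_min' hex hl⟩
  obtain ⟨d, hd⟩ : ∃ d, ∀ v ∈ e.1, lev v ≤ d := by
    obtain ⟨d, hd⟩ := (e.1.toFinset.image lev).bddAbove
    exact ⟨d, fun v hv => hd (by
      simp only [Finset.coe_image, Set.mem_image]
      exact ⟨v, by simpa using hv, rfl⟩)⟩
  refine ⟨d + Nat.find hex + 1, fun J hJ W H φ h => ?_⟩
  rw [mem_phi_iff_isLeast he hleast,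
    h.mem_phiFin_iff hG.1 hG.2.1 he hd (by omega) (Nat.find_spec hex)]

end LGraph

/-! ### Local comparison of the forbidden degree forest with finite graphs -/

theorem LEdge.map_map {U V W : Type} (ψ : V → W) (φ : U → V) (e : LEdge U) :
    LEdge.map ψ (LEdge.map φ e) = LEdge.map (fun u => ψ (φ u)) e := by
  simp [LEdge.map, Sym2.map_map]

theorem pgwTree_parent_mem {t : ℝ} {M : List ℕ → ℕ × ℝ} {i : ℕ} {u : List ℕ}
    (h : i :: u ∈ (pgwTree t M).verts) : u ∈ (pgwTree t M).verts :=
  fun j w hw => h j w (hw.trans (List.suffix_cons i _))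

theorem pgwTree_cons_mem {t : ℝ} {M : List ℕ → ℕ × ℝ} {i : ℕ} {u : List ℕ} :
    i :: u ∈ (pgwTree t M).verts ↔ u ∈ (pgwTree t M).verts ∧ i < (M u).1 := by
  refine ⟨fun h => ⟨pgwTree_parent_mem h, h i u (List.suffix_refl _)⟩, ?_⟩
  rintro ⟨h, hi⟩ j w hw
  rcases List.suffix_cons_iff.1 hw with hw | hw
  · obtain ⟨rfl, rfl⟩ := List.cons.inj hw
    exact hi
  · exact h j w hw

theorem pgwTree_nil_mem {t : ℝ} {M : List ℕ → ℕ × ℝ} : [] ∈ (pgwTree t M).verts := by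
  intro j w h
  simp at h

theorem pgwTree_mem_edges {t : ℝ} {M : List ℕ → ℕ × ℝ} {e : LEdge (List ℕ)} :
    e ∈ (pgwTree t M).edges ↔ ∃ i u, i :: u ∈ (pgwTree t M).verts ∧
      e = (s(u, i :: u), t * (M (i :: u)).2) := Iff.rfl

theorem pgwTree_adj_length {t : ℝ} {M : List ℕ → ℕ × ℝ} (u w : List ℕ)
    (h : (pgwTree t M).Adj u w) : w.length ≤ u.length + 1 := by
  obtain ⟨s, i, x, -, hx⟩ := h
  have := (Prod.mk.inj hx).1
  rw [Sym2.eq_iff] at this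
  rcases this with ⟨rfl, rfl⟩ | ⟨rfl, rfl⟩ <;> simp
  omega

theorem pgwTree_finite_level (t : ℝ) (M : List ℕ → ℕ × ℝ) (d : ℕ) :
    {u | u ∈ (pgwTree t M).verts ∧ u.length ≤ d}.Finite := by
  induction d with
  | zero =>
    refine (Set.finite_singleton []).subset ?_
    rintro u ⟨-, hu⟩
    exact List.length_eq_zero_iff.1 (Nat.le_zero.1 hu)
  | succ d ih =>
    refine ((Set.finite_singleton []).union (ih.biUnion fun u _ =>
      (Set.finite_Iio (M u).1).image fun i => i :: u)).subset ?_
    rintro u ⟨hu, hul⟩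
    cases u with
    | nil => exact Or.inl rfl
    | cons i u =>
      rw [pgwTree_cons_mem] at hu
      exact Or.inr (Set.mem_biUnion (x := u) ⟨hu.1, by simpa using hul⟩ ⟨i, hu.2, rfl⟩)

variable {m : ℕ} {k : ℕ∞}

theorem rootedForbiddenForest_adj_length {t : ℝ} {M : Fin m → List ℕ → ℕ × ℝ}
    (p q : Fin m × List ℕ) 
    (h : (LGraph.disjointUnion fun i => forbiddenTree k t (M i)).Adj p q) :
    q.2.length ≤ p.2.length + 1 := by
  obtain ⟨s, i, f, hf, hfe⟩ := h
  have hf' : f ∈ (pgwTree t (M i)).edges := hf.1.1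
  obtain ⟨u, w⟩ := f
  induction u with | _ u v
  have := (Prod.mk.inj hfe).1
  simp only [Sym2.map_mk, Sym2.eq_iff] at this
  have h1 : (pgwTree t (M i)).Adj u v := ⟨w, hf'⟩
  rcases this with ⟨rfl, rfl⟩ | ⟨rfl, rfl⟩
  · exact pgwTree_adj_length _ _ h1
  · exact pgwTree_adj_length _ _ h1.symm

/-- A sufficiently deep embedding of the trees in a finite graph induces an isomorphism of the balls
of the forbidden degree versions. -/
theorem exists_jIso_level {t : ℝ} {M : Fin m → List ℕ → ℕ × ℝ}
    (hM : ∀ i, (pgwTree t (M i)).IsOmegaPlus k) (d : ℕ) :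
    ∃ J₀, ∀ J ≥ J₀, ∀ (N : ℕ) (P : PairEdge N → PointConfig) (v : Fin m → Fin N)
      (φ : Fin m × List ℕ → Fin N),
      (∀ i, LGraph.LevelEmbeds (pgwTree t (M i)) List.length J (erGraph t P) fun u => φ (i, u)) →
      Set.InjOn φ {p | p.2 ∈ (pgwTree t (M p.1)).verts ∧ p.2.length ≤ J} →
      (∀ i, φ (i, []) = v i) →
      RGraph.JIso d (rootedForbiddenForest k t M) (rootedForbiddenGraph k t P v) := by
  classical
  have hEfin : ∀ i, {e | e ∈ (pgwTree t (M i)).edges ∧ ∃ v ∈ e.1, v.length ≤ d}.Finite := by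
    intro i
    refine ((pgwTree_finite_level t (M i) d).biUnion fun v hv =>
      pgwTree_locallyFinite t (M i) v hv.1).subset ?_
    rintro e ⟨he, v, hv, hvd⟩
    exact Set.mem_biUnion ⟨(pgwTree t (M i)).mem_verts e he v hv, hvd⟩ ⟨he, hv⟩
  have hlevel : ∀ i, ∃ J₀, ∀ e ∈ (pgwTree t (M i)).edges, (∃ v ∈ e.1, v.length ≤ d) →
      ∀ J ≥ J₀, ∀ (W : Type) (H : LGraph W) (φ : List ℕ → W),
      LGraph.LevelEmbeds (pgwTree t (M i)) List.length J H φ →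
      (LEdge.map φ e ∈ phiFin k H.edges ↔ e ∈ ((pgwTree t (M i)).phi k).edges) := by
    intro i
    have h1 : ∀ e : LEdge (List ℕ), ∃ J₀, e ∈ (pgwTree t (M i)).edges → ∀ J ≥ J₀,
        ∀ (W : Type) (H : LGraph W) (φ : List ℕ → W),
        LGraph.LevelEmbeds (pgwTree t (M i)) List.length J H φ →
        (LEdge.map φ e ∈ phiFin k H.edges ↔ e ∈ ((pgwTree t (M i)).phi k).edges) := by
      intro e
      by_cases he : e ∈ (pgwTree t (M i)).edges
      · obtain ⟨J₀, h⟩ := (hM i).exists_level (lev := List.length) he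
        exact ⟨J₀, fun _ => h⟩
      · exact ⟨0, fun h => absurd h he⟩
    choose j₀ hj₀ using h1
    obtain ⟨J₀, hJ₀⟩ := ((hEfin i).image j₀).bddAbove
    exact ⟨J₀, fun e he hed J hJ => hj₀ e he J ((hJ₀ ⟨e, ⟨he, hed⟩, rfl⟩).trans hJ)⟩
  choose j₁ hj₁ using hlevel
  obtain ⟨J₁, hJ₁⟩ := (Set.finite_range j₁).bddAbove
  -- `J₁` settles the status of the finitely many edges meeting height at most `d`, and `d + 2`
  -- leaves room for the balls of radius `d + 1` on which injectivity is needed.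
  refine ⟨max J₁ (d + 2), fun J hJ N P v φ hemb hinj hroot => ?_⟩
  have hkeep : ∀ i, ∀ e ∈ (pgwTree t (M i)).edges, (∃ v ∈ e.1, v.length ≤ d) →
      (LEdge.map (fun u => φ (i, u)) e ∈ phiFin k (erGraph t P).edges ↔
        e ∈ ((pgwTree t (M i)).phi k).edges) := fun i e he hed =>
    hj₁ i e he hed J ((hJ₁ ⟨i, rfl⟩).trans ((le_max_left _ _).trans hJ)) _ _ _ (hemb i)
  have hJd : d + 2 ≤ J := (le_max_right _ _).trans hJ
  set x := rootedForbiddenForest k t M with hx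
  have hverts : ∀ i r, ∀ p ∈ x.graph.ball (x.root i) r,
      p.2 ∈ (forbiddenTree k t (M p.1)).verts ∧ p.2.length ≤ r := by
    intro i r p hp
    refine ⟨RGraph.ball_root_subset_verts x i r hp, ?_⟩
    have := LGraph.lev_le_of_mem_ball (lev := fun p : Fin m × List ℕ => p.2.length)
      rootedForbiddenForest_adj_length hp
    have h0 : (x.root i).2.length = 0 := rfl
    simpa [h0] using this
  refine RGraph.jIso_of_local (φ := φ) hroot ?_ ?_ ?_
  · refine hinj.mono (Set.iUnion_subset fun i p hp => ?_)
    obtain ⟨h1, h2⟩ := hverts i _ p hp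
    exact ⟨h1.1, by omega⟩
  · rintro i p hp _ ⟨j, f, hf, rfl⟩ hpg
    obtain ⟨u, hu, rfl⟩ := Sym2.mem_map.1 hpg
    obtain ⟨h1, h2⟩ := hverts i _ _ hp
    have hfT : f ∈ (pgwTree t (M j)).edges := hf.1.1
    change LEdge.map φ (LEdge.map (Prod.mk j) f) ∈ (forbiddenGraph k t P).edges
    rw [LEdge.map_map]
    exact ⟨(hemb j).map_mem f hfT u hu (by simp only at h2; omega),
      (hkeep j f hfT ⟨u, hu, h2⟩).2 hf.1⟩
  · rintro i ⟨j, u⟩ r hr hp - h ⟨hh, hhk⟩ hph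
    obtain ⟨h1, h2⟩ := hverts i _ _ hp
    simp only at h1 h2
    obtain ⟨g, hg, hug, rfl⟩ := (hemb j).interior u h1.1 (by omega) h hh hph
    have hgphi := (hkeep j g hg ⟨u, hug, by omega⟩).1 hhk
    refine ⟨LEdge.map (Prod.mk j) g, ⟨j, g, ⟨hgphi, fun w hw => ?_⟩, rfl⟩,
      Sym2.mem_map.2 ⟨u, hug, rfl⟩, LEdge.map_map _ _ _⟩
    -- The limiting tree is a connected component, so one has to check that the other endpoint of a
    -- kept edge belongs to it as well.
    obtain ⟨r', hr'⟩ := Set.mem_iUnion.1 h1.2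
    by_cases huw : u = w
    · exact Set.mem_iUnion.2 ⟨r', huw ▸ hr'⟩
    · exact Set.mem_iUnion.2 ⟨r' + 1, Or.inr ⟨u, hr',
        LGraph.adj_of_edge hgphi ((Sym2.mem_and_mem_iff huw).1 ⟨hug, hw⟩)⟩⟩

/-! ### Measurability of random labelled graphs -/

variable {Ω : Type*} [MeasurableSpace Ω] {V I : Type} {m : ℕ} {k : ℕ∞}

/-- The labelled edges of the indices `i` that are active at `ω`. -/
def activeEdges (E : I → Sym2 V) (s : I → Ω → ℝ) (act : I → Set Ω) (ω : Ω) : Set (LEdge V) :=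
  {e | ∃ i, ω ∈ act i ∧ e = (E i, s i ω)}

/-- The labels of the active indices are distinct. -/
def distinctEvent (s : I → Ω → ℝ) (act : I → Set Ω) : Set Ω :=
  {ω | ∀ i j, ω ∈ act i → ω ∈ act j → s i ω = s j ω → i = j}

/-- A random graph whose edges are indexed by a countable set, with measurable labels. -/
structure IsMeasurableGraph (G : Ω → LGraph V) (E : I → Sym2 V) (s : I → Ω → ℝ)
    (act : I → Set Ω) : Prop where
  verts : ∀ v, MeasurableSet {ω | v ∈ (G ω).verts}
  label : ∀ i, Measurable (s i)
  measurable_act : ∀ i, MeasurableSet (act i)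
  edges : ∀ ω, (G ω).edges = activeEdges E s act ω

section

variable [Countable I] {E : I → Sym2 V} {s : I → Ω → ℝ} {act : I → Set Ω}
  {G : Ω → LGraph V}

theorem measurableSet_distinctEvent (hs : ∀ i, Measurable (s i))
    (hact : ∀ i, MeasurableSet (act i)) : MeasurableSet (distinctEvent s act) := by
  have : distinctEvent s act =
      ⋂ i, ⋂ j, ((act i)ᶜ ∪ (act j)ᶜ ∪ {ω | s i ω = s j ω}ᶜ ∪ {_ω | i = j}) := by
    ext ω
    simp only [distinctEvent, Set.mem_ofPred_eq, Set.mem_iInter, Set.mem_union, Set.mem_compl_iff]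
    refine forall_congr' fun i => forall_congr' fun j => ?_
    tauto
  rw [this]
  refine MeasurableSet.iInter fun i => MeasurableSet.iInter fun j => ?_
  exact (((hact i).compl.union (hact j).compl).union
    (measurableSet_eq_fun (hs i) (hs j)).compl).union (MeasurableSet.const _)

namespace IsMeasurableGraph

theorem adj (h : IsMeasurableGraph G E s act) (u w : V) :
    MeasurableSet {ω | (G ω).Adj u w} := by
  have : {ω | (G ω).Adj u w} = ⋃ i, act i ∩ {_ω | E i = s(u, w)} := by
    ext ω
    simp only [LGraph.Adj, h.edges, activeEdges, Set.mem_ofPred_eq, Set.mem_iUnion,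
      Set.mem_inter_iff]
    constructor
    · rintro ⟨r, i, hi, hr⟩
      exact ⟨i, hi, (Prod.mk.inj hr).1.symm⟩
    · rintro ⟨i, hi, hE⟩
      exact ⟨s i ω, i, hi, by rw [hE]⟩
  rw [this]
  exact MeasurableSet.iUnion fun i => (h.measurable_act i).inter (MeasurableSet.const _)

theorem mem_ball [Countable V] (h : IsMeasurableGraph G E s act) (v w : V) (r : ℕ) :
    MeasurableSet {ω | w ∈ (G ω).ball v r} := by
  induction r generalizing w with
  | zero => exact MeasurableSet.const (w = v)
  | succ r ih =>
    have : {ω | w ∈ (G ω).ball v (r + 1)} = {ω | w ∈ (G ω).ball v r} ∪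
        ⋃ u, {ω | u ∈ (G ω).ball v r} ∩ {ω | (G ω).Adj u w} := by
      ext ω
      simp [LGraph.ball]
    rw [this]
    exact (ih w).union (MeasurableSet.iUnion fun u => (ih u).inter (h.adj u w))

theorem mem_component [Countable V] (h : IsMeasurableGraph G E s act) (v w : V) :
    MeasurableSet {ω | w ∈ ⋃ j, (G ω).ball v j} := by
  simp only [Set.mem_iUnion]
  exact measurableSet_setOfPred.2 (Measurable.exists fun j =>
    measurableSet_setOfPred.1 (h.mem_ball v w j))

/-- Random rooted graphs described by measurable data are measurable for the σ-algebra generated by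
the cylinders. -/
theorem measurable_rooted [Countable V] (h : IsMeasurableGraph G E s act)
    (hinj : ∀ ω i j, ω ∈ act i → ω ∈ act j → E i = E j → s i ω = s j ω → i = j)
    {r : Ω → Fin m → V} (hr : ∀ q x, MeasurableSet {ω | r ω q = x})
    (hmem : ∀ ω q, r ω q ∈ (G ω).verts) (hfin : ∀ ω, (G ω).LocallyFinite) :
    Measurable fun ω => (⟨V, G ω, r ω, hmem ω, hfin ω⟩ : RGraph m) := by
  refine measurable_generateFrom ?_
  rintro _ ⟨j, N, M, ends, ρ, A, hA, rfl⟩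
  have hrball : ∀ q w, MeasurableSet {ω | w ∈ (G ω).ball (r ω q) j} := by
    intro q w
    have : {ω | w ∈ (G ω).ball (r ω q) j} = ⋃ x, {ω | r ω q = x} ∩ {ω | w ∈ (G ω).ball x j} := by
      ext ω; simp
    rw [this]
    exact MeasurableSet.iUnion fun x => (hr q x).inter (h.mem_ball x w j)
  let BV : V → Set Ω := fun w => {ω | w ∈ (G ω).verts ∧ ∃ q, w ∈ (G ω).ball (r ω q) j}
  let BE : I → Set Ω := fun i => {ω | ω ∈ act i ∧ ∃ q, ∀ w, w ∈ E i → w ∈ (G ω).ball (r ω q) j}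
  have hBV : ∀ w, MeasurableSet (BV w) := by
    intro w
    refine (h.verts w).inter ?_
    exact measurableSet_setOfPred.2 (Measurable.exists fun q =>
      measurableSet_setOfPred.1 (hrball q w))
  have hBE : ∀ i, MeasurableSet (BE i) := by
    intro i
    refine (h.measurable_act i).inter ?_
    refine measurableSet_setOfPred.2 (Measurable.exists fun q => Measurable.forall fun w => ?_)
    exact Measurable.imp measurable_const (measurableSet_setOfPred.1 (hrball q w))
  -- The isomorphism with the prescribed finite graph is turned into a choice of vertices `φ` and of
  -- edge indices `ι`. There are countably many choices, and for each of them the event only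
  -- involves membership in the ball and labels.
  have key : (fun ω => (⟨V, G ω, r ω, hmem ω, hfin ω⟩ : RGraph m)) ⁻¹'
      RGraph.cylinder j N M ends ρ A = ⋃ φ : Fin N → V, ⋃ ι : Fin M → I,
      {ω | (φ.Injective ∧ ι.Injective ∧ ∀ a, E (ι a) = (ends a).map φ) ∧
        (∀ w, ω ∈ BV w ↔ w ∈ Set.range φ) ∧ (∀ i, ω ∈ BE i ↔ i ∈ Set.range ι) ∧
        (∀ q, r ω q = φ (ρ q)) ∧ ∀ a, s (ι a) ω ∈ A a} := by
    ext ω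
    have hedge : ∀ e : LEdge V, e ∈ ((⟨V, G ω, r ω, hmem ω, hfin ω⟩ : RGraph m).ball j).graph.edges ↔
        ∃ i, ω ∈ BE i ∧ e = (E i, s i ω) := by
      intro e
      change (e ∈ (G ω).edges ∧ ∃ q, ∀ w ∈ e.1, w ∈ (G ω).ball (r ω q) j) ↔ _
      rw [h.edges]
      constructor
      · rintro ⟨⟨i, hi, rfl⟩, hq⟩
        exact ⟨i, ⟨hi, hq⟩, rfl⟩
      · rintro ⟨i, ⟨hi, hq⟩, rfl⟩
        exact ⟨⟨i, hi, rfl⟩, hq⟩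
    have hvert : ∀ w : V, w ∈ ((⟨V, G ω, r ω, hmem ω, hfin ω⟩ : RGraph m).ball j).graph.verts ↔
        ω ∈ BV w := by
      intro w
      change (w ∈ (G ω).verts ∧ w ∈ ⋃ q, (G ω).ball (r ω q) j) ↔ _
      rw [Set.mem_iUnion]
      rfl
    have hEinj : ∀ i j, ω ∈ BE i → ω ∈ BE j → (E i, s i ω) = (E j, s j ω) → i = j :=
      fun i j hi hj hij => hinj ω i j hi.1 hj.1 (Prod.mk.inj hij).1 (Prod.mk.inj hij).2
    simp only [Set.mem_preimage, Set.mem_iUnion, Set.mem_ofPred_eq, RGraph.cylinder]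
    constructor
    · rintro ⟨φ, lab, hφ, hlab, hroot, hlabA⟩
      have hch : ∀ a, ∃ i, ω ∈ BE i ∧ ((ends a).map φ, lab a) = (E i, s i ω) := fun a =>
        (hedge _).1 (hlab.mapsTo (Set.mem_univ a))
      choose ι hι hιe using hch
      refine ⟨φ, ι, ⟨Set.injOn_univ.1 hφ.injOn, fun a b hab => ?_,
        fun a => ((Prod.mk.inj (hιe a)).1).symm⟩, fun w => ?_, fun i => ⟨fun hi => ?_, ?_⟩,
        fun q => (hroot q).symm, fun a => ?_⟩
      · refine hlab.injOn (Set.mem_univ a) (Set.mem_univ b) ?_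
        rw [hιe a, hιe b, hab]
      · rw [← hvert w, ← hφ.image_eq, Set.image_univ]; rfl
      · obtain ⟨a, -, ha⟩ := hlab.surjOn ((hedge _).2 ⟨i, hi, rfl⟩)
        exact ⟨a, hEinj _ _ (hι a) hi (by rw [← hιe a]; exact ha)⟩
      · rintro ⟨a, rfl⟩; exact hι a
      · rw [← (Prod.mk.inj (hιe a)).2]; exact hlabA a
    · rintro ⟨φ, ι, ⟨hφ, hι, hE⟩, hV, hI, hroot, hlabA⟩
      have hf : ∀ a, ((ends a).map φ, s (ι a) ω) = (E (ι a), s (ι a) ω) := fun a => by rw [hE]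
      refine ⟨φ, fun a => s (ι a) ω, ⟨fun a _ => ?_, hφ.injOn, fun w hw => ?_⟩,
        ⟨fun a _ => ?_, fun a _ b _ hab => ?_, fun e he => ?_⟩, fun q => (hroot q).symm, hlabA⟩
      · exact (hvert _).2 ((hV _).2 ⟨a, rfl⟩)
      · obtain ⟨a, ha⟩ := (hV w).1 ((hvert w).1 hw)
        exact ⟨a, Set.mem_univ _, ha⟩
      · exact (hedge _).2 ⟨ι a, (hI _).2 ⟨a, rfl⟩, hf a⟩
      · change ((ends a).map φ, s (ι a) ω) = ((ends b).map φ, s (ι b) ω) at hab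
        rw [hf, hf] at hab
        exact hι (hEinj _ _ ((hI _).2 ⟨a, rfl⟩) ((hI _).2 ⟨b, rfl⟩) hab)
      · obtain ⟨i, hi, rfl⟩ := (hedge e).1 he
        obtain ⟨a, rfl⟩ := (hI i).1 hi
        exact ⟨a, Set.mem_univ _, hf a⟩
  rw [key]
  refine MeasurableSet.iUnion fun φ => MeasurableSet.iUnion fun ι => ?_
  refine (MeasurableSet.const _).inter (MeasurableSet.inter ?_ (MeasurableSet.inter ?_
    (MeasurableSet.inter ?_ ?_)))
  · refine measurableSet_setOfPred.2 (Measurable.forall fun w => ?_)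
    exact (measurableSet_setOfPred.1 (hBV w)).iff measurable_const
  · refine measurableSet_setOfPred.2 (Measurable.forall fun i => ?_)
    exact (measurableSet_setOfPred.1 (hBE i)).iff measurable_const
  · refine measurableSet_setOfPred.2 (Measurable.forall fun q => ?_)
    exact measurableSet_setOfPred.1 (hr q _)
  · refine measurableSet_setOfPred.2 (Measurable.forall fun a => ?_)
    exact measurableSet_setOfPred.1 (h.label (ι a) (hA a))

end IsMeasurableGraph

/-- On the event that the labels are distinct, the set of edges kept by the dynamics is measurable.
-/
theorem measurableSet_kept (hs : ∀ i, Measurable (s i)) (hact : ∀ i, MeasurableSet (act i))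
    (hfin : ∀ ω, {i | ω ∈ act i}.Finite) (i : I) :
    MeasurableSet {ω | ω ∈ distinctEvent s act ∧ ω ∈ act i ∧
      (E i, s i ω) ∈ phiFin k (activeEdges E s act ω)} := by
  classical
  -- On the event of distinct labels, the dynamics only depends on the finite set of active indices
  -- and on the order of their labels. This gives countably many measurable cells, on each of which
  -- the status of `i` is constant by `phiFin_image`.
  let C : Finset I × Finset (I × I) → Set Ω := fun AR =>
    distinctEvent s act ∩ ({ω | ∀ i, ω ∈ act i ↔ i ∈ AR.1} ∩
      {ω | ∀ i j, i ∈ AR.1 ∧ j ∈ AR.1 → (s i ω < s j ω ↔ (i, j) ∈ AR.2)})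
  have hC : ∀ AR, MeasurableSet (C AR) := by
    intro AR
    refine (measurableSet_distinctEvent hs hact).inter (MeasurableSet.inter ?_ ?_)
    · refine measurableSet_setOfPred.2 (Measurable.forall fun i => ?_)
      exact (measurableSet_setOfPred.1 (hact i)).iff measurable_const
    · refine measurableSet_setOfPred.2 (Measurable.forall fun i => Measurable.forall fun j => ?_)
      exact Measurable.imp measurable_const
        ((measurableSet_setOfPred.1 (measurableSet_lt (hs i) (hs j))).iff measurable_const)
  set K : Set Ω := {ω | ω ∈ distinctEvent s act ∧ ω ∈ act i ∧
      (E i, s i ω) ∈ phiFin k (activeEdges E s act ω)} with hK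
  have hconst : ∀ AR, ∀ ω ∈ C AR, ∀ ω' ∈ C AR, ω ∈ K → ω' ∈ K := by
    rintro ⟨A, R⟩ ω ⟨hω, hωA, hωR⟩ ω' ⟨hω', hωA', hωR'⟩ ⟨-, hi, hk⟩
    simp only [Set.mem_ofPred_eq] at hωA hωR hωA' hωR'
    have hiA : ∀ j, ω ∈ act j ↔ ω' ∈ act j := fun j => (hωA j).trans (hωA' j).symm
    have hinj : Set.InjOn (fun j => (E j, s j ω)) {j | ω ∈ act j} := fun a ha b hb hab =>
      hω a b ha hb (Prod.mk.inj hab).2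
    obtain ⟨f, hf⟩ : ∃ f : LEdge V → LEdge V, ∀ j, ω ∈ act j →
        f (E j, s j ω) = (E j, s j ω') := by
      have : Nonempty I := ⟨i⟩
      refine ⟨fun e => (fun j => (E j, s j ω'))
        (Function.invFunOn (fun j => (E j, s j ω)) {j | ω ∈ act j} e), fun j hj => ?_⟩
      have := hinj.leftInvOn_invFunOn hj
      simp only at this ⊢
      rw [this]
    have himg : activeEdges E s act ω' = f '' activeEdges E s act ω := by
      ext e
      constructor
      · rintro ⟨j, hj, rfl⟩
        exact ⟨_, ⟨j, (hiA j).2 hj, rfl⟩, hf j ((hiA j).2 hj)⟩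
      · rintro ⟨_, ⟨j, hj, rfl⟩, rfl⟩
        exact ⟨j, (hiA j).1 hj, hf j hj⟩
    refine ⟨hω', (hiA i).1 hi, ?_⟩
    rw [himg, phiFin_image (φ := id)]
    · exact ⟨_, hk, hf i hi⟩
    · refine ((hfin ω).image fun j => (E j, s j ω)).subset ?_
      rintro e ⟨j, hj, rfl⟩
      exact ⟨j, hj, rfl⟩
    · rintro _ ⟨a, ha, rfl⟩ _ ⟨b, hb, rfl⟩ hab
      rw [hω a b ha hb hab]
    · exact Set.injOn_id _
    · rintro _ ⟨a, ha, rfl⟩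
      rw [hf a ha, Sym2.map_id, id]
    · rintro _ ⟨a, ha, rfl⟩ _ ⟨b, hb, rfl⟩ hab
      rw [hf a ha, hf b hb]
      have h1 := hωR a b ⟨(hωA a).1 ha, (hωA b).1 hb⟩
      have h2 := hωR' a b ⟨(hωA a).1 ha, (hωA b).1 hb⟩
      exact h2.2 (h1.1 hab)
  have hcover : ∀ ω ∈ K, ∃ AR, ω ∈ C AR := by
    rintro ω ⟨hω, -, -⟩
    refine ⟨((hfin ω).toFinset, ((hfin ω).toFinset ×ˢ (hfin ω).toFinset).filter
      fun p => s p.1 ω < s p.2 ω), hω, fun j => by simp, fun a b hab => ?_⟩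
    simp only [Finset.mem_filter, Finset.mem_product]
    exact ⟨fun h => ⟨hab, h⟩, fun h => h.2⟩
  have : K = ⋃ AR : {AR // ∃ ω ∈ C AR, ω ∈ K}, C AR.1 := by
    ext ω
    simp only [Set.mem_iUnion]
    constructor
    · intro hω
      obtain ⟨AR, hAR⟩ := hcover ω hω
      exact ⟨⟨AR, ω, hAR, hω⟩, hAR⟩
    · rintro ⟨⟨AR, ω₀, h0, h0K⟩, hω⟩
      exact hconst AR ω₀ h0 ω hω h0K
  rw [this]
  exact MeasurableSet.iUnion fun AR => hC AR.1

end

/-! ### Point configurations -/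

namespace PointConfig

theorem measurable_count {B : Set ℝ} (hB : MeasurableSet B) : Measurable (count B) :=
  Measurable.of_comap_le (le_iSup₂_of_le B hB le_rfl)

theorem measurable_of_count {α : Type*} [MeasurableSpace α] {f : α → PointConfig}
    (h : ∀ B, MeasurableSet B → Measurable fun x => (f x).count B) : Measurable f := by
  refine Measurable.of_le_map ?_
  refine iSup₂_le fun B hB => ?_
  rintro _ ⟨S, hS, rfl⟩
  exact h B hB hS

/-- The points of a configuration in `(-∞, t]`. -/
noncomputable def trunc (t : ℝ) (c : PointConfig) : PointConfig :=
  ⟨c.1 ∩ Set.Iic t, fun _ h => c.2.1 h.1, fun T => (c.2.2 T).subset fun _ h => ⟨h.1.1, h.2⟩⟩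

theorem measurable_trunc (t : ℝ) : Measurable (trunc t) := by
  refine measurable_of_count fun B hB => ?_
  have : (fun c => (trunc t c).count B) = count (Set.Iic t ∩ B) := by
    funext c
    simp only [count, trunc, Set.inter_assoc]
  rw [this]
  exact measurable_count (measurableSet_Iic.inter hB)

/-- The configuration without points. -/
def none : PointConfig := ⟨∅, Set.empty_subset _, fun _ => by simp⟩

/-- The configuration with the single point `s` (without points if `s < 0`). -/
def single (s : ℝ) : PointConfig :=
  ⟨{x | x = s ∧ 0 ≤ x}, fun _ h => h.2, fun _ => (Set.finite_singleton s).subset fun _ h => h.1.1⟩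

theorem count_single {s : ℝ} {B : Set ℝ} [Decidable (s ∈ B ∧ 0 ≤ s)] :
    (single s).count B = if s ∈ B ∧ 0 ≤ s then 1 else 0 := by
  split_ifs with h
  · have : (single s).1 ∩ B = {s} := by
      ext x
      constructor
      · exact fun hx => hx.1.1
      · rintro rfl; exact ⟨⟨rfl, h.2⟩, h.1⟩
    rw [count, this, Set.encard_singleton]
  · rw [count, Set.encard_eq_zero, Set.eq_empty_iff_forall_notMem]
    rintro x ⟨⟨rfl, h0⟩, hx⟩
    exact h ⟨hx, h0⟩

theorem measurable_single : Measurable single := by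
  classical
  refine measurable_of_count fun B hB => ?_
  simp only [count_single]
  exact Measurable.ite (hB.inter measurableSet_Ici) measurable_const measurable_const

theorem encard_Iic_finite (t : ℝ) (c : PointConfig) : c.count (Set.Iic t) ≠ ⊤ :=
  Set.encard_ne_top_iff.2 (c.2.2 t)

theorem exists_rank {F : Finset ℝ} {i : ℕ} (hi : i < F.card) :
    ∃ x ∈ F, (F.filter (· < x)).card = i := by
  have hmaps : Set.MapsTo (fun x => (F.filter (· < x)).card) F (Finset.range F.card) := by
    intro x hx
    simp only [Finset.coe_range, Set.mem_Iio]
    refine Finset.card_lt_card ⟨Finset.filter_subset _ _, fun h => ?_⟩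
    have := h hx
    simp at this
  have hinj : Set.InjOn (fun x => (F.filter (· < x)).card) F := by
    intro x hx y hy hxy
    by_contra hne
    have key : ∀ x ∈ F, ∀ y ∈ F, x < y → (F.filter (· < x)).card < (F.filter (· < y)).card := by
      intro x hx y hy hlt
      refine Finset.card_lt_card ⟨fun z hz => ?_, fun h => ?_⟩
      · rw [Finset.mem_filter] at hz ⊢
        exact ⟨hz.1, hz.2.trans hlt⟩
      · have := h (Finset.mem_filter.2 ⟨hx, hlt⟩)
        simp at this
    rcases lt_or_gt_of_ne hne with h | h
    · exact (key x hx y hy h).ne hxy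
    · exact (key y hy x hx h).ne' hxy
  have hs := Finset.surjOn_of_injOn_of_card_le _ hmaps hinj (by simp)
  obtain ⟨x, hx, hxi⟩ := hs (Finset.mem_coe.2 (Finset.mem_range.2 hi))
  exact ⟨x, hx, hxi⟩

theorem exists_nth (c : PointConfig) {t : ℝ} {i : ℕ} (hi : (i : ℕ∞) < c.count (Set.Iic t)) :
    ∃ x ∈ c.1, x ≤ t ∧ c.count (Set.Iio x) = i := by
  classical
  set F := (c.2.2 t).toFinset with hF
  have hcard : c.count (Set.Iic t) = F.card := by
    rw [count, Set.Finite.encard_eq_coe_toFinset_card (c.2.2 t)]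
  rw [hcard] at hi
  obtain ⟨x, hx, hxi⟩ := exists_rank (Nat.cast_lt.1 hi)
  have hx' : x ∈ c.1 ∧ x ≤ t := by simpa [hF] using hx
  refine ⟨x, hx'.1, hx'.2, ?_⟩
  rw [← hxi, ← Set.encard_coe_eq_coe_finsetCard, count]
  congr 1
  ext y
  simp only [hF, Set.mem_inter_iff, Set.mem_Iio, Finset.coe_filter, Set.Finite.mem_toFinset,
    Set.mem_Iic, Set.mem_ofPred_eq]
  exact ⟨fun h => ⟨⟨h.1, h.2.le.trans hx'.2⟩, h.2⟩, fun h => ⟨h.1.1, h.2⟩⟩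

open Classical in
/-- The point of rank `i` among the points in `(-∞, t]`. -/
noncomputable def nth (t : ℝ) (i : ℕ) (c : PointConfig) : ℝ :=
  if h : (i : ℕ∞) < c.count (Set.Iic t) then (c.exists_nth h).choose else 0

theorem nth_spec {c : PointConfig} {t : ℝ} {i : ℕ} (h : (i : ℕ∞) < c.count (Set.Iic t)) :
    nth t i c ∈ c.1 ∧ nth t i c ≤ t ∧ c.count (Set.Iio (nth t i c)) = i := by
  rw [nth, dif_pos h]
  exact (c.exists_nth h).choose_spec

theorem count_mono (c : PointConfig) {A B : Set ℝ} (h : A ⊆ B) : c.count A ≤ c.count B :=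
  Set.encard_le_encard (Set.inter_subset_inter_right _ h)

theorem count_Iio_add_one_le {c : PointConfig} {x y : ℝ} (hx : x ∈ c.1) (hxy : x ≤ y) :
    c.count (Set.Iio x) + 1 ≤ c.count (Set.Iic y) := by
  have : c.1 ∩ Set.Iio x ∪ {x} ⊆ c.1 ∩ Set.Iic y := by
    rintro z (⟨hz, hzx⟩ | rfl)
    · exact ⟨hz, (le_of_lt hzx).trans hxy⟩
    · exact ⟨hx, hxy⟩
  refine le_trans ?_ (Set.encard_le_encard this)
  rw [Set.encard_union_eq (by simp), Set.encard_singleton]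
  exact le_rfl

/-- Ranks start at `0`, and the point of rank `i` has exactly `i` points strictly below it. Its
comparison with `x` is thus a counting event, and such events generate the σ-algebra on
configurations. -/
theorem nth_le_iff {c : PointConfig} {t x : ℝ} {i : ℕ} (h : (i : ℕ∞) < c.count (Set.Iic t)) :
    nth t i c ≤ x ↔ (i : ℕ∞) < c.count (Set.Iic x) := by
  obtain ⟨h1, h2, h3⟩ := nth_spec h
  constructor
  · intro hx
    have := count_Iio_add_one_le h1 hx
    rw [h3] at this
    exact lt_of_lt_of_le (by exact_mod_cast Nat.lt_succ_self i) this
  · intro hi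
    by_contra hx
    have : c.count (Set.Iic x) ≤ c.count (Set.Iio (nth t i c)) :=
      c.count_mono fun z hz => lt_of_le_of_lt hz (not_le.1 hx)
    rw [h3] at this
    exact absurd hi (not_lt.2 this)

theorem measurable_nth (t : ℝ) (i : ℕ) : Measurable (nth t i) := by
  have hS : ∀ x, MeasurableSet {c : PointConfig | (i : ℕ∞) < c.count (Set.Iic x)} := fun x =>
    measurable_count measurableSet_Iic (show MeasurableSet (Set.Ioi (i : ℕ∞)) from
      MeasurableSet.of_discrete)
  refine measurable_of_Iic fun x => ?_
  have : nth t i ⁻¹' Set.Iic x = ({c | (i : ℕ∞) < c.count (Set.Iic t)} ∩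
      {c | (i : ℕ∞) < c.count (Set.Iic x)}) ∪
      ({c | (i : ℕ∞) < c.count (Set.Iic t)}ᶜ ∩ {_c | 0 ≤ x}) := by
    ext c
    by_cases h : (i : ℕ∞) < c.count (Set.Iic t)
    · simp [h, nth_le_iff h]
    · simp [h, nth]
  rw [this]
  exact ((hS t).inter (hS x)).union ((hS t).compl.inter (MeasurableSet.const _))

theorem nth_injective {c : PointConfig} {t : ℝ} {i j : ℕ} (hi : (i : ℕ∞) < c.count (Set.Iic t))
    (hj : (j : ℕ∞) < c.count (Set.Iic t)) (h : nth t i c = nth t j c) : i = j := by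
  have h1 := (nth_spec hi).2.2
  rw [h, (nth_spec hj).2.2] at h1
  exact_mod_cast h1.symm

theorem exists_nth_eq {c : PointConfig} {t x : ℝ} (hx : x ∈ c.1) (hxt : x ≤ t) :
    ∃ i : ℕ, (i : ℕ∞) < c.count (Set.Iic t) ∧ nth t i c = x := by
  have hfin : c.count (Set.Iio x) ≠ ⊤ :=
    ne_top_of_le_ne_top (c.encard_Iic_finite x) (c.count_mono Set.Iio_subset_Iic_self)
  lift c.count (Set.Iio x) to ℕ using hfin with i hi
  have h1 := count_Iio_add_one_le hx hxt
  rw [← hi] at h1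
  have hit : (i : ℕ∞) < c.count (Set.Iic t) :=
    lt_of_lt_of_le (by exact_mod_cast Nat.lt_succ_self i) h1
  refine ⟨i, hit, ?_⟩
  obtain ⟨h2, -, h3⟩ := nth_spec hit
  rcases lt_trichotomy (nth t i c) x with h | h | h
  · have h4 := count_Iio_add_one_le h2 (le_refl _)
    have h5 : c.count (Set.Iic (nth t i c)) ≤ c.count (Set.Iio x) :=
      c.count_mono fun z hz => lt_of_le_of_lt hz h
    rw [h3] at h4
    rw [← hi] at h5
    have := h4.trans h5
    norm_cast at this
    omega
  · exact h
  · have h4 := count_Iio_add_one_le hx (le_refl _)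
    have h5 : c.count (Set.Iic x) ≤ c.count (Set.Iio (nth t i c)) :=
      c.count_mono fun z hz => lt_of_le_of_lt hz h
    rw [← hi] at h4
    rw [h3] at h5
    have := h4.trans h5
    norm_cast at this
    omega

end PointConfig

/-! ### Measurability of the random graphs on a finite set of vertices -/

section ErGraph

variable {N m : ℕ} {k : ℕ∞} {t : ℝ}

/-- The configurations for which the point of rank `i` of the process of the pair `a` exists. -/
def pointEvent (t : ℝ) (p : PairEdge N × ℕ) : Set (PairEdge N → PointConfig) :=
  {P | (p.2 : ℕ∞) < (P p.1).count (Set.Iic t)}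

theorem measurableSet_pointEvent (p : PairEdge N × ℕ) : MeasurableSet (pointEvent t p) :=
  ((PointConfig.measurable_count measurableSet_Iic).comp (measurable_pi_apply p.1))
    (show MeasurableSet (Set.Ioi (p.2 : ℕ∞)) from MeasurableSet.of_discrete)

/-- The label of the point of rank `i` of the process of the pair `a`. -/
noncomputable def pointLabel (t : ℝ) (p : PairEdge N × ℕ) (P : PairEdge N → PointConfig) : ℝ :=
  (P p.1).nth t p.2

theorem measurable_pointLabel (p : PairEdge N × ℕ) : Measurable (pointLabel t p) :=
  (PointConfig.measurable_nth t p.2).comp (measurable_pi_apply p.1)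

theorem erGraph_edges_eq (P : PairEdge N → PointConfig) :
    (erGraph t P).edges = activeEdges (fun p : PairEdge N × ℕ => p.1.1) (pointLabel t)
      (pointEvent t) P := by
  ext e
  constructor
  · rintro ⟨a, ha, hs, hst⟩
    obtain ⟨i, hi, hie⟩ := PointConfig.exists_nth_eq hs hst
    exact ⟨(a, i), hi, Prod.ext ha hie.symm⟩
  · rintro ⟨⟨a, i⟩, hi, rfl⟩
    exact ⟨a, rfl, (PointConfig.nth_spec hi).1, (PointConfig.nth_spec hi).2.1⟩

theorem pointLabel_injective {P : PairEdge N → PointConfig} {p q : PairEdge N × ℕ}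
    (hp : P ∈ pointEvent t p) (hq : P ∈ pointEvent t q) (h : p.1 = q.1)
    (h' : pointLabel t p P = pointLabel t q P) : p = q := by
  obtain ⟨a, i⟩ := p
  obtain ⟨b, j⟩ := q
  obtain rfl : a = b := h
  exact congrArg (Prod.mk a) (PointConfig.nth_injective hp hq h')

theorem mem_distinctEvent_iff (P : PairEdge N → PointConfig) :
    P ∈ distinctEvent (pointLabel t) (pointEvent t) ↔ (erGraph t P).DistinctLabels := by
  unfold LGraph.DistinctLabels
  rw [erGraph_edges_eq]
  constructor
  · rintro h _ ⟨p, hp, rfl⟩ _ ⟨q, hq, rfl⟩ hpq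
    rw [h p q hp hq hpq]
  · intro h p q hp hq hpq
    have := h _ ⟨p, hp, rfl⟩ _ ⟨q, hq, rfl⟩ hpq
    exact pointLabel_injective hp hq (Subtype.ext (Prod.mk.inj this).1) hpq

theorem measurableSet_distinctLabels :
    MeasurableSet {P : PairEdge N → PointConfig | (erGraph t P).DistinctLabels} := by
  have : {P : PairEdge N → PointConfig | (erGraph t P).DistinctLabels} =
      distinctEvent (pointLabel t) (pointEvent t) := by
    ext P; exact (mem_distinctEvent_iff P).symm
  rw [this]
  exact measurableSet_distinctEvent measurable_pointLabel measurableSet_pointEvent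

/-- A measurable version of the random forbidden degree graph: it has no edges when two labels
coincide. -/
noncomputable def regularRootedGraph (k : ℕ∞) (t : ℝ)
    (x : (PairEdge N → PointConfig) × (Fin m → Fin N)) : RGraph m where
  V := Fin N
  graph := (forbiddenGraph k t x.1).filterEdges fun _ => (erGraph t x.1).DistinctLabels
  root := x.2
  root_mem := fun _ => trivial
  locallyFinite := fun _ _ => (erGraph_edges_finite t x.1).subset fun _ h => h.1.1.1

theorem regularRootedGraph_eq {x : (PairEdge N → PointConfig) × (Fin m → Fin N)}
    (h : (erGraph t x.1).DistinctLabels) :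
    regularRootedGraph k t x = rootedForbiddenGraph k t x.1 x.2 := by
  have : ((forbiddenGraph k t x.1).filterEdges fun _ => (erGraph t x.1).DistinctLabels) =
      forbiddenGraph k t x.1 := by
    simp [LGraph.filterEdges, h]
  unfold regularRootedGraph rootedForbiddenGraph
  congr 1

theorem measurable_regularRootedGraph :
    Measurable (regularRootedGraph (N := N) (m := m) k t) := by
  let E : PairEdge N × ℕ → Sym2 (Fin N) := fun p => p.1.1
  let act : PairEdge N × ℕ → Set ((PairEdge N → PointConfig) × (Fin m → Fin N)) := fun p =>
    {x | x.1 ∈ {P | P ∈ distinctEvent (pointLabel t) (pointEvent t) ∧ P ∈ pointEvent t p ∧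
      (E p, pointLabel t p P) ∈ phiFin k (activeEdges E (pointLabel t) (pointEvent t) P)}}
  have hmeas : IsMeasurableGraph (fun x : (PairEdge N → PointConfig) × (Fin m → Fin N) =>
      (forbiddenGraph k t x.1).filterEdges fun _ => (erGraph t x.1).DistinctLabels) E
      (fun p x => pointLabel t p x.1) act := by
    refine ⟨fun v => MeasurableSet.const True, fun p => (measurable_pointLabel p).comp measurable_fst,
      fun p => ?_, fun x => ?_⟩
    · refine measurable_fst (measurableSet_kept measurable_pointLabel measurableSet_pointEvent
        (fun P => ?_) p)
      -- Finitely many pairs, and ranks below the largest number of points up to time `t`.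
      refine ((Set.finite_univ (α := PairEdge N)).prod
        (Set.finite_Iio (Finset.univ.sup fun a => ((P a).count (Set.Iic t)).toNat))).subset ?_
      rintro ⟨a, i⟩ hi
      refine ⟨Set.mem_univ _, ?_⟩
      have h1 : i < ((P a).count (Set.Iic t)).toNat := by
        have h2 : (i : ℕ∞) < (P a).count (Set.Iic t) := hi
        rw [← ENat.natCast_toNat ((P a).encard_Iic_finite t)] at h2
        exact_mod_cast h2
      exact lt_of_lt_of_le h1 (Finset.le_sup
        (f := fun a => ((P a).count (Set.Iic t)).toNat) (Finset.mem_univ a))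
    · ext e
      change ((e ∈ (erGraph t x.1).edges ∧ e ∈ phiFin k (erGraph t x.1).edges) ∧
        (erGraph t x.1).DistinctLabels) ↔ _
      rw [erGraph_edges_eq, ← mem_distinctEvent_iff]
      constructor
      · rintro ⟨⟨⟨p, hp, rfl⟩, hk⟩, hd⟩
        exact ⟨p, ⟨hd, hp, hk⟩, rfl⟩
      · rintro ⟨p, ⟨hd, hp, hk⟩, rfl⟩
        exact ⟨⟨⟨p, hp, rfl⟩, hk⟩, hd⟩
  refine hmeas.measurable_rooted (r := fun x => x.2) ?_ ?_ _ _
  · rintro x p q hp hq hE hs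
    exact pointLabel_injective hp.2.1 hq.2.1 (Subtype.ext hE) hs
  · intro q y
    have : Measurable fun x : (PairEdge N → PointConfig) × (Fin m → Fin N) => x.2 q :=
      (measurable_pi_apply q).comp measurable_snd
    exact this (measurableSet_singleton y)

end ErGraph

/-! ### Measurability of the limiting forest -/

/-- The endpoints of the edge between the word `u` and its parent. -/
def wordEnds (u : List ℕ) : Sym2 (List ℕ) := s(u.tail, u)

theorem wordEnds_injective {u w : List ℕ} (h : wordEnds u = wordEnds w) : u = w := by
  rcases Sym2.eq_iff.1 h with ⟨-, h⟩ | ⟨h1, h2⟩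
  · exact h
  · have h3 := congrArg List.length h1
    have h4 := congrArg List.length h2
    rw [List.length_tail] at h3 h4
    have hu : u = [] := List.length_eq_zero_iff.1 (by omega)
    have hw : w = [] := List.length_eq_zero_iff.1 (by omega)
    rw [hu, hw]

variable {t : ℝ} {k : ℕ∞} {m : ℕ}

theorem pgwTree_mem_edges' {M : List ℕ → ℕ × ℝ} {e : LEdge (List ℕ)} :
    e ∈ (pgwTree t M).edges ↔ ∃ u, u ≠ [] ∧ u ∈ (pgwTree t M).verts ∧
      e = (wordEnds u, t * (M u).2) := by
  rw [pgwTree_mem_edges]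
  constructor
  · rintro ⟨i, u, h, rfl⟩
    exact ⟨i :: u, List.cons_ne_nil _ _, h, rfl⟩
  · rintro ⟨u, hu, h, rfl⟩
    obtain ⟨i, u, rfl⟩ := List.exists_cons_of_ne_nil hu
    exact ⟨i, u, h, rfl⟩

/-- The part of height at most `l` of the tree. -/
def treeTrunc (t : ℝ) (M : List ℕ → ℕ × ℝ) (l : ℕ) : LGraph (List ℕ) :=
  (pgwTree t M).induce {u | u.length ≤ l}

theorem treeTrunc_mem_edges {M : List ℕ → ℕ × ℝ} {l : ℕ} {e : LEdge (List ℕ)} :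
    e ∈ (treeTrunc t M l).edges ↔ ∃ u, (u ≠ [] ∧ u ∈ (pgwTree t M).verts ∧ u.length ≤ l) ∧
      e = (wordEnds u, t * (M u).2) := by
  constructor
  · rintro ⟨he, hl⟩
    obtain ⟨u, hu, hv, rfl⟩ := pgwTree_mem_edges'.1 he
    exact ⟨u, ⟨hu, hv, hl u (Sym2.mem_mk_right _ _)⟩, rfl⟩
  · rintro ⟨u, ⟨hu, hv, hl⟩, rfl⟩
    refine ⟨pgwTree_mem_edges'.2 ⟨u, hu, hv, rfl⟩, fun w hw => ?_⟩
    rcases Sym2.mem_iff.1 hw with rfl | rfl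
    · have : u.tail.length ≤ u.length := by rw [List.length_tail]; omega
      exact this.trans hl
    · exact hl

/-- Makes `IsOmegaPlus.exists_level` applicable to the truncations: for a tree in `Ω⁺`, the status
of an edge in the truncation at height `J` is eventually constant and equal to its status in the
infinite tree. -/
theorem treeTrunc_levelEmbeds {M : List ℕ → ℕ × ℝ} (hd : (pgwTree t M).DistinctLabels) (J : ℕ) :
    LGraph.LevelEmbeds (pgwTree t M) List.length J (treeTrunc t M J) id := by
  have hmem : ∀ g ∈ (pgwTree t M).edges, ∀ v ∈ g.1, v.length < J →
      g ∈ (treeTrunc t M J).edges := by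
    intro g hg v hv hvJ
    refine ⟨hg, fun w hw => ?_⟩
    by_cases h : v = w
    · exact h ▸ hvJ.le
    · have := pgwTree_adj_length v w
        (LGraph.adj_of_edge hg ((Sym2.mem_and_mem_iff h).1 ⟨hv, hw⟩))
      exact this.trans hvJ
  refine ⟨⟨pgwTree_finite_level t M J, LGraph.finite_induce_edges (pgwTree_locallyFinite t M)
    (B := {u | u.length ≤ J} ∩ (pgwTree t M).verts) ?_ Set.inter_subset_right |>.subset ?_⟩,
    fun e he f hf => hd e he.1 f hf.1, Set.injOn_id _, pgwTree_adj_length, ?_, ?_⟩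
  · exact (pgwTree_finite_level t M J).subset fun u hu => ⟨hu.2, hu.1⟩
  · exact fun e he => ⟨he.1, fun v hv => ⟨he.2 v hv, (pgwTree t M).mem_verts e he.1 v hv⟩⟩
  · intro g hg v hv hvJ
    rw [LEdge.map_id]
    exact hmem g hg v hv hvJ
  · intro v _ _ h hh hv
    exact ⟨h, hh.1, hv, by rw [LEdge.map_id]; rfl⟩

section

variable {Ω : Type*} {ξ : List ℕ → Ω → ℕ × ℝ}

/-- The labels of the edges of the random tree, indexed by words. -/
def wordLabel (t : ℝ) (ξ : List ℕ → Ω → ℕ × ℝ) (u : List ℕ) (ω : Ω) : ℝ := t * (ξ u ω).2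

theorem measurable_wordLabel [MeasurableSpace Ω] (hξ : ∀ u, Measurable (ξ u)) (u : List ℕ) :
    Measurable (wordLabel t ξ u) := (hξ u).snd.const_mul t

/-- The event that the word `u` is a vertex of the random tree. -/
def vertexEvent (t : ℝ) (ξ : List ℕ → Ω → ℕ × ℝ) (u : List ℕ) : Set Ω :=
  {ω | u ∈ (pgwTree t fun w => ξ w ω).verts}

theorem measurableSet_vertexEvent [MeasurableSpace Ω] (hξ : ∀ u, Measurable (ξ u)) (u : List ℕ) :
    MeasurableSet (vertexEvent t ξ u) := by
  refine measurableSet_setOfPred.2 (Measurable.forall fun i => Measurable.forall fun w =>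
    Measurable.imp measurable_const (measurableSet_setOfPred.1 ?_))
  exact (hξ w).fst (show MeasurableSet (Set.Ioi i) from MeasurableSet.of_discrete)

/-- The event that the word `u` is a vertex of height between `1` and `l`. -/
def truncEvent (t : ℝ) (ξ : List ℕ → Ω → ℕ × ℝ) (l : ℕ) (u : List ℕ) : Set Ω :=
  {ω | u ≠ [] ∧ u ∈ (pgwTree t fun w => ξ w ω).verts ∧ u.length ≤ l}

theorem measurableSet_truncEvent [MeasurableSpace Ω] (hξ : ∀ u, Measurable (ξ u)) (l : ℕ) (u : List ℕ) :
    MeasurableSet (truncEvent t ξ l u) :=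
  (MeasurableSet.const _).inter ((measurableSet_vertexEvent (t := t) hξ u).inter (MeasurableSet.const _))

theorem treeTrunc_edges_eq (l : ℕ) (ω : Ω) : (treeTrunc t (fun w => ξ w ω) l).edges =
    activeEdges wordEnds (wordLabel t ξ) (truncEvent t ξ l) ω := by
  ext e
  exact treeTrunc_mem_edges

/-- The event that the edge above `u` is kept in all sufficiently large truncations of the tree. -/
def limitKept (k : ℕ∞) (t : ℝ) (ξ : List ℕ → Ω → ℕ × ℝ) (u : List ℕ) : Set Ω :=
  {ω | ∃ L, ∀ l, L ≤ l → ω ∈ {ω | ω ∈ distinctEvent (wordLabel t ξ) (truncEvent t ξ l) ∧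
    ω ∈ truncEvent t ξ l u ∧ (wordEnds u, wordLabel t ξ u ω) ∈
      phiFin k (activeEdges wordEnds (wordLabel t ξ) (truncEvent t ξ l) ω)}}

theorem measurableSet_limitKept [MeasurableSpace Ω] (hξ : ∀ u, Measurable (ξ u)) (u : List ℕ) :
    MeasurableSet (limitKept k t ξ u) := by
  refine measurableSet_setOfPred.2 (Measurable.exists fun L => Measurable.forall fun l =>
    Measurable.imp measurable_const (measurableSet_setOfPred.1 ?_))
  refine measurableSet_kept (measurable_wordLabel hξ) (measurableSet_truncEvent hξ l) (fun ω => ?_) u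
  exact (pgwTree_finite_level t (fun w => ξ w ω) l).subset fun u hu => ⟨hu.2.1, hu.2.2⟩

/-- A measurable version of the forbidden degree tree. -/
def limitGraph (k : ℕ∞) (t : ℝ) (ξ : List ℕ → Ω → ℕ × ℝ) (ω : Ω) : LGraph (List ℕ) :=
  (pgwTree t fun w => ξ w ω).filterEdges fun e =>
    e ∈ activeEdges wordEnds (wordLabel t ξ) (limitKept k t ξ) ω

theorem limitGraph_edges (ω : Ω) : (limitGraph k t ξ ω).edges =
    activeEdges wordEnds (wordLabel t ξ) (limitKept k t ξ) ω := by
  ext e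
  refine ⟨fun h => h.2, fun h => ⟨?_, h⟩⟩
  obtain ⟨u, ⟨L, hL⟩, rfl⟩ := h
  obtain ⟨-, h, -⟩ := hL L le_rfl
  exact pgwTree_mem_edges'.2 ⟨u, h.1, h.2.1, rfl⟩

theorem isMeasurableGraph_limitGraph [MeasurableSpace Ω] (hξ : ∀ u, Measurable (ξ u)) :
    IsMeasurableGraph (limitGraph k t ξ) wordEnds (wordLabel t ξ) (limitKept k t ξ) where
  verts := measurableSet_vertexEvent (t := t) hξ
  label := measurable_wordLabel hξ
  measurable_act := measurableSet_limitKept hξ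
  edges := limitGraph_edges

/-- The definition of `phi` quantifies over all finite graphs and is not visibly measurable.
Eventual presence in the truncations is, and the two agree on `Ω⁺` by stabilisation of the status.
-/
theorem phi_eq_limitGraph {ω : Ω} (h : (pgwTree t fun w => ξ w ω).IsOmegaPlus k) :
    (pgwTree t fun w => ξ w ω).phi k = limitGraph k t ξ ω := by
  have hd : ∀ l, ω ∈ distinctEvent (wordLabel t ξ) (truncEvent t ξ l) := by
    intro l u w hu hw huw
    have := h.2.1 _ (pgwTree_mem_edges'.2 ⟨u, hu.1, hu.2.1, rfl⟩) _
      (pgwTree_mem_edges'.2 ⟨w, hw.1, hw.2.1, rfl⟩) huw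
    exact wordEnds_injective (Prod.mk.inj this).1
  have hedges : ((pgwTree t fun w => ξ w ω).phi k).edges = (limitGraph k t ξ ω).edges := by
    rw [limitGraph_edges]
    ext e
    constructor
    · intro he
      obtain ⟨u, hu, hv, rfl⟩ := pgwTree_mem_edges'.1 he.1
      obtain ⟨J₀, hJ₀⟩ := h.exists_level (lev := List.length) he.1
      refine ⟨u, ⟨max J₀ u.length, fun l hl => ⟨hd l, ⟨hu, hv, (le_max_right _ _).trans hl⟩, ?_⟩⟩,
        rfl⟩
      have := (hJ₀ l ((le_max_left _ _).trans hl) _ _ _ (treeTrunc_levelEmbeds h.2.1 l)).2 he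
      rwa [LEdge.map_id, treeTrunc_edges_eq] at this
    · rintro ⟨u, ⟨L, hL⟩, rfl⟩
      obtain ⟨-, hu, -⟩ := hL L le_rfl
      have he : (wordEnds u, wordLabel t ξ u ω) ∈ (pgwTree t fun w => ξ w ω).edges :=
        pgwTree_mem_edges'.2 ⟨u, hu.1, hu.2.1, rfl⟩
      obtain ⟨J₀, hJ₀⟩ := h.exists_level (lev := List.length) he
      refine (hJ₀ (max J₀ L) (le_max_left _ _) _ _ _ (treeTrunc_levelEmbeds h.2.1 _)).1 ?_
      rw [LEdge.map_id, treeTrunc_edges_eq]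
      exact (hL _ (le_max_right _ _)).2.2
  unfold limitGraph LGraph.phi LGraph.filterEdges at hedges ⊢
  congr 1

end

theorem aemeasurable_rootedForbiddenForest {Ω : Type*} [MeasurableSpace Ω] {ν : Measure Ω}
    {ξ : Fin m → List ℕ → Ω → ℕ × ℝ} (hξ : ∀ i u, Measurable (ξ i u))
    (h : ∀ᵐ ω ∂ν, ∀ i, (pgwTree t fun u => ξ i u ω).IsOmegaPlus k) :
    AEMeasurable (fun ω => rootedForbiddenForest k t fun i u => ξ i u ω) ν := by
  let G : Fin m → Ω → LGraph (List ℕ) := fun i => limitGraph k t (ξ i)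
  have hG : ∀ i, IsMeasurableGraph (G i) wordEnds (wordLabel t (ξ i)) (limitKept k t (ξ i)) :=
    fun i => isMeasurableGraph_limitGraph (hξ i)
  let U : Ω → LGraph (Fin m × List ℕ) := fun ω =>
    LGraph.disjointUnion fun i => (G i ω).component []
  -- The component is induced, so a kept edge belongs to it when both endpoints do.
  let act : Fin m × List ℕ → Set Ω := fun p => limitKept k t (ξ p.1) p.2 ∩
    ({ω | p.2.tail ∈ ⋃ j, (G p.1 ω).ball [] j} ∩ {ω | p.2 ∈ ⋃ j, (G p.1 ω).ball [] j})
  have hU : IsMeasurableGraph U (fun p => (wordEnds p.2).map (Prod.mk p.1))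
      (fun p => wordLabel t (ξ p.1) p.2) act := by
    refine ⟨fun p => ?_, fun p => measurable_wordLabel (hξ p.1) p.2, fun p => ?_, fun ω => ?_⟩
    · exact ((hG p.1).verts p.2).inter ((hG p.1).mem_component [] p.2)
    · exact (measurableSet_limitKept (hξ p.1) p.2).inter
        (((hG p.1).mem_component [] _).inter ((hG p.1).mem_component [] _))
    · ext e
      constructor
      · rintro ⟨i, f, ⟨hf, hfb⟩, rfl⟩
        rw [(hG i).edges] at hf
        obtain ⟨u, hu, rfl⟩ := hf
        exact ⟨(i, u), ⟨hu, hfb _ (Sym2.mem_mk_left _ _), hfb _ (Sym2.mem_mk_right _ _)⟩, rfl⟩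
      · rintro ⟨⟨i, u⟩, ⟨hu, h1, h2⟩, rfl⟩
        refine ⟨i, (wordEnds u, wordLabel t (ξ i) u ω), ⟨?_, fun w hw => ?_⟩, rfl⟩
        · rw [(hG i).edges]
          exact ⟨u, hu, rfl⟩
        · rcases Sym2.mem_iff.1 hw with rfl | rfl
          · exact h1
          · exact h2
  have hmem : ∀ ω (i : Fin m), ((i, []) : Fin m × List ℕ) ∈ (U ω).verts := fun ω i =>
    ⟨pgwTree_nil_mem (t := t), Set.mem_iUnion.2 ⟨0, rfl⟩⟩
  have hfin : ∀ ω, (U ω).LocallyFinite := fun ω => LGraph.LocallyFinite.disjointUnion fun i =>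
    (pgwTree_locallyFinite t _).of_le (fun _ h => h.1) (fun _ h => h.1.1)
  refine ⟨_, hU.measurable_rooted (r := fun _ i => (i, [])) ?_ ?_ hmem hfin, ?_⟩
  · rintro ω ⟨i, u⟩ ⟨j, w⟩ - - hE -
    have h1 : ∀ p ∈ (wordEnds u).map (Prod.mk i), p.1 = i := by
      intro p hp
      obtain ⟨a, -, rfl⟩ := Sym2.mem_map.1 hp
      rfl
    have hij : j = i := h1 (j, w) (by
      change _ = _ at hE
      rw [hE]
      exact Sym2.mem_map.2 ⟨w, Sym2.mem_mk_right _ _, rfl⟩)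
    subst hij
    have := Sym2.map.injective (Prod.mk_right_injective j) hE
    exact congrArg (Prod.mk j) (wordEnds_injective this)
  · exact fun q x => MeasurableSet.const _
  · filter_upwards [h] with ω hω
    have : (fun i => forbiddenTree k t fun u => ξ i u ω) = fun i => (G i ω).component [] := by
      funext i
      rw [forbiddenTree, phi_eq_limitGraph (hω i)]
    unfold rootedForbiddenForest
    congr 1
    exact congrArg LGraph.disjointUnion this

/-! ### Propagation paths in the Galton–Watson tree -/

theorem tsum_pi_prod_eq_pow {α : Type*} (f : α → ℝ≥0∞) (n : ℕ) :
    ∑' p : Fin n → α, ∏ i, f (p i) = (∑' a, f a) ^ n := by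
  induction n with
  | zero => simp
  | succ n ih =>
    rw [← (Fin.consEquiv fun _ : Fin (n + 1) => α).tsum_eq, ENNReal.tsum_prod', pow_succ', ← ih,
      ← ENNReal.tsum_mul_right]
    refine tsum_congr fun a => ?_
    rw [← ENNReal.tsum_mul_left]
    refine tsum_congr fun p => ?_
    rw [Fin.prod_univ_succ]
    simp [Fin.consEquiv]

/-- The number of nonincreasing sequences is polynomial in their length. -/
theorem card_antitone_le (n K : ℕ) :
    Nat.card {b : Fin n → Fin K // Antitone b} ≤ (n + 1) ^ K := by
  classical
  have hle : ∀ (b : Fin n → Fin K) (c : Fin K),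
      (Finset.univ.filter fun i => c ≤ b i).card < n + 1 := by
    intro b c
    have := Finset.card_filter_le (Finset.univ : Finset (Fin n)) fun i => c ≤ b i
    rw [Finset.card_univ, Fintype.card_fin] at this
    omega
  let F : {b : Fin n → Fin K // Antitone b} → (Fin K → Fin (n + 1)) := fun b c =>
    ⟨(Finset.univ.filter fun i => c ≤ b.1 i).card, hle b.1 c⟩
  have hF : Function.Injective F := by
    have key : ∀ b b' : {b : Fin n → Fin K // Antitone b}, F b = F b' → ∀ i, b.1 i ≤ b'.1 i := by
      intro b b' h i
      by_contra hlt
      have hlt := not_le.1 hlt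
      have h1 := congrArg Fin.val (congrFun h (b.1 i))
      simp only [F] at h1
      have hss : (Finset.univ.filter fun l => b.1 i ≤ b'.1 l) ⊂
          Finset.univ.filter fun l => b.1 i ≤ b.1 l := by
        refine ⟨fun l hl => ?_, fun h => ?_⟩
        · rw [Finset.mem_filter] at hl ⊢
          refine ⟨hl.1, b.2 ?_⟩
          by_contra hil
          have := b'.2 (not_le.1 hil).le
          exact absurd (hl.2.trans this) (not_le.2 hlt)
        · have := h (Finset.mem_filter.2 ⟨Finset.mem_univ i, le_rfl⟩)
          rw [Finset.mem_filter] at this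
          exact absurd this.2 (not_le.2 hlt)
      exact absurd h1 (Finset.card_lt_card hss).ne'
    intro b b' h
    exact Subtype.ext (funext fun i => le_antisymm (key b b' h i) (key b' b h.symm i))
  refine (Nat.card_le_card_of_injective F hF).trans ?_
  simp

/-- Summing `P(p.1 < N, p.2 < N)` over all pairs gives `E[N²]`, the mean number of choices of a
child and a side edge at a visited word. It is finite since `n² ≤ 4ⁿ`. -/
theorem poisson_second_moment_ne_top (t : ℝ≥0) :
    ∑' p : ℕ × ℕ, poissonMeasure t {n | p.1 < n ∧ p.2 < n} ≠ ⊤ := by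
  classical
  have h1 : ∑' p : ℕ × ℕ, poissonMeasure t {n | p.1 < n ∧ p.2 < n} =
      ∫⁻ n, ∑' p : ℕ × ℕ, ({n | p.1 < n ∧ p.2 < n} : Set ℕ).indicator 1 n ∂poissonMeasure t := by
    rw [lintegral_tsum fun p => Measurable.aemeasurable (measurable_of_countable _)]
    refine tsum_congr fun p => ?_
    rw [lintegral_indicator_one MeasurableSet.of_discrete]
  have h2 : ∀ n : ℕ, ∑' p : ℕ × ℕ, ({n | p.1 < n ∧ p.2 < n} : Set ℕ).indicator (1 : ℕ → ℝ≥0∞) n =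
      (n : ℝ≥0∞) * n := by
    intro n
    rw [tsum_eq_sum (s := Finset.range n ×ˢ Finset.range n)]
    · rw [Finset.sum_congr rfl (g := fun _ => 1)]
      · simp
      · intro p hp
        rw [Finset.mem_product, Finset.mem_range, Finset.mem_range] at hp
        simp [hp.1, hp.2]
    · intro p hp
      rw [Finset.mem_product, Finset.mem_range, Finset.mem_range] at hp
      exact Set.indicator_of_notMem (s := {n : ℕ | p.1 < n ∧ p.2 < n}) hp 1
  have h3 : ∀ n : ℕ, ((n : ℝ≥0∞) * n) * poissonMeasure t {n} ≤
      ENNReal.ofReal (Real.exp (-t) * ((4 * t) ^ n / n.factorial)) := by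
    intro n
    rw [poissonMeasure_singleton, ← Nat.cast_mul, ← ENNReal.ofReal_natCast,
      ← ENNReal.ofReal_mul (by positivity)]
    refine ENNReal.ofReal_le_ofReal ?_
    have h4 : ((n * n : ℕ) : ℝ) ≤ 4 ^ n := by
      have h5 : n * n ≤ 2 ^ n * 2 ^ n :=
        Nat.mul_le_mul Nat.lt_two_pow_self.le Nat.lt_two_pow_self.le
      rw [← mul_pow] at h5
      exact_mod_cast h5
    calc ((n * n : ℕ) : ℝ) * (Real.exp (-t) * t ^ n / n.factorial)
        ≤ 4 ^ n * (Real.exp (-t) * t ^ n / n.factorial) :=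
          mul_le_mul_of_nonneg_right h4 (by positivity)
      _ = Real.exp (-t) * ((4 * t) ^ n / n.factorial) := by rw [mul_pow]; ring
  rw [h1]
  simp only [h2]
  rw [lintegral_countable']
  refine ne_top_of_le_ne_top ?_ (ENNReal.tsum_le_tsum h3)
  exact ((Real.summable_pow_div_factorial (4 * t)).mul_left _).tsum_ofReal_ne_top

/-- The words visited from `w` when the successive children are given by `p`. -/
def descend (w : List ℕ) (p : ℕ → ℕ × ℕ) : ℕ → List ℕ
  | 0 => w
  | i + 1 => (p i).1 :: descend w p i

/-- The edge (identified with its lower endpoint) at the `i`-th visited word given by `p`: the edge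
above this word or the edge to the child `(p i).2`. -/
def sideWord (w : List ℕ) (p : ℕ → ℕ × ℕ) (i : ℕ) : List ℕ :=
  if (p i).2 = (p i).1 then descend w p i else (p i).2 :: descend w p i

theorem descend_length (w : List ℕ) (p : ℕ → ℕ × ℕ) (i : ℕ) :
    (descend w p i).length = w.length + i := by
  induction i with
  | zero => rfl
  | succ i ih => simp only [descend, List.length_cons, ih]; omega

theorem descend_injective (w : List ℕ) (p : ℕ → ℕ × ℕ) : Function.Injective (descend w p) := by
  intro i j h
  have := congrArg List.length h
  rw [descend_length, descend_length] at this
  omega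

/-- By length, two side edges can only coincide at consecutive words, a side child of the first
being the second. The convention that `(p i).2 = (p i).1` denotes the edge above the word rules this
out. Injectivity makes the side labels independent. -/
theorem sideWord_injective (w : List ℕ) (p : ℕ → ℕ × ℕ) : Function.Injective (sideWord w p) := by
  have key : ∀ i j, i < j → sideWord w p i ≠ sideWord w p j := by
    intro i j hij h
    have hl := congrArg List.length h
    unfold sideWord at h hl
    split_ifs at h hl with h1 h2 h2
    · have := descend_injective w p h; omega
    · simp only [List.length_cons, descend_length] at hl; omega
    · simp only [List.length_cons, descend_length] at hl
      obtain rfl : j = i + 1 := by omega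
      exact h1 (List.cons.inj h).1
    · simp only [List.length_cons, descend_length] at hl; omega
  intro i j h
  rcases lt_trichotomy i j with hlt | heq | hlt
  · exact absurd h (key i j hlt)
  · exact heq
  · exact absurd h.symm (key j i hlt)

/-- There is a downward path of length `n` from `w` with decreasing labels of side edges. -/
def DownChain (M : List ℕ → ℕ × ℝ) (w : List ℕ) (n : ℕ) : Prop :=
  ∃ p : ℕ → ℕ × ℕ, (∀ i < n, (p i).1 < (M (descend w p i)).1 ∧ (p i).2 < (M (descend w p i)).1) ∧
    ∀ i j, i < j → j < n → (M (sideWord w p j)).2 < (M (sideWord w p i)).2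

/-- The cell of a number in the partition of `[0, 1)` into `K` intervals. -/
noncomputable def cell (K : ℕ) (x : ℝ) : Fin (K + 1) :=
  ⟨min ⌊K * x⌋₊ K, by omega⟩

theorem cell_mono (K : ℕ) : Monotone (cell K) := fun _ _ h =>
  min_le_min_right _ (Nat.floor_mono (mul_le_mul_of_nonneg_left h (Nat.cast_nonneg K)))

theorem measurable_cell (K : ℕ) : Measurable (cell K) := (cell_mono K).measurable

theorem volume_cell_le {K : ℕ} (hK : 0 < K) (j : Fin (K + 1)) :
    (volume.restrict (Set.Icc (0 : ℝ) 1)) {x | cell K x = j} ≤ (K : ℝ≥0∞)⁻¹ := by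
  have hK' : (0 : ℝ) < K := by exact_mod_cast hK
  have hm : MeasurableSet {x | cell K x = j} := measurable_cell K (measurableSet_singleton j)
  rw [Measure.restrict_apply hm]
  -- On `[0, 1]` the cap in `cell` is inactive. The extra index `K` is only reached at `x = 1`,
  -- which the same interval bound covers.
  have hsub : {x | cell K x = j} ∩ Set.Icc (0 : ℝ) 1 ⊆ Set.Icc (j / K : ℝ) ((j + 1) / K) := by
    rintro x ⟨hx, h0, h1⟩
    have hx' : min ⌊K * x⌋₊ K = (j : ℕ) := congrArg Fin.val hx
    have hfl := Nat.floor_le (mul_nonneg hK'.le h0)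
    have hfl' := Nat.lt_floor_add_one (K * x)
    have hfK : (⌊K * x⌋₊ : ℕ) ≤ K := by
      have : (K : ℝ) * x ≤ (K : ℕ) := by nlinarith
      exact Nat.floor_le_of_le this
    rw [min_eq_left hfK] at hx'
    rw [hx'] at hfl hfl'
    constructor
    · rw [div_le_iff₀ hK']; linarith
    · rw [le_div_iff₀ hK']; linarith
  refine (measure_mono hsub).trans ?_
  rw [Real.volume_Icc]
  have : ((j : ℕ) + 1 : ℝ) / K - (j : ℕ) / K = (K : ℝ)⁻¹ := by field_simp; ring
  rw [this, ENNReal.ofReal_inv_of_pos hK', ENNReal.ofReal_natCast]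

/-! ### First-moment bound for descending chains -/

section Law

variable {Ω : Type*} [MeasurableSpace Ω] {ν : Measure Ω} {ξ : List ℕ → Ω → ℕ × ℝ} {t : ℝ≥0}

theorem measure_mark_rect {ι : Type*} {ξ : ι → Ω → ℕ × ℝ}
    (hξ : ∀ u, Measurable (ξ u))
    (hlaw : ∀ u, ν.map (ξ u) = (poissonMeasure t).prod (volume.restrict (Set.Icc (0 : ℝ) 1)))
    (hind : iIndepFun ξ ν) (W : Finset ι) (C : ι → Set ℕ) (D : ι → Set ℝ)
    (hD : ∀ u, MeasurableSet (D u)) :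
    ν (⋂ u ∈ W, ξ u ⁻¹' (C u ×ˢ D u)) = (∏ u ∈ W, poissonMeasure t (C u)) *
      ∏ u ∈ W, (volume.restrict (Set.Icc (0 : ℝ) 1)) (D u) := by
  have hm : ∀ u, MeasurableSet (C u ×ˢ D u) := fun u => MeasurableSet.of_discrete.prod (hD u)
  rw [hind.measure_inter_preimage_eq_mul W fun u _ => hm u, ← Finset.prod_mul_distrib]
  refine Finset.prod_congr rfl fun u _ => ?_
  rw [← Measure.map_apply (hξ u) (hm u), hlaw u, Measure.prod_prod]

instance : IsProbabilityMeasure (volume.restrict (Set.Icc (0 : ℝ) 1)) :=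
  ⟨by rw [Measure.restrict_apply_univ, Real.volume_Icc]; simp⟩

/-- Extension of a finite sequence by a constant. -/
def extendSeq {n : ℕ} (p : Fin n → ℕ × ℕ) (i : ℕ) : ℕ × ℕ := if h : i < n then p ⟨i, h⟩ else 0

/-- Union bound over the choices `p` and over the nonincreasing sequences of cells of the side
labels. Visited words are distinct and so are side words, so independence gives a product of
offspring probabilities times at most `K⁻ⁿ`. Summing over `p` yields the `n`-th power of the second
moment, and `card_antitone_le` counts the sequences of cells. -/
theorem measure_downChain_le (hξ : ∀ u, Measurable (ξ u))
    (hlaw : ∀ u, ν.map (ξ u) = (poissonMeasure t).prod (volume.restrict (Set.Icc (0 : ℝ) 1)))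
    (hind : iIndepFun ξ ν) (w : List ℕ) (n : ℕ) {K : ℕ} (hK : 0 < K) :
    ν {ω | DownChain (fun u => ξ u ω) w n} ≤ ((n + 1 : ℕ) : ℝ≥0∞) ^ (K + 1) *
      ((∑' p : ℕ × ℕ, poissonMeasure t {n | p.1 < n ∧ p.2 < n}) * (K : ℝ≥0∞)⁻¹) ^ n := by
  classical
  let R : (Fin n → ℕ × ℕ) → (Fin n → Fin (K + 1)) → Set Ω := fun p b =>
    {ω | ∀ i : Fin n, ((p i).1 < (ξ (descend w (extendSeq p) i) ω).1 ∧
      (p i).2 < (ξ (descend w (extendSeq p) i) ω).1) ∧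
      cell K (ξ (sideWord w (extendSeq p) i) ω).2 = b i}
  have hcover : {ω | DownChain (fun u => ξ u ω) w n} ⊆
      ⋃ p : Fin n → ℕ × ℕ, ⋃ b : {b : Fin n → Fin (K + 1) // Antitone b}, R p b.1 := by
    rintro ω ⟨p, hp, hdec⟩
    let q : Fin n → ℕ × ℕ := fun i => p i
    have hq : ∀ i < n, extendSeq q i = p i := fun i hi => by simp [extendSeq, hi, q]
    have hdq : ∀ i ≤ n, descend w (extendSeq q) i = descend w p i := by
      intro i
      induction i with
      | zero => exact fun _ => rfl
      | succ i ih => intro hi; simp only [descend, ih (by omega), hq i (by omega)]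
    have hsq : ∀ i < n, sideWord w (extendSeq q) i = sideWord w p i := by
      intro i hi
      simp only [sideWord, hq i hi, hdq i hi.le]
    refine Set.mem_iUnion.2 ⟨q, Set.mem_iUnion.2
      ⟨⟨fun i => cell K (ξ (sideWord w p i) ω).2, ?_⟩, ?_⟩⟩
    · intro i j hij
      rcases hij.lt_or_eq with h | rfl
      · exact cell_mono K (hdec i j h j.2).le
      · exact le_rfl
    · intro i
      rw [hdq i i.2.le, hsq i i.2]
      exact ⟨hp i i.2, rfl⟩
  have hR : ∀ p b, ν (R p b) ≤ (∏ i, poissonMeasure t {n | (p i).1 < n ∧ (p i).2 < n}) *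
      ((K : ℝ≥0∞)⁻¹) ^ n := by
    intro p b
    set z : Fin n → List ℕ := fun i => descend w (extendSeq p) i with hz
    set y : Fin n → List ℕ := fun i => sideWord w (extendSeq p) i with hy
    have hzi : Function.Injective z := fun i j h => Fin.ext (descend_injective _ _ h)
    have hyi : Function.Injective y := fun i j h => Fin.ext (sideWord_injective _ _ h)
    -- A word can be both visited and a side word. The constraints on its offspring number and on
    -- its label then add up in one rectangle, and the product law of the mark separates them.
    let C : List ℕ → Set ℕ := fun u => {k | ∀ i, z i = u → (p i).1 < k ∧ (p i).2 < k}
    let D : List ℕ → Set ℝ := fun u => {x | ∀ i, y i = u → cell K x = b i}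
    have hD : ∀ u, MeasurableSet (D u) := by
      intro u
      refine measurableSet_setOfPred.2 (Measurable.forall fun i => Measurable.imp measurable_const
        (measurableSet_setOfPred.1 (measurable_cell K (measurableSet_singleton (b i)))))
    set W := Finset.univ.image z ∪ Finset.univ.image y with hW
    have hsub : R p b ⊆ ⋂ u ∈ W, ξ u ⁻¹' (C u ×ˢ D u) := by
      intro ω hω
      simp only [Set.mem_iInter]
      intro u _
      refine ⟨?_, ?_⟩
      · rintro i rfl; exact (hω i).1
      · rintro i rfl; exact (hω i).2
    refine (measure_mono hsub).trans ?_
    rw [measure_mark_rect hξ hlaw hind W C D hD]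
    refine mul_le_mul' ?_ ?_
    · refine (Finset.prod_le_prod_of_subset_of_le_one' (Finset.subset_union_left)
        fun _ _ _ => prob_le_one).trans ?_
      rw [Finset.prod_image hzi.injOn]
      exact Finset.prod_le_prod' fun i _ => measure_mono fun k hk => hk i rfl
    · refine (Finset.prod_le_prod_of_subset_of_le_one' (Finset.subset_union_right)
        fun _ _ _ => prob_le_one).trans ?_
      rw [Finset.prod_image hyi.injOn]
      refine (Finset.prod_le_prod' (g := fun _ => (K : ℝ≥0∞)⁻¹) fun i _ =>
        (measure_mono fun x (hx : x ∈ D (y i)) => hx i rfl).trans (volume_cell_le hK (b i))).trans ?_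
      simp
  have hcard : (Fintype.card {b : Fin n → Fin (K + 1) // Antitone b} : ℝ≥0∞) ≤
      ((n + 1 : ℕ) : ℝ≥0∞) ^ (K + 1) := by
    rw [← Nat.card_eq_fintype_card]
    exact_mod_cast card_antitone_le n (K + 1)
  calc ν {ω | DownChain (fun u => ξ u ω) w n}
      ≤ ∑' p : Fin n → ℕ × ℕ, ∑' b : {b : Fin n → Fin (K + 1) // Antitone b}, ν (R p b.1) :=
        (measure_mono hcover).trans ((measure_iUnion_le _).trans
          (ENNReal.tsum_le_tsum fun p => measure_iUnion_le _))
    _ ≤ ∑' p : Fin n → ℕ × ℕ, ∑' _b : {b : Fin n → Fin (K + 1) // Antitone b},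
          (∏ i, poissonMeasure t {n | (p i).1 < n ∧ (p i).2 < n}) * ((K : ℝ≥0∞)⁻¹) ^ n :=
        ENNReal.tsum_le_tsum fun p => ENNReal.tsum_le_tsum fun b => hR p b.1
    _ = (Fintype.card {b : Fin n → Fin (K + 1) // Antitone b} : ℝ≥0∞) *
          ((∑' p : ℕ × ℕ, poissonMeasure t {n | p.1 < n ∧ p.2 < n}) * (K : ℝ≥0∞)⁻¹) ^ n := by
        simp only [tsum_fintype, Finset.sum_const, Finset.card_univ, nsmul_eq_mul]
        rw [ENNReal.tsum_mul_left, ENNReal.tsum_mul_right, mul_pow, tsum_pi_prod_eq_pow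
          fun p : ℕ × ℕ => poissonMeasure t {n | p.1 < n ∧ p.2 < n}]
    _ ≤ _ := mul_le_mul_left hcard _

theorem ae_exists_not_downChain (hξ : ∀ u, Measurable (ξ u))
    (hlaw : ∀ u, ν.map (ξ u) = (poissonMeasure t).prod (volume.restrict (Set.Icc (0 : ℝ) 1)))
    (hind : iIndepFun ξ ν) : ∀ᵐ ω ∂ν, ∀ w, ∃ n, ¬ DownChain (fun u => ξ u ω) w n := by
  rw [ae_all_iff]
  intro w
  rw [ae_iff]
  push Not
  set c := ∑' p : ℕ × ℕ, poissonMeasure t {n | p.1 < n ∧ p.2 < n} with hc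
  have hc' : c ≠ ⊤ := poisson_second_moment_ne_top t
  -- Makes the ratio `c / K` at most `1 / 2`, so that the geometric factor beats the polynomial one.
  obtain ⟨K, hK⟩ := exists_nat_gt (2 * c.toReal)
  have hK0 : 0 < K := by
    have : (0 : ℝ) < K := lt_of_le_of_lt (by positivity) hK
    exact_mod_cast this
  have hK0' : (0 : ℝ) < K := by exact_mod_cast hK0
  have hcK : c * (K : ℝ≥0∞)⁻¹ ≤ ENNReal.ofReal (1 / 2) := by
    rw [← ENNReal.ofReal_toReal hc', ← ENNReal.ofReal_natCast, ← ENNReal.ofReal_inv_of_pos hK0',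
      ← ENNReal.ofReal_mul (by positivity)]
    refine ENNReal.ofReal_le_ofReal ?_
    rw [← div_eq_mul_inv, div_le_iff₀ hK0']
    linarith
  have hbound : ∀ n : ℕ, ν {ω | ∀ n, DownChain (fun u => ξ u ω) w n} ≤
      ENNReal.ofReal (((n + 1 : ℕ) : ℝ) ^ (K + 1) * (1 / 2) ^ n) := by
    intro n
    refine (measure_mono fun ω (h : ∀ n, DownChain (fun u => ξ u ω) w n) => h n).trans
      ((measure_downChain_le hξ hlaw hind w n hK0).trans ?_)
    rw [ENNReal.ofReal_mul (by positivity), ENNReal.ofReal_pow (by positivity),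
      ENNReal.ofReal_natCast, ENNReal.ofReal_pow (by positivity)]
    gcongr
  have hlim : Tendsto (fun n : ℕ => ENNReal.ofReal (((n + 1 : ℕ) : ℝ) ^ (K + 1) * (1 / 2) ^ n)) atTop
      (𝓝 0) := by
    have h1 : Tendsto (fun n : ℕ => ((n : ℝ) ^ (K + 1) * (1 / 2) ^ n)) atTop (𝓝 0) :=
      tendsto_pow_const_mul_const_pow_of_abs_lt_one (K + 1) (by norm_num [abs_lt])
    have h2 := ((tendsto_add_atTop_iff_nat 1).2 h1).mul_const 2
    rw [zero_mul] at h2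
    rw [← ENNReal.ofReal_zero]
    refine ENNReal.tendsto_ofReal (h2.congr fun n => ?_)
    rw [pow_succ (1 / 2 : ℝ) n]
    ring
  exact le_antisymm (ge_of_tendsto' hlim hbound) bot_le

end Law

/-- A self-avoiding path in a tree never goes up after having gone down, and it can go up at most
`a.length` times. The edge `e'_i` at a vertex of the descent is not the next path edge, so it is the
edge above this vertex or leads to another child. These are exactly the two cases of `sideWord`. -/
theorem exists_downChain_of_propagationPath {t : ℝ} (ht : 0 ≤ t) {M : List ℕ → ℕ × ℝ}
    {a : List ℕ} {l n : ℕ} {v : ℕ → List ℕ} {e e' : ℕ → LEdge (List ℕ)}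
    (h : (pgwTree t M).IsPropagationPath a l v e e') (hl : a.length + 2 + n ≤ l) :
    ∃ w ∈ (pgwTree t M).verts, w.length ≤ a.length + 1 ∧ DownChain M w n := by
  classical
  have hstep : ∀ i < l, (∃ c, v (i + 1) = c :: v i) ∨ ∃ c, v i = c :: v (i + 1) := by
    intro i hi
    obtain ⟨he, hv⟩ := h.path i hi
    obtain ⟨c, u, -, hcu⟩ := he
    rw [hcu] at hv
    rcases Sym2.eq_iff.1 hv with ⟨h1, h2⟩ | ⟨h1, h2⟩
    · exact Or.inl ⟨c, by rw [← h1, ← h2]⟩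
    · exact Or.inr ⟨c, by rw [← h1, ← h2]⟩
  have hup : ∀ i ≤ l, (∀ j < i, ¬ ∃ c, v (j + 1) = c :: v j) → (v i).length + i = a.length := by
    intro i
    induction i with
    | zero => intro _ _; rw [h.start]; rfl
    | succ i ih =>
      intro hi hno
      have h1 := ih (by omega) fun j hj => hno j (by omega)
      obtain ⟨c, hc⟩ := (hstep i (by omega)).resolve_left (hno i (by omega))
      rw [hc, List.length_cons] at h1
      omega
  have hex : ∃ j, j < l ∧ ∃ c, v (j + 1) = c :: v j := by
    by_contra hno
    push Not at hno
    have := hup l le_rfl fun j hj ⟨c, hc⟩ => hno j hj c hc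
    omega
  set q := Nat.find hex with hq
  obtain ⟨hql, hqd⟩ : q < l ∧ ∃ c, v (q + 1) = c :: v q := Nat.find_spec hex
  have hqlen : (v q).length + q = a.length := hup q hql.le fun j hj hc =>
    Nat.find_min hex hj ⟨by omega, hc⟩
  have hdown : ∀ i, q ≤ i → i < l → ∃ c, v (i + 1) = c :: v i := by
    intro i hi
    induction i, hi using Nat.le_induction with
    | base => exact fun _ => hqd
    | succ i hi ih =>
      intro hil
      obtain ⟨c, hc⟩ := ih (by omega)
      refine (hstep (i + 1) hil).resolve_right ?_
      rintro ⟨d, hd⟩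
      rw [hc] at hd
      have h1 : v i = v (i + 1 + 1) := (List.cons.inj hd).2
      have := h.self_avoiding (Set.mem_Iic.2 (by omega)) (Set.mem_Iic.2 (by omega)) h1
      omega
  have hvmem : ∀ i < l, v (i + 1) ∈ (pgwTree t M).verts := by
    intro i hi
    obtain ⟨he, hv⟩ := h.path i hi
    exact (pgwTree t M).mem_verts _ he _ (hv ▸ Sym2.mem_mk_right _ _)
  have hword : ∀ i < n, ∃ p : ℕ × ℕ, v (q + 1 + i + 1) = p.1 :: v (q + 1 + i) ∧
      p.1 < (M (v (q + 1 + i))).1 ∧ p.2 < (M (v (q + 1 + i))).1 ∧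
      (e' (q + 1 + i)).2 = t * (M (if p.2 = p.1 then v (q + 1 + i) else p.2 :: v (q + 1 + i))).2 := by
    intro i hi
    set j := q + 1 + i with hj
    have hjl : j < l := by omega
    obtain ⟨c, hc⟩ := hdown j (by omega) hjl
    have hcM : c < (M (v j)).1 := by
      have := hvmem j hjl
      rw [hc] at this
      exact (pgwTree_cons_mem.1 this).2
    obtain ⟨he', hve'⟩ := h.incident j (by omega) hjl
    obtain ⟨d, u, hdu, heq⟩ := he'
    have hdu' : d :: u ∈ (pgwTree t M).verts := hdu
    rw [heq] at hve'
    rcases Sym2.mem_iff.1 hve' with hu | hu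
    · have hdc : d ≠ c := by
        intro hdc
        refine h.ne j (j + 1) (by omega) hjl (by omega) (by omega) (by omega) ?_
        obtain ⟨hp, hpv⟩ := h.path j hjl
        obtain ⟨u₁, hu₁, hv₁, he₁⟩ := pgwTree_mem_edges'.1 hp
        have : wordEnds u₁ = wordEnds (d :: u) := by
          rw [he₁] at hpv
          rw [show wordEnds u₁ = _ from hpv, hc, ← hdc, hu]
          rfl
        rw [wordEnds_injective this] at he₁
        rw [heq, he₁]
        rfl
      refine ⟨(c, d), hc, hcM, ?_, ?_⟩
      · rw [hu]; exact (pgwTree_cons_mem.1 hdu').2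
      · rw [if_neg hdc, heq, hu]
    · refine ⟨(c, c), hc, hcM, hcM, ?_⟩
      rw [if_pos rfl, heq, hu]
  choose! p hp using hword
  have hdesc : ∀ i ≤ n, descend (v (q + 1)) p i = v (q + 1 + i) := by
    intro i
    induction i with
    | zero => exact fun _ => rfl
    | succ i ih =>
      intro hi
      rw [descend, ih (by omega)]
      exact (hp i (by omega)).1.symm
  refine ⟨v (q + 1), hvmem q hql, ?_, p, fun i hi => ?_, fun i j hij hj => ?_⟩
  · obtain ⟨c, hc⟩ := hqd
    rw [hc, List.length_cons]
    omega
  · rw [hdesc i hi.le]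
    exact ⟨(hp i hi).2.1, (hp i hi).2.2.1⟩
  · have h1 := h.decreasing (q + 1 + i) (q + 1 + j) (by omega) (by omega) (by omega)
    have hs : ∀ i < n, sideWord (v (q + 1)) p i = if (p i).2 = (p i).1 then v (q + 1 + i)
        else (p i).2 :: v (q + 1 + i) := fun i hi => by rw [sideWord, hdesc i hi.le]
    rw [(hp i (by omega)).2.2.2, (hp j hj).2.2.2, ← hs i (by omega), ← hs j hj] at h1
    exact lt_of_mul_lt_mul_left h1 ht

/-! ### The Galton–Watson tree almost surely has bounded propagation paths -/

section Law

variable {Ω : Type*} [MeasurableSpace Ω] {ν : Measure Ω} {t : ℝ≥0}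

theorem ae_label_ne [IsProbabilityMeasure ν] {ι : Type*} {ξ : ι → Ω → ℕ × ℝ} (hξ : ∀ u, Measurable (ξ u))
    (hlaw : ∀ u, ν.map (ξ u) = (poissonMeasure t).prod (volume.restrict (Set.Icc (0 : ℝ) 1)))
    (hind : iIndepFun ξ ν) {u w : ι} (huw : u ≠ w) : ∀ᵐ ω ∂ν, (ξ u ω).2 ≠ (ξ w ω).2 := by
  have hsnd : ∀ u, ν.map (fun ω => (ξ u ω).2) = volume.restrict (Set.Icc (0 : ℝ) 1) := by
    intro u
    have := Measure.map_map (μ := ν) measurable_snd (hξ u)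
    rw [hlaw u, Measure.map_snd_prod, measure_univ, one_smul] at this
    exact this.symm
  have hi : IndepFun (fun ω => (ξ u ω).2) (fun ω => (ξ w ω).2) ν :=
    (hind.indepFun huw).comp measurable_snd measurable_snd
  have hmap := (indepFun_iff_map_prod_eq_prod_map_map (hξ u).snd.aemeasurable
    (hξ w).snd.aemeasurable).1 hi
  rw [hsnd, hsnd] at hmap
  have hdiag : MeasurableSet {p : ℝ × ℝ | p.1 = p.2} :=
    measurableSet_eq_fun measurable_fst measurable_snd
  rw [ae_iff]
  push Not
  have : {ω | (ξ u ω).2 = (ξ w ω).2} =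
      (fun ω => ((ξ u ω).2, (ξ w ω).2)) ⁻¹' {p : ℝ × ℝ | p.1 = p.2} := rfl
  rw [this, ← Measure.map_apply ((hξ u).snd.prodMk (hξ w).snd) hdiag, hmap,
    Measure.prod_apply hdiag]
  simp

theorem ae_offspring_eq_zero {ι : Type*} {ξ : ι → Ω → ℕ × ℝ} (hξ : ∀ u, Measurable (ξ u))
    (hlaw : ∀ u, ν.map (ξ u) = (poissonMeasure 0).prod (volume.restrict (Set.Icc (0 : ℝ) 1)))
    (u : ι) : ∀ᵐ ω ∂ν, (ξ u ω).1 = 0 := by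
  have hfst : ν.map (fun ω => (ξ u ω).1) = poissonMeasure 0 := by
    have := Measure.map_map (μ := ν) measurable_fst (hξ u)
    rw [hlaw u, Measure.map_fst_prod, measure_univ, one_smul] at this
    exact this.symm
  have h1 : (poissonMeasure 0) {0}ᶜ = 0 := by
    rw [prob_compl_eq_zero_iff (measurableSet_singleton 0), poissonMeasure_singleton]
    simp
  rw [← hfst, Measure.map_apply (hξ u).fst MeasurableSet.of_discrete] at h1
  exact h1

theorem ae_isOmegaMinus [IsProbabilityMeasure ν] {ξ : List ℕ → Ω → ℕ × ℝ} (hξ : ∀ u, Measurable (ξ u))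
    (hlaw : ∀ u, ν.map (ξ u) = (poissonMeasure t).prod (volume.restrict (Set.Icc (0 : ℝ) 1)))
    (hind : iIndepFun ξ ν) : ∀ᵐ ω ∂ν, (pgwTree t fun u => ξ u ω).IsOmegaMinus := by
  have hdist : ∀ᵐ ω ∂ν, (pgwTree t fun u => ξ u ω).DistinctLabels := by
    -- For `t = 0` all labels vanish and would coincide, but the tree is almost surely reduced to
    -- its root.
    rcases eq_or_ne t 0 with rfl | ht
    · filter_upwards [ae_offspring_eq_zero hξ hlaw []] with ω hω
      rintro e ⟨i, u, hiu, -⟩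
      exfalso
      have hroot : ∀ u : List ℕ, u ≠ [] → u ∉ (pgwTree (0 : ℝ≥0) fun u => ξ u ω).verts := by
        intro u
        induction u with
        | nil => exact fun h => absurd rfl h
        | cons i u ih =>
          intro _ hu
          rw [pgwTree_cons_mem] at hu
          by_cases hu0 : u = []
          · rw [hu0, hω] at hu
            exact Nat.not_lt_zero _ hu.2
          · exact ih hu0 hu.1
      exact hroot _ (List.cons_ne_nil i u) hiu
    · have hall : ∀ᵐ ω ∂ν, ∀ u w : List ℕ, u ≠ w → (ξ u ω).2 ≠ (ξ w ω).2 := by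
        rw [ae_all_iff]; intro u
        rw [ae_all_iff]; intro w
        by_cases huw : u = w
        · exact Eventually.of_forall fun ω h => absurd huw h
        · filter_upwards [ae_label_ne hξ hlaw hind huw] with ω hω _ using hω
      filter_upwards [hall] with ω hω e he f hf hef
      obtain ⟨u, -, -, rfl⟩ := pgwTree_mem_edges'.1 he
      obtain ⟨w, -, -, rfl⟩ := pgwTree_mem_edges'.1 hf
      have ht' : (t : ℝ) ≠ 0 := by exact_mod_cast ht
      have h1 : (ξ u ω).2 = (ξ w ω).2 := mul_left_cancel₀ ht' hef
      by_cases huw : u = w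
      · rw [huw]
      · exact absurd h1 (hω u w huw)
  filter_upwards [hdist, ae_exists_not_downChain hξ hlaw hind] with ω hω hchain
  refine ⟨pgwTree_locallyFinite _ _, hω, fun a _ => ?_⟩
  choose n hn using hchain
  -- The descending part starts at one of the finitely many words of height at most `a.length + 1`,
  -- which gives a common bound.
  obtain ⟨L, hL⟩ := ((pgwTree_finite_level t (fun u => ξ u ω) (a.length + 1)).image n).bddAbove
  refine ⟨a.length + 2 + L, fun l v e e' hp => ?_⟩
  by_contra hlt
  have hmono : ∀ w n n', n ≤ n' → DownChain (fun u => ξ u ω) w n' →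
      DownChain (fun u => ξ u ω) w n := by
    rintro w n n' hnn ⟨p, h1, h2⟩
    exact ⟨p, fun i hi => h1 i (by omega), fun i j hij hj => h2 i j hij (by omega)⟩
  obtain ⟨w, hw, hwl, hd⟩ := exists_downChain_of_propagationPath t.2 hp (n := L) (by omega)
  exact hn w (hmono w _ _ (hL ⟨w, ⟨hw, hwl⟩, rfl⟩) hd)

end Law

/-! ### Laws of Poisson processes on a bounded interval -/

section Poisson

variable {Ω : Type*} [MeasurableSpace Ω] {μ : Measure Ω} {r t : ℝ≥0} {P : Ω → PointConfig}

theorem poissonMeasure_zero_apply (a : ℝ≥0) :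
    poissonMeasure a {0} = ENNReal.ofReal (Real.exp (-a)) := by
  rw [poissonMeasure_singleton]; simp

theorem IsPoissonProcess.measure_count_eq_zero (h : IsPoissonProcess r P μ) {B : Set ℝ}
    (hB : MeasurableSet B) (hv : volume (B ∩ Set.Ici 0) ≠ ∞) :
    μ {ω | (P ω).count B = 0} =
      ENNReal.ofReal (Real.exp (-(r * (volume (B ∩ Set.Ici 0)).toNNReal : ℝ≥0))) := by
  have := h.law B hB hv 0
  rw [poissonMeasure_zero_apply] at this
  exact_mod_cast this

theorem IsPoissonProcess.measurable_count (h : IsPoissonProcess r P μ) {B : Set ℝ}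
    (hB : MeasurableSet B) : Measurable fun ω => (P ω).count B :=
  (PointConfig.measurable_count hB).comp h.measurable

theorem IsPoissonProcess.measure_count_ne_zero_le [IsProbabilityMeasure μ]
    (h : IsPoissonProcess r P μ) {B : Set ℝ} (hB : MeasurableSet B)
    (hv : volume (B ∩ Set.Ici 0) ≠ ∞) :
    μ {ω | (P ω).count B ≠ 0} ≤ r * volume (B ∩ Set.Ici 0) := by
  have hm : MeasurableSet {ω | (P ω).count B = 0} :=
    h.measurable_count hB (show MeasurableSet {(0 : ℕ∞)} from MeasurableSet.of_discrete)
  have : {ω | (P ω).count B ≠ 0} = {ω | (P ω).count B = 0}ᶜ := rfl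
  rw [this, prob_compl_eq_one_sub hm, h.measure_count_eq_zero hB hv, ← ENNReal.ofReal_one,
    ← ENNReal.ofReal_sub _ (Real.exp_pos _).le]
  calc ENNReal.ofReal (1 - Real.exp (-(r * (volume (B ∩ Set.Ici 0)).toNNReal : ℝ≥0)))
      ≤ ENNReal.ofReal (r * (volume (B ∩ Set.Ici 0)).toNNReal : ℝ≥0) := by
        refine ENNReal.ofReal_le_ofReal ?_
        have := Real.add_one_le_exp (-((r * (volume (B ∩ Set.Ici 0)).toNNReal : ℝ≥0) : ℝ))
        linarith
    _ = r * volume (B ∩ Set.Ici 0) := by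
        rw [ENNReal.ofReal_coe_nnreal, ENNReal.coe_mul, ENNReal.coe_toNNReal hv]

theorem IsPoissonProcess.ae_not_mem [IsProbabilityMeasure μ] (h : IsPoissonProcess r P μ) (s : ℝ) :
    ∀ᵐ ω ∂μ, s ∉ (P ω).1 := by
  have hv : volume ({s} ∩ Set.Ici 0) = 0 :=
    measure_mono_null Set.inter_subset_left (measure_singleton s)
  have := h.measure_count_ne_zero_le (measurableSet_singleton s) (by rw [hv]; simp)
  rw [hv, mul_zero] at this
  have h0 : μ {ω | (P ω).count {s} ≠ 0} = 0 := le_antisymm this bot_le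
  rw [ae_iff]
  refine measure_mono_null (fun ω (hω : ¬ s ∉ (P ω).1) => ?_) h0
  push Not at hω
  change ((P ω).1 ∩ {s}).encard ≠ 0
  rw [Set.encard_ne_zero]
  exact ⟨s, hω, rfl⟩

/-- Independent Poisson processes have no common point. -/
theorem ae_disjoint_of_indepFun [IsProbabilityMeasure μ] {P' : Ω → PointConfig}
    (h : IsPoissonProcess r P μ) (h' : IsPoissonProcess r P' μ) (hi : IndepFun P P' μ) (t : ℝ≥0) :
    ∀ᵐ ω ∂μ, ∀ x ≤ (t : ℝ), x ∈ (P ω).1 → x ∉ (P' ω).1 := by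
  let I : ℕ → ℕ → Set ℝ := fun K i => Set.Icc (i * (t / K)) ((i + 1) * (t / K))
  have hvol : ∀ K i, volume (I K i ∩ Set.Ici 0) ≤ ENNReal.ofReal (t / K) := by
    intro K i
    refine (measure_mono Set.inter_subset_left).trans ?_
    rw [Real.volume_Icc]
    exact ENNReal.ofReal_le_ofReal (by ring_nf; rfl)
  have hne : ∀ K i, volume (I K i ∩ Set.Ici 0) ≠ ∞ := fun K i =>
    ne_top_of_le_ne_top ENNReal.ofReal_ne_top (hvol K i)
  have hcell : ∀ K i, μ ({ω | (P ω).count (I K i) ≠ 0} ∩ {ω | (P' ω).count (I K i) ≠ 0}) ≤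
      ENNReal.ofReal ((r * (t / K)) ^ 2) := by
    intro K i
    have hms : MeasurableSet {c : PointConfig | c.count (I K i) ≠ 0} :=
      PointConfig.measurable_count measurableSet_Icc
        (show MeasurableSet {x : ℕ∞ | x ≠ 0} from MeasurableSet.of_discrete)
    have heq := hi.measure_inter_preimage_eq_mul _ _ hms hms
    have hb : ∀ {Q : Ω → PointConfig}, IsPoissonProcess r Q μ →
        μ {ω | (Q ω).count (I K i) ≠ 0} ≤ ENNReal.ofReal (r * (t / K)) := by
      intro Q hQ
      refine (hQ.measure_count_ne_zero_le measurableSet_Icc (hne K i)).trans ?_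
      rw [ENNReal.ofReal_mul NNReal.zero_le_coe, ENNReal.ofReal_coe_nnreal]
      exact mul_le_mul_right (hvol K i) _
    refine (le_of_eq heq).trans ?_
    rw [sq, ENNReal.ofReal_mul (by positivity)]
    exact mul_le_mul' (hb h) (hb h')
  -- A common point lies in one of the intervals of length `t / (K + 1)`, and each of them is hit by
  -- both processes with probability `O(K⁻²)`. One interval beyond the first `K + 1` is needed,
  -- since the rounding of the endpoint `t` may give the index `K + 1`.
  have hbound : ∀ K : ℕ, μ {ω | ¬ ∀ x ≤ (t : ℝ), x ∈ (P ω).1 → x ∉ (P' ω).1} ≤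
      ENNReal.ofReal (((K + 1 : ℕ) + 1) * (r * (t / (K + 1 : ℕ))) ^ 2) := by
    intro K
    have hK : (0 : ℝ) < (K + 1 : ℕ) := by exact_mod_cast Nat.succ_pos K
    have hsub : {ω | ¬ ∀ x ≤ (t : ℝ), x ∈ (P ω).1 → x ∉ (P' ω).1} ⊆
        ⋃ i ∈ Finset.range (K + 1 + 1), {ω | (P ω).count (I (K + 1) i) ≠ 0} ∩
          {ω | (P' ω).count (I (K + 1) i) ≠ 0} := by
      intro ω hω
      simp only [Set.mem_ofPred_eq] at hω
      push Not at hω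
      obtain ⟨x, hxt, hx, hx'⟩ := hω
      have hx0 : (0 : ℝ) ≤ x := (P ω).2.1 hx
      set i := ⌊x / (t / (K + 1 : ℕ))⌋₊ with hi
      have hxi : x ∈ I (K + 1) i := by
        rcases eq_or_lt_of_le t.2 with ht | ht
        · have ht' : (t : ℝ) = 0 := ht.symm
          have hx00 : x = 0 := le_antisymm (hxt.trans_eq ht') hx0
          simp [I, ht', hx00]
        · have hd : (0 : ℝ) < t / (K + 1 : ℕ) := div_pos ht hK
          have h1 := Nat.floor_le (div_nonneg hx0 hd.le)
          have h2 := (Nat.lt_floor_add_one (x / (t / (K + 1 : ℕ)))).le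
          rw [le_div_iff₀ hd] at h1
          rw [div_le_iff₀ hd] at h2
          exact ⟨h1, h2⟩
      have hiK : i < K + 1 + 1 := by
        refine Nat.lt_succ_of_le (Nat.floor_le_of_le ?_)
        refine div_le_of_le_mul₀ (by positivity) hK.le ?_
        rwa [mul_div_cancel₀ _ hK.ne']
      refine Set.mem_biUnion (Finset.mem_coe.2 (Finset.mem_range.2 hiK)) ⟨?_, ?_⟩
      · exact Set.encard_ne_zero.2 ⟨x, hx, hxi⟩
      · exact Set.encard_ne_zero.2 ⟨x, hx', hxi⟩
    refine (measure_mono hsub).trans ((measure_biUnion_finset_le _ _).trans ?_)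
    refine (Finset.sum_le_sum fun i _ => hcell (K + 1) i).trans ?_
    rw [Finset.sum_const, Finset.card_range, nsmul_eq_mul, ENNReal.ofReal_mul (by positivity)]
    refine mul_le_mul_left ?_ _
    rw [← ENNReal.ofReal_natCast]
    exact ENNReal.ofReal_le_ofReal (by push_cast; rfl)
  have hlim : Tendsto (fun K : ℕ => ENNReal.ofReal
      (((K + 1 : ℕ) + 1) * (r * (t / (K + 1 : ℕ))) ^ 2)) atTop (𝓝 0) := by
    rw [← ENNReal.ofReal_zero]
    refine ENNReal.tendsto_ofReal ?_
    have h1 : Tendsto (fun K : ℕ => (1 : ℝ) / ((K : ℝ) + 1)) atTop (𝓝 0) :=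
      tendsto_one_div_add_atTop_nhds_zero_nat
    have h2 : Tendsto (fun K : ℕ => ((r : ℝ) * t) ^ 2 * ((1 / ((K : ℝ) + 1)) +
        (1 / ((K : ℝ) + 1)) ^ 2)) atTop (𝓝 (((r : ℝ) * t) ^ 2 * (0 + 0 ^ 2))) :=
      (h1.add (h1.pow 2)).const_mul _
    simp only [ne_eq, OfNat.ofNat_ne_zero, not_false_eq_true, zero_pow, add_zero, mul_zero] at h2
    refine h2.congr fun K => ?_
    have : (K : ℝ) + 1 ≠ 0 := by positivity
    push_cast
    field_simp
  exact le_antisymm (ge_of_tendsto' hlim hbound) bot_le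

/-- The random labels of independent Poisson processes are distinct. -/
theorem ae_distinctLabels [IsProbabilityMeasure μ] {N : ℕ} {P : PairEdge N → Ω → PointConfig}
    (hP : ∀ a, IsPoissonProcess r (P a) μ) (hind : iIndepFun P μ) (t : ℝ≥0) :
    ∀ᵐ ω ∂μ, (erGraph (t : ℝ) fun a => P a ω).DistinctLabels := by
  have hall : ∀ᵐ ω ∂μ, ∀ a b, a ≠ b → ∀ x ≤ (t : ℝ), x ∈ (P a ω).1 → x ∉ (P b ω).1 := by
    rw [ae_all_iff]; intro a
    rw [ae_all_iff]; intro b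
    by_cases hab : a = b
    · exact Eventually.of_forall fun ω h => absurd hab h
    · filter_upwards [ae_disjoint_of_indepFun (hP a) (hP b) (hind.indepFun hab) t] with ω hω _
        using hω
  filter_upwards [hall] with ω hω
  rintro e ⟨a, ha, hea, het⟩ f ⟨b, hb, hfb, hft⟩ hef
  by_cases hab : a = b
  · refine Prod.ext ?_ hef
    rw [ha, hb, hab]
  · exact absurd (hef ▸ hfb) (hω a b hab e.2 het hea)

theorem volume_scale (t : ℝ≥0) {D : Set ℝ} (hD : MeasurableSet D) :
    volume (Set.Iic (t : ℝ) ∩ D ∩ Set.Ici 0) =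
      t * (volume.restrict (Set.Icc (0 : ℝ) 1)) {s | (t : ℝ) * s ∈ D} := by
  have hset : Set.Iic (t : ℝ) ∩ D ∩ Set.Ici 0 = D ∩ Set.Icc 0 (t : ℝ) := by
    ext x; simp only [Set.mem_inter_iff, Set.mem_Iic, Set.mem_Ici, Set.mem_Icc]; tauto
  rw [hset]
  rcases eq_or_ne t 0 with rfl | ht
  · have : volume (D ∩ Set.Icc 0 ((0 : ℝ≥0) : ℝ)) = 0 :=
      measure_mono_null Set.inter_subset_right (by simp)
    rw [this]
    simp
  · have ht' : (0 : ℝ) < t := lt_of_le_of_ne t.2 (by exact_mod_cast ht.symm)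
    have hm : MeasurableSet {s | (t : ℝ) * s ∈ D} := measurable_const_mul (t : ℝ) hD
    rw [Measure.restrict_apply hm]
    have : {s | (t : ℝ) * s ∈ D} ∩ Set.Icc 0 1 = (fun s => (t : ℝ) * s) ⁻¹' (D ∩ Set.Icc 0 (t : ℝ)) := by
      ext s
      simp only [Set.mem_inter_iff, Set.mem_ofPred_eq, Set.mem_Icc, Set.mem_preimage]
      rw [mul_nonneg_iff_of_pos_left ht', mul_le_iff_le_one_right ht']
    rw [this, Real.volume_preimage_mul_left ht'.ne', abs_of_pos (inv_pos.2 ht'), ← mul_assoc,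
      ← ENNReal.ofReal_coe_nnreal, ← ENNReal.ofReal_mul ht'.le, mul_inv_cancel₀ ht'.ne',
      ENNReal.ofReal_one, one_mul]

theorem volume_Iic_inter (t : ℝ≥0) : volume (Set.Iic (t : ℝ) ∩ Set.Ici 0) = t := by
  rw [Set.inter_comm, Set.Ici_inter_Iic, Real.volume_Icc, sub_zero, ENNReal.ofReal_coe_nnreal]

theorem PointConfig.count_trunc (c : PointConfig) (s : ℝ) (B : Set ℝ) :
    (c.trunc s).count B = c.count (Set.Iic s ∩ B) := by
  rw [count, count, trunc, Set.inter_assoc]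

theorem IsPoissonProcess.measure_trunc_none (h : IsPoissonProcess r P μ) (t : ℝ≥0) :
    μ {ω | ((P ω).trunc t).count Set.univ = 0} = ENNReal.ofReal (Real.exp (-(r * t : ℝ≥0))) := by
  simp only [PointConfig.count_trunc, Set.inter_univ]
  rw [h.measure_count_eq_zero measurableSet_Iic (by rw [volume_Iic_inter]; simp), volume_Iic_inter,
    ENNReal.toNNReal_coe]

/-- A configuration with one point is determined by this point. -/
theorem PointConfig.mem_iff_of_count_univ_eq_one {c : PointConfig} (h : c.count Set.univ = 1)
    (B : Set PointConfig) : c ∈ B ↔ c.count {x | single x ∈ B} = 1 := by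
  rw [count, Set.inter_univ, Set.encard_eq_one] at h
  obtain ⟨x, hx⟩ := h
  have hx0 : 0 ≤ x := c.2.1 (hx ▸ rfl)
  have hc : c = single x := by
    refine Subtype.ext ?_
    rw [hx]
    ext y
    exact ⟨fun hy => ⟨hy, (Set.mem_singleton_iff.1 hy).symm ▸ hx0⟩, fun hy => hy.1⟩
  rw [count, hx]
  by_cases hB : single x ∈ B
  · have : ({x} : Set ℝ) ∩ {x | single x ∈ B} = {x} :=
      Set.inter_eq_left.2 (Set.singleton_subset_iff.2 hB)
    rw [this, Set.encard_singleton, hc]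
    simp [hB]
  · have : ({x} : Set ℝ) ∩ {x | single x ∈ B} = ∅ :=
      Set.singleton_inter_eq_empty.2 hB
    rw [this, Set.encard_empty, hc]
    simp [hB]

/-- The law of the point of the process on the event that there is exactly one. -/
theorem IsPoissonProcess.measure_trunc_single (h : IsPoissonProcess r P μ) (t : ℝ≥0)
    {B : Set PointConfig} (hB : MeasurableSet B) :
    μ {ω | ((P ω).trunc t).count Set.univ = 1 ∧ (P ω).trunc t ∈ B} =
      ENNReal.ofReal (Real.exp (-(r * t : ℝ≥0))) * ((r * t : ℝ≥0) *
        (volume.restrict (Set.Icc (0 : ℝ) 1)) {s | PointConfig.single (t * s) ∈ B}) := by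
  set D : Set ℝ := {x | PointConfig.single x ∈ B} with hD
  have hDm : MeasurableSet D := PointConfig.measurable_single hB
  -- There is exactly one point and it lies in `D` when there is one point in `D` and none in its
  -- complement. Counts of disjoint sets are independent.
  let C : Fin 2 → Set ℝ := ![Set.Iic (t : ℝ) ∩ D, Set.Iic (t : ℝ) ∩ Dᶜ]
  have hCm : ∀ i, MeasurableSet (C i) := by
    intro i
    fin_cases i
    · exact measurableSet_Iic.inter hDm
    · exact measurableSet_Iic.inter hDm.compl
  have hCd : Pairwise fun i j => Disjoint (C i) (C j) := by
    have h0 : Disjoint (C 0) (C 1) :=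
      (disjoint_compl_right (a := D)).mono Set.inter_subset_right Set.inter_subset_right
    intro i j hij
    fin_cases i <;> fin_cases j
    · exact absurd rfl hij
    · exact h0
    · exact h0.symm
    · exact absurd rfl hij
  have hind := h.indep 2 C hCm hCd
  have hset : {ω | ((P ω).trunc t).count Set.univ = 1 ∧ (P ω).trunc t ∈ B} =
      ((fun ω => (P ω).count (C 0)) ⁻¹' {1}) ∩ ((fun ω => (P ω).count (C 1)) ⁻¹' {0}) := by
    ext ω
    have hsum : ((P ω).trunc t).count Set.univ = (P ω).count (C 0) + (P ω).count (C 1) := by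
      rw [PointConfig.count_trunc, Set.inter_univ, PointConfig.count, PointConfig.count,
        PointConfig.count, ← Set.encard_union_eq
          (((hCd (by decide : (0 : Fin 2) ≠ 1))).mono Set.inter_subset_right Set.inter_subset_right),
        ← Set.inter_union_distrib_left]
      congr 2
      simp [C, ← Set.inter_union_distrib_left]
    have hC0 : ((P ω).trunc t).count D = (P ω).count (C 0) := PointConfig.count_trunc _ _ _
    simp only [Set.mem_ofPred_eq, Set.mem_inter_iff, Set.mem_preimage, Set.mem_singleton_iff]
    constructor
    · rintro ⟨h1, h2⟩
      have h3 := (PointConfig.mem_iff_of_count_univ_eq_one h1 B).1 h2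
      rw [← hD, hC0] at h3
      refine ⟨h3, ?_⟩
      rw [hsum, h3] at h1
      rcases eq_or_ne ((P ω).count (C 1)) ⊤ with htop | htop
      · simp [htop] at h1
      · lift (P ω).count (C 1) to ℕ using htop with j
        norm_cast at h1 ⊢
        omega
    · rintro ⟨h1, h2⟩
      have h3 : ((P ω).trunc t).count Set.univ = 1 := by rw [hsum, h1, h2, add_zero]
      refine ⟨h3, (PointConfig.mem_iff_of_count_univ_eq_one h3 B).2 ?_⟩
      rw [← hD, hC0, h1]
  have hfin : ∀ E : Set ℝ, volume (Set.Iic (t : ℝ) ∩ E ∩ Set.Ici 0) ≠ ∞ := fun E =>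
    ne_top_of_le_ne_top (b := (t : ℝ≥0∞)) (by simp) ((measure_mono
      (Set.inter_subset_inter_left _ Set.inter_subset_left)).trans (volume_Iic_inter t).le)
  rw [hset, (hind.indepFun (by decide : (0 : Fin 2) ≠ 1)).measure_inter_preimage_eq_mul _ _
    (show MeasurableSet {(1 : ℕ∞)} from MeasurableSet.of_discrete)
    (show MeasurableSet {(0 : ℕ∞)} from MeasurableSet.of_discrete)]
  set a := (volume (C 0 ∩ Set.Ici 0)).toNNReal with ha
  set b := (volume (C 1 ∩ Set.Ici 0)).toNNReal with hb
  have ha' : (a : ℝ≥0∞) = volume (C 0 ∩ Set.Ici 0) := ENNReal.coe_toNNReal (hfin D)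
  have hb' : (b : ℝ≥0∞) = volume (C 1 ∩ Set.Ici 0) := ENNReal.coe_toNNReal (hfin Dᶜ)
  have hab : a + b = t := by
    have : (a : ℝ≥0∞) + b = t := by
      rw [ha', hb', ← measure_union ((hCd (by decide : (0 : Fin 2) ≠ 1)).mono
        Set.inter_subset_left Set.inter_subset_left) ((hCm 1).inter measurableSet_Ici),
        ← Set.union_inter_distrib_right, ← volume_Iic_inter t]
      congr 2
      simp [C, ← Set.inter_union_distrib_left]
    exact_mod_cast this
  have h0 : μ ((fun ω => (P ω).count (C 0)) ⁻¹' {1}) = poissonMeasure (r * a) {1} := by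
    have := h.law (C 0) (hCm 0) (hfin D) 1
    exact_mod_cast this
  have h1 : μ ((fun ω => (P ω).count (C 1)) ⁻¹' {0}) = poissonMeasure (r * b) {0} := by
    have := h.law (C 1) (hCm 1) (hfin Dᶜ) 0
    exact_mod_cast this
  have hscale : (t : ℝ≥0∞) * (volume.restrict (Set.Icc (0 : ℝ) 1)) {s | PointConfig.single (t * s) ∈ B} =
      a := by
    rw [ha']
    exact (volume_scale t hDm).symm
  rw [h0, h1, ENNReal.coe_mul, mul_assoc, hscale, poissonMeasure_zero_apply, poissonMeasure_singleton,
    ← ENNReal.coe_mul, ← ENNReal.ofReal_coe_nnreal, ← ENNReal.ofReal_mul (by positivity),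
    ← ENNReal.ofReal_mul (by positivity), ← hab]
  congr 1
  push_cast
  rw [mul_add, neg_add, Real.exp_add]
  simp
  ring

end Poisson

/-! ### Embeddings of truncated forests -/

/-- The vertices of `m` trees of words. -/
abbrev Word (m : ℕ) : Type := Fin m × List ℕ

namespace Word

variable {m : ℕ}

/-- The parent of a word in its tree. -/
def parent (p : Word m) : Word m := (p.1, p.2.tail)

/-- The `i`-th child of a word. -/
def child (p : Word m) (i : ℕ) : Word m := (p.1, i :: p.2)

theorem parent_child (p : Word m) (i : ℕ) : (p.child i).parent = p := rfl

theorem child_injective (p : Word m) : Function.Injective p.child := by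
  intro i j h
  exact (List.cons.inj (Prod.mk.inj h).2).1

theorem exists_eq_child {p : Word m} (h : p.2 ≠ []) : ∃ i, p = p.parent.child i := by
  obtain ⟨a, u⟩ := p
  obtain ⟨i, u, rfl⟩ := List.exists_cons_of_ne_nil h
  exact ⟨i, rfl⟩

end Word

section Forest

variable {m : ℕ}

/-- The word `p` belongs to the forest with offspring numbers `c`. -/
def InForest (c : Word m → ℕ) (p : Word m) : Prop :=
  ∀ i w, (i :: w) <:+ p.2 → i < c (p.1, w)

theorem inForest_child {c : Word m → ℕ} {p : Word m} {i : ℕ} :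
    InForest c (p.child i) ↔ InForest c p ∧ i < c p :=
  pgwTree_cons_mem (t := 0) (M := fun w => (c (p.1, w), 0))

theorem inForest_root (c : Word m → ℕ) (i : Fin m) : InForest c (i, []) :=
  pgwTree_nil_mem (t := 0) (M := fun w => (c (i, w), 0))

theorem finite_forest (c : Word m → ℕ) (J : ℕ) : {p | InForest c p ∧ p.2.length ≤ J}.Finite := by
  refine (Set.finite_iUnion fun i : Fin m =>
    (pgwTree_finite_level 0 (fun w => (c (i, w), 0)) J).image (Prod.mk i)).subset ?_
  rintro ⟨i, u⟩ ⟨h, hl⟩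
  exact Set.mem_iUnion.2 ⟨i, u, ⟨h, hl⟩, rfl⟩

/-- The vertices of height at most `J` of the forest with offspring numbers `c`. -/
noncomputable def forestVerts (c : Word m → ℕ) (J : ℕ) : Finset (Word m) :=
  (finite_forest c J).toFinset

theorem mem_forestVerts {c : Word m → ℕ} {J : ℕ} {p : Word m} :
    p ∈ forestVerts c J ↔ InForest c p ∧ p.2.length ≤ J := by
  simp [forestVerts]

theorem root_mem_forestVerts (c : Word m → ℕ) (J : ℕ) (i : Fin m) : (i, []) ∈ forestVerts c J :=
  mem_forestVerts.2 ⟨inForest_root c i, Nat.zero_le _⟩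

theorem child_mem_forestVerts {c : Word m → ℕ} {J : ℕ} {p : Word m} {i : ℕ} :
    p.child i ∈ forestVerts c J ↔ p ∈ forestVerts c J ∧ p.2.length < J ∧ i < c p := by
  rw [mem_forestVerts, mem_forestVerts, inForest_child]
  have : (p.child i).2.length = p.2.length + 1 := rfl
  rw [this]
  constructor
  · rintro ⟨⟨h1, h2⟩, h3⟩
    exact ⟨⟨h1, by omega⟩, by omega, h2⟩
  · rintro ⟨⟨h1, -⟩, h2, h3⟩
    exact ⟨⟨h1, h3⟩, by omega⟩

/-- The truncated forest is determined by the offspring numbers at height less than `J`, and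
conversely determines them. -/
theorem forestVerts_eq_iff {c c₀ : Word m → ℕ} {J : ℕ} :
    forestVerts c J = forestVerts c₀ J ↔
      ∀ p ∈ (forestVerts c₀ J).filter (fun p => p.2.length < J), c p = c₀ p := by
  constructor
  · intro h p hp
    obtain ⟨hp, hpJ⟩ := Finset.mem_filter.1 hp
    have key : ∀ i, i < c p ↔ i < c₀ p := by
      intro i
      have h1 : p.child i ∈ forestVerts c J ↔ p.child i ∈ forestVerts c₀ J := by rw [h]
      rw [child_mem_forestVerts, child_mem_forestVerts, h] at h1
      simpa [hp, hpJ] using h1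
    rcases lt_trichotomy (c p) (c₀ p) with hlt | heq | hlt
    · exact absurd ((key _).2 hlt) (lt_irrefl _)
    · exact heq
    · exact absurd ((key _).1 hlt) (lt_irrefl _)
  · intro h
    ext ⟨a, u⟩
    induction u with
    | nil => exact iff_of_true (root_mem_forestVerts _ _ _) (root_mem_forestVerts _ _ _)
    | cons i u ih =>
      have e : ((a, i :: u) : Word m) = Word.child (a, u) i := rfl
      rw [e, child_mem_forestVerts, child_mem_forestVerts, ih]
      refine and_congr_right fun hm => and_congr_right fun hl => ?_
      rw [h _ (Finset.mem_filter.2 ⟨hm, hl⟩)]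

end Forest

/-- A finite set of words together with a vertex of `Fin (n + 1)` for each of them. -/
abbrev Placement (m n : ℕ) : Type := Σ V : Finset (Word m), (V → Fin (n + 1))

namespace Placement

variable {m n : ℕ}

/-- The vertex where a word is placed. -/
def pos (θ : Placement m n) (p : Word m) : Fin (n + 1) :=
  if h : p ∈ θ.1 then θ.2 ⟨p, h⟩ else 0

theorem ext_pos {θ θ' : Placement m n} (h : θ.1 = θ'.1) (h' : ∀ p ∈ θ.1, θ.pos p = θ'.pos p) :
    θ = θ' := by
  obtain ⟨V, f⟩ := θ
  obtain ⟨V', f'⟩ := θ'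
  obtain rfl : V = V' := h
  congr 1
  funext ⟨p, hp⟩
  have hp' : p ∈ (⟨V, f⟩ : Placement m n).1 := hp
  have := h' p hp'
  simp only [pos, hp, dif_pos] at this
  exact this

/-- The words of height less than `J`. -/
def interior (J : ℕ) (θ : Placement m n) : Finset (Word m) := θ.1.filter fun p => p.2.length < J

/-- The words that are not roots. -/
def nonroots (θ : Placement m n) : Finset (Word m) := θ.1.filter fun p => p.2 ≠ []

/-- The placed words are the vertices of a forest truncated at height `J`, with distinct places. -/
structure Good (J : ℕ) (θ : Placement m n) (c : Word m → ℕ) : Prop where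
  verts : θ.1 = forestVerts c J
  inj : Set.InjOn θ.pos θ.1

/-- The pair `a` is the place of an edge of the forest. -/
def IsEdge (θ : Placement m n) (a : PairEdge (n + 1)) : Prop :=
  ∃ p ∈ θ.nonroots, a.1 = s(θ.pos p.parent, θ.pos p)

/-- The pair `a` contains the place of a word of height less than `J`. -/
def Touches (J : ℕ) (θ : Placement m n) (a : PairEdge (n + 1)) : Prop :=
  ∃ p ∈ θ.interior J, θ.pos p ∈ a.1

/-- The placed edges of the forest are the only edges at the vertices of height less than `J`, and
they are simple. -/
def Explored (J : ℕ) (θ : Placement m n) (Q : PairEdge (n + 1) → PointConfig) : Prop :=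
  ∀ a, (θ.IsEdge a → (Q a).count Set.univ = 1) ∧
    (¬ θ.IsEdge a → θ.Touches J a → (Q a).count Set.univ = 0)

/-- The children of each word are placed in the order given by `σ`. -/
def Sorted (J : ℕ) (θ : Placement m n) (c : Word m → ℕ) (σ : Fin (n + 1) → Equiv.Perm (Fin (n + 1))) :
    Prop :=
  ∀ p ∈ θ.interior J, StrictMono fun i : Fin (c p) => σ (θ.pos p) (θ.pos (p.child i))

variable {J : ℕ} {θ θ' : Placement m n} {c c' : Word m → ℕ}

theorem Good.child_mem (h : θ.Good J c) {p : Word m} {i : ℕ} :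
    p.child i ∈ θ.1 ↔ p ∈ θ.interior J ∧ i < c p := by
  rw [interior, Finset.mem_filter, h.verts, child_mem_forestVerts, and_assoc]

theorem Good.child_mem_nonroots (h : θ.Good J c) {p : Word m} {i : ℕ} :
    p.child i ∈ θ.nonroots ↔ p ∈ θ.interior J ∧ i < c p := by
  rw [nonroots, Finset.mem_filter, h.child_mem]
  exact and_iff_left (List.cons_ne_nil _ _)

theorem interior_subset : θ.interior J ⊆ θ.1 := Finset.filter_subset _ _

theorem nonroots_subset : θ.nonroots ⊆ θ.1 := Finset.filter_subset _ _

theorem Good.parent_mem (h : θ.Good J c) {p : Word m} (hp : p ∈ θ.nonroots) :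
    p.parent ∈ θ.interior J := by
  obtain ⟨i, hi⟩ := Word.exists_eq_child (Finset.mem_filter.1 hp).2
  rw [hi, h.child_mem_nonroots] at hp
  exact hp.1

theorem parent_ne {p : Word m} (hp : p ∈ θ.nonroots) : p.parent ≠ p := by
  obtain ⟨i, hi⟩ := Word.exists_eq_child (Finset.mem_filter.1 hp).2
  intro h
  have := congrArg (fun q : Word m => q.2.length) hi
  rw [h] at this
  simp [Word.child] at this

theorem Good.pos_parent_ne (h : θ.Good J c) {p : Word m} (hp : p ∈ θ.nonroots) :
    θ.pos p.parent ≠ θ.pos p := fun heq =>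
  parent_ne hp (h.inj (interior_subset (h.parent_mem hp)) (nonroots_subset hp) heq)

/-- The neighbours of a placed word in an explored configuration. -/
theorem Good.neighbour_iff (h : θ.Good J c) {Q : PairEdge (n + 1) → PointConfig}
    (hQ : θ.Explored J Q) {p : Word m} (hp : p ∈ θ.interior J) (y : Fin (n + 1))
    (hy : ¬ (s(θ.pos p, y)).IsDiag) :
    (Q ⟨s(θ.pos p, y), hy⟩).count Set.univ ≠ 0 ↔
      (p.2 ≠ [] ∧ y = θ.pos p.parent) ∨ ∃ i < c p, y = θ.pos (p.child i) := by
  have h1 : (Q ⟨s(θ.pos p, y), hy⟩).count Set.univ ≠ 0 ↔ θ.IsEdge ⟨s(θ.pos p, y), hy⟩ := by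
    by_cases he : θ.IsEdge ⟨s(θ.pos p, y), hy⟩
    · exact iff_of_true (by rw [(hQ _).1 he]; exact one_ne_zero) he
    · exact iff_of_false (fun hne => hne ((hQ _).2 he ⟨p, hp, Sym2.mem_mk_left _ _⟩)) he
  rw [h1]
  have hpV := interior_subset hp
  constructor
  · rintro ⟨q, hq, hqe⟩
    have hqV := nonroots_subset hq
    have hqp := h.parent_mem hq
    rcases Sym2.eq_iff.1 hqe with ⟨h2, h3⟩ | ⟨h2, h3⟩
    · right
      have heq : p = q.parent := h.inj hpV (interior_subset hqp) h2
      obtain ⟨i, hi⟩ := Word.exists_eq_child (Finset.mem_filter.1 hq).2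
      rw [← heq] at hi
      rw [hi, h.child_mem_nonroots] at hq
      exact ⟨i, hq.2, by rw [h3, ← hi]⟩
    · left
      have heq : p = q := h.inj hpV hqV h2
      exact ⟨heq ▸ (Finset.mem_filter.1 hq).2, by rw [h3, heq]⟩
  · rintro (⟨hr, rfl⟩ | ⟨i, hi, rfl⟩)
    · exact ⟨p, Finset.mem_filter.2 ⟨hpV, hr⟩, Sym2.eq_swap⟩
    · exact ⟨p.child i, h.child_mem_nonroots.2 ⟨hp, hi⟩, rfl⟩

theorem Good.range_children (h : θ.Good J c) {Q : PairEdge (n + 1) → PointConfig}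
    (hQ : θ.Explored J Q) {p : Word m} (hp : p ∈ θ.interior J) (y : Fin (n + 1)) :
    (∃ i < c p, y = θ.pos (p.child i)) ↔ ∃ hy : ¬ (s(θ.pos p, y)).IsDiag,
      (Q ⟨s(θ.pos p, y), hy⟩).count Set.univ ≠ 0 ∧ ¬ (p.2 ≠ [] ∧ y = θ.pos p.parent) := by
  constructor
  · rintro ⟨i, hi, rfl⟩
    have hm := h.child_mem_nonroots.2 ⟨hp, hi⟩
    have hne := h.pos_parent_ne hm
    rw [Word.parent_child] at hne
    refine ⟨by rwa [Sym2.mk_isDiag_iff], (h.neighbour_iff hQ hp _ _).2 (Or.inr ⟨i, hi, rfl⟩), ?_⟩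
    rintro ⟨hr, heq⟩
    have hpn : p ∈ θ.nonroots := Finset.mem_filter.2 ⟨interior_subset hp, hr⟩
    have := h.inj (nonroots_subset hm) (interior_subset (h.parent_mem hpn)) heq
    have := congrArg (fun q : Word m => q.2.length) this
    simp only [Word.child, Word.parent, List.length_cons, List.length_tail] at this
    omega
  · rintro ⟨hy, h1, h2⟩
    exact ((h.neighbour_iff hQ hp y hy).1 h1).resolve_left h2

/-- Given an order around every vertex, a configuration contains at most one sorted explored forest.
-/
theorem eq_of_sorted {σ : Fin (n + 1) → Equiv.Perm (Fin (n + 1))}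
    {Q : PairEdge (n + 1) → PointConfig} (h : θ.Good J c) (h' : θ'.Good J c')
    (hQ : θ.Explored J Q) (hQ' : θ'.Explored J Q) (hs : θ.Sorted J c σ) (hs' : θ'.Sorted J c' σ)
    (hroot : ∀ i : Fin m, θ.pos (i, []) = θ'.pos (i, [])) : θ = θ' := by
  have key : ∀ u : List ℕ, ∀ a : Fin m, (((a, u) : Word m) ∈ θ.1 ↔ ((a, u) : Word m) ∈ θ'.1) ∧
      ∀ w, w <:+ u → ((a, w) : Word m) ∈ θ.1 → θ.pos (a, w) = θ'.pos (a, w) := by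
    intro u
    induction u with
    | nil =>
      intro a
      refine ⟨iff_of_true ?_ ?_, fun w hw _ => ?_⟩
      · rw [h.verts]; exact root_mem_forestVerts _ _ _
      · rw [h'.verts]; exact root_mem_forestVerts _ _ _
      · rw [List.suffix_nil.1 hw]; exact hroot a
    | cons j u ih =>
      intro a
      set p : Word m := (a, u) with hp
      obtain ⟨ih1, ih2⟩ := ih a
      suffices hsuf : (p.child j ∈ θ.1 ↔ p.child j ∈ θ'.1) ∧ (p.child j ∈ θ.1 →
          θ.pos (p.child j) = θ'.pos (p.child j)) by
        refine ⟨hsuf.1, fun w hw hwm => ?_⟩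
        rcases List.suffix_cons_iff.1 hw with rfl | hw
        · exact hsuf.2 hwm
        · exact ih2 w hw hwm
      have hint : p ∈ θ.interior J ↔ p ∈ θ'.interior J := by
        rw [interior, interior, Finset.mem_filter, Finset.mem_filter, ih1]
      by_cases hpi : p ∈ θ.interior J
      · have hpi' := hint.1 hpi
        have hpos : θ.pos p = θ'.pos p := ih2 u (List.suffix_refl _) (interior_subset hpi)
        have hpar : p.2 ≠ [] → θ.pos p.parent = θ'.pos p.parent := fun hne =>
          ih2 _ (List.tail_suffix u) (interior_subset (h.parent_mem
            (Finset.mem_filter.2 ⟨interior_subset hpi, hne⟩)))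
        -- The set of places of the children is read off the configuration: the neighbours of the
        -- place of `p` other than that of its parent.
        have hrange : ∀ y, (∃ i < c p, y = θ.pos (p.child i)) ↔
            ∃ i < c' p, y = θ'.pos (p.child i) := by
          intro y
          rw [h.range_children hQ hpi, h'.range_children hQ' hpi', hpos]
          refine exists_congr fun _ => and_congr_right fun _ => not_congr ?_
          exact and_congr_right fun hne => by rw [hpar hne]
        have hinj : Function.Injective fun i : Fin (c p) => θ.pos (p.child i) := fun i i' hii =>
          Fin.ext (Word.child_injective p (h.inj (h.child_mem.2 ⟨hpi, i.2⟩)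
            (h.child_mem.2 ⟨hpi, i'.2⟩) hii))
        have hinj' : Function.Injective fun i : Fin (c' p) => θ'.pos (p.child i) := fun i i' hii =>
          Fin.ext (Word.child_injective p (h'.inj (h'.child_mem.2 ⟨hpi', i.2⟩)
            (h'.child_mem.2 ⟨hpi', i'.2⟩) hii))
        have hr : (Set.range fun i : Fin (c p) => θ.pos (p.child i)) =
            Set.range fun i : Fin (c' p) => θ'.pos (p.child i) := by
          ext y
          have := hrange y
          simp only [Set.mem_range, Fin.exists_iff]
          constructor
          · rintro ⟨i, hi, rfl⟩
            obtain ⟨i', hi', e⟩ := this.1 ⟨i, hi, rfl⟩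
            exact ⟨i', hi', e.symm⟩
          · rintro ⟨i, hi, rfl⟩
            obtain ⟨i', hi', e⟩ := this.2 ⟨i, hi, rfl⟩
            exact ⟨i', hi', e.symm⟩
        have hc : c p = c' p := by
          have := congrArg Set.ncard hr
          rwa [← Set.image_univ, ← Set.image_univ, Set.ncard_image_of_injective _ hinj,
            Set.ncard_image_of_injective _ hinj', Set.ncard_univ, Set.ncard_univ,
            Nat.card_eq_fintype_card, Nat.card_eq_fintype_card, Fintype.card_fin,
            Fintype.card_fin] at this
        refine ⟨by rw [h.child_mem, h'.child_mem, hint, hc], fun hm => ?_⟩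
        have hj := (h.child_mem.1 hm).2
        have hmono := hs p hpi
        have hmono' : StrictMono fun i : Fin (c p) => σ (θ.pos p) (θ'.pos (p.child i)) := by
          rw [hpos, hc]; exact hs' p hpi'
        have hr' : (Set.range fun i : Fin (c p) => σ (θ.pos p) (θ.pos (p.child i))) =
            Set.range fun i : Fin (c p) => σ (θ.pos p) (θ'.pos (p.child i)) := by
          rw [← hc] at hr
          have := congrArg (fun S => σ (θ.pos p) '' S) hr
          simpa only [← Set.range_comp, Function.comp_def] using this
        -- Two increasing enumerations of the same finite set coincide.
        have := congrFun ((hmono.range_inj hmono').1 hr') ⟨j, hj⟩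
        exact (σ (θ.pos p)).injective this
      · have h1 : p.child j ∉ θ.1 := fun hm => hpi (h.child_mem.1 hm).1
        have h2 : p.child j ∉ θ'.1 := fun hm => hpi (hint.2 (h'.child_mem.1 hm).1)
        exact ⟨iff_of_false h1 h2, fun hm => absurd hm h1⟩
  exact ext_pos (Finset.ext fun p => (key p.2 p.1).1) fun p hp => (key p.2 p.1).2 _ (List.suffix_refl _) hp

end Placement

/-! ### Weights of the explored forests -/

section Permutations

open Classical in
/-- At least a fraction `1 / c !` of the permutations are increasing along `c` given points. -/
theorem factorial_le_card_strictMono {N c : ℕ} {y : Fin c → Fin N} (hy : Function.Injective y) :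
    N.factorial ≤ (Finset.univ.filter fun τ : Equiv.Perm (Fin N) =>
      StrictMono fun i => τ (y i)).card * c.factorial := by
  let e : Fin c ↪ Fin N := ⟨y, hy⟩
  -- Each permutation is rearranged so as to be increasing along `y`, and the sorting permutation is
  -- remembered. The pair determines `τ`.
  let f : Equiv.Perm (Fin N) → Equiv.Perm (Fin N) × Equiv.Perm (Fin c) := fun τ =>
    (τ * (Tuple.sort fun i => τ (y i)).viaEmbedding e, Tuple.sort fun i => τ (y i))
  have hf : Function.Injective f := by
    intro τ τ' h
    obtain ⟨h1, h2⟩ := Prod.mk.inj h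
    rw [h2] at h1
    exact mul_right_cancel h1
  have hmem : ∀ τ ∈ (Finset.univ : Finset (Equiv.Perm (Fin N))), f τ ∈
      (Finset.univ.filter fun τ : Equiv.Perm (Fin N) => StrictMono fun i => τ (y i)) ×ˢ
        (Finset.univ : Finset (Equiv.Perm (Fin c))) := by
    intro τ _
    refine Finset.mem_product.2 ⟨Finset.mem_filter.2 ⟨Finset.mem_univ _, ?_⟩, Finset.mem_univ _⟩
    have h1 := Tuple.monotone_sort fun i => τ (y i)
    have h2 : (fun i => (f τ).1 (y i)) = (fun i => τ (y i)) ∘ Tuple.sort fun i => τ (y i) := by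
      funext i
      change τ ((Tuple.sort fun i => τ (y i)).viaEmbedding e (e i)) = _
      rw [Equiv.Perm.viaEmbedding_apply]
      rfl
    rw [h2]
    exact h1.strictMono_of_injective
      ((τ.injective.comp hy).comp (Equiv.injective _))
  have := Finset.card_le_card_of_injOn f hmem hf.injOn
  rwa [Finset.card_univ, Fintype.card_perm, Fintype.card_fin, Finset.card_product,
    Finset.card_univ, Fintype.card_perm, Fintype.card_fin] at this

end Permutations

namespace Placement

variable {m n : ℕ} {J : ℕ} {θ : Placement m n} {c : Word m → ℕ}

/-- The number of placed children of a word. -/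
noncomputable def offspring (θ : Placement m n) (p : Word m) : ℕ := {i | p.child i ∈ θ.1}.ncard

theorem Good.offspring_eq (h : θ.Good J c) {p : Word m} (hp : p ∈ θ.interior J) :
    θ.offspring p = c p := by
  have : {i | p.child i ∈ θ.1} = Set.Iio (c p) := by
    ext i
    simp [h.child_mem, hp]
  rw [offspring, this, Set.ncard_eq_toFinset_card', Set.toFinset_Iio, Nat.card_Iio]

/-- A placement determines its own offspring numbers, so sums can run over placements alone. -/
theorem Good.good_offspring (h : θ.Good J c) : θ.Good J θ.offspring where
  verts := by
    rw [h.verts, eq_comm, forestVerts_eq_iff, ← h.verts]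
    exact fun p hp => h.offspring_eq hp
  inj := h.inj

-- Distinct words have distinct places, so sortedness imposes at most one condition on the
-- permutation attached to each vertex. The count factorises over the vertices into bounds from
-- `factorial_le_card_strictMono`.
open Classical in
theorem Good.card_sorted (h : θ.Good J c) :
    (n + 1).factorial ^ (n + 1) ≤
      (Finset.univ.filter fun σ : Fin (n + 1) → Equiv.Perm (Fin (n + 1)) =>
        θ.Sorted J c σ).card * ∏ p ∈ θ.interior J, (c p).factorial := by
  let A : Fin (n + 1) → Finset (Equiv.Perm (Fin (n + 1))) := fun x =>
    Finset.univ.filter fun τ => ∀ p ∈ θ.interior J, θ.pos p = x →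
      StrictMono fun i : Fin (c p) => τ (θ.pos (p.child i))
  have hA : (Finset.univ.filter fun σ : Fin (n + 1) → Equiv.Perm (Fin (n + 1)) =>
      θ.Sorted J c σ) = Fintype.piFinset A := by
    ext σ
    simp only [Finset.mem_filter, Finset.mem_univ, true_and, Fintype.mem_piFinset, A]
    constructor
    · rintro hσ _ p hp rfl
      exact hσ p hp
    · exact fun hσ p hp => hσ _ p hp rfl
  have hprod : ∏ p ∈ θ.interior J, (c p).factorial =
      ∏ x : Fin (n + 1), ∏ p ∈ θ.interior J with θ.pos p = x, (c p).factorial :=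
    (Finset.prod_fiberwise _ _ _).symm
  rw [hA, Fintype.card_piFinset, hprod, ← Finset.prod_mul_distrib]
  calc (n + 1).factorial ^ (n + 1) = ∏ _x : Fin (n + 1), (n + 1).factorial := by simp
    _ ≤ _ := Finset.prod_le_prod' fun x _ => ?_
  by_cases hx : ∃ p ∈ θ.interior J, θ.pos p = x
  · obtain ⟨p, hp, rfl⟩ := hx
    have huniq : ∀ q ∈ θ.interior J, θ.pos q = θ.pos p → q = p := fun q hq =>
      h.inj (interior_subset hq) (interior_subset hp)
    have h1 : (θ.interior J).filter (fun q => θ.pos q = θ.pos p) = {p} := by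
      ext q
      simp only [Finset.mem_filter, Finset.mem_singleton]
      exact ⟨fun hq => huniq q hq.1 hq.2, by rintro rfl; exact ⟨hp, rfl⟩⟩
    rw [h1, Finset.prod_singleton]
    have h2 : A (θ.pos p) = Finset.univ.filter fun τ : Equiv.Perm (Fin (n + 1)) =>
        StrictMono fun i : Fin (c p) => τ (θ.pos (p.child i)) := by
      ext τ
      simp only [A, Finset.mem_filter, Finset.mem_univ, true_and]
      refine ⟨fun hτ => hτ p hp rfl, fun hτ q hq hqp => ?_⟩
      obtain rfl := huniq q hq hqp
      exact hτ
    rw [h2]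
    refine factorial_le_card_strictMono (y := fun i : Fin (c p) => θ.pos (p.child i)) ?_
    exact fun i i' hii => Fin.ext (Word.child_injective p (h.inj (h.child_mem.2 ⟨hp, i.2⟩)
      (h.child_mem.2 ⟨hp, i'.2⟩) hii))
  · push Not at hx
    have h1 : (θ.interior J).filter (fun q => θ.pos q = x) = ∅ :=
      Finset.filter_eq_empty_iff.2 fun q hq => hx q hq
    have h2 : A x = Finset.univ := Finset.filter_true_of_mem fun τ _ p hp hpx =>
      absurd hpx (hx p hp)
    rw [h1, h2, Finset.prod_empty, mul_one, Finset.card_univ, Fintype.card_perm, Fintype.card_fin]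

/-- The inverse of the product of the factorials of the offspring numbers. -/
noncomputable def weight (J : ℕ) (θ : Placement m n) : ℝ≥0∞ :=
  ∏ p ∈ θ.interior J, ((θ.offspring p).factorial : ℝ≥0∞)⁻¹

open Classical in
/-- The total weight of the explored forests with given roots is at most one. -/
theorem tsum_weight_le (J : ℕ) (Q : PairEdge (n + 1) → PointConfig) (x : Fin m → Fin (n + 1)) :
    ∑' θ : Placement m n, (if θ.Good J θ.offspring ∧ (∀ i, θ.pos (i, []) = x i) ∧ θ.Explored J Q
      then θ.weight J else 0) ≤ 1 := by
  rw [ENNReal.tsum_eq_iSup_sum]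
  refine iSup_le fun S => ?_
  rw [← Finset.sum_filter]
  set S' := S.filter fun θ => θ.Good J θ.offspring ∧ (∀ i, θ.pos (i, []) = x i) ∧ θ.Explored J Q
  -- Double counting of the pairs of a forest and a family of permutations sorting it, among `K`
  -- families: a forest is sorted by at least `weight * K` of them (`h1`), and each family sorts at
  -- most one explored forest (`h2`).
  set K : ℕ := (n + 1).factorial ^ (n + 1) with hK
  have hK0 : (K : ℝ≥0∞) ≠ 0 := by
    rw [hK]; exact_mod_cast (pow_pos (Nat.factorial_pos _) _).ne'
  let O : Placement m n → Finset (Fin (n + 1) → Equiv.Perm (Fin (n + 1))) := fun θ =>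
    Finset.univ.filter fun σ => θ.Sorted J θ.offspring σ
  have h1 : ∀ θ ∈ S', θ.weight J * K ≤ (O θ).card := by
    intro θ hθ
    have hg := (Finset.mem_filter.1 hθ).2.1
    have hle := hg.card_sorted
    have hle' : (K : ℝ≥0∞) ≤ ((O θ).card : ℝ≥0∞) *
        ∏ p ∈ θ.interior J, ((θ.offspring p).factorial : ℝ≥0∞) := by
      exact_mod_cast hle
    have hw : θ.weight J = (∏ p ∈ θ.interior J, ((θ.offspring p).factorial : ℝ≥0∞))⁻¹ := by
      rw [weight, ENNReal.prod_inv_distrib]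
      intro p _ q _ _
      exact Or.inr (ENNReal.natCast_ne_top _)
    rw [hw, mul_comm, ← div_eq_mul_inv]
    exact ENNReal.div_le_of_le_mul hle'
  have h2 : ∑ θ ∈ S', (O θ).card ≤ K := by
    have : ∑ θ ∈ S', (O θ).card = ∑ σ, (S'.filter fun θ => θ.Sorted J θ.offspring σ).card := by
      simp only [O, Finset.card_filter]
      exact Finset.sum_comm
    rw [this]
    calc _ ≤ ∑ _σ : Fin (n + 1) → Equiv.Perm (Fin (n + 1)), 1 := by
          refine Finset.sum_le_sum fun σ _ => Finset.card_le_one.2 fun θ hθ θ' hθ' => ?_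
          obtain ⟨ha, hs⟩ := Finset.mem_filter.1 hθ
          obtain ⟨ha', hs'⟩ := Finset.mem_filter.1 hθ'
          obtain ⟨hg, hr, hQ⟩ := (Finset.mem_filter.1 ha).2
          obtain ⟨hg', hr', hQ'⟩ := (Finset.mem_filter.1 ha').2
          exact eq_of_sorted hg hg' hQ hQ' hs hs' fun i => (hr i).trans (hr' i).symm
      _ = K := by simp [hK, Fintype.card_perm]
  have h3 : (∑ θ ∈ S', θ.weight J) * K ≤ 1 * K := by
    rw [Finset.sum_mul, one_mul]
    exact (Finset.sum_le_sum h1).trans (by exact_mod_cast h2)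
  exact (ENNReal.mul_le_mul_iff_left hK0 (ENNReal.natCast_ne_top _)).1 h3

end Placement

/-! ### The law of an explored configuration -/

theorem PointConfig.count_univ_eq_zero {c : PointConfig} : c.count Set.univ = 0 ↔ c = none := by
  rw [PointConfig.count, Set.inter_univ, Set.encard_eq_zero]
  exact ⟨fun h => Subtype.ext h, fun h => by rw [h]; rfl⟩

/-- The law of a Poisson process with intensity `r` on `[0, t]`, as far as configurations with at
most one point are concerned. -/
structure IsTruncatedLaw (r t : ℝ≥0) (L : Measure PointConfig) : Prop where
  zero : L {c | c.count Set.univ = 0} = ENNReal.ofReal (Real.exp (-(r * t : ℝ≥0)))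
  one : ∀ B, MeasurableSet B → L ({c | c.count Set.univ = 1} ∩ B) =
    ENNReal.ofReal (Real.exp (-(r * t : ℝ≥0))) * ((r * t : ℝ≥0) *
      (volume.restrict (Set.Icc (0 : ℝ) 1)) {s | PointConfig.single (t * s) ∈ B})

theorem IsPoissonProcess.isTruncatedLaw {Ω : Type*} [MeasurableSpace Ω] {μ : Measure Ω} {r : ℝ≥0}
    {P : Ω → PointConfig} (h : IsPoissonProcess r P μ) (t : ℝ≥0) :
    IsTruncatedLaw r t (μ.map fun ω => (P ω).trunc t) where
  zero := by
    have hm : Measurable fun ω => (P ω).trunc t :=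
      (PointConfig.measurable_trunc _).comp h.measurable
    have h0 : MeasurableSet {c : PointConfig | c.count Set.univ = 0} :=
      PointConfig.measurable_count MeasurableSet.univ (measurableSet_singleton 0)
    rw [Measure.map_apply hm h0]
    exact h.measure_trunc_none t
  one B hB := by
    have hm : Measurable fun ω => (P ω).trunc t :=
      (PointConfig.measurable_trunc _).comp h.measurable
    have h1 : MeasurableSet {c : PointConfig | c.count Set.univ = 1} :=
      PointConfig.measurable_count MeasurableSet.univ (measurableSet_singleton 1)
    rw [Measure.map_apply hm (h1.inter hB)]
    exact h.measure_trunc_single t hB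

namespace Placement

variable {m n : ℕ} {J : ℕ} {θ : Placement m n} {c : Word m → ℕ}

theorem Good.eq_of_edge (h : θ.Good J c) {p q : Word m} (hp : p ∈ θ.nonroots) (hq : q ∈ θ.nonroots)
    (he : s(θ.pos p.parent, θ.pos p) = s(θ.pos q.parent, θ.pos q)) : p = q := by
  rcases Sym2.eq_iff.1 he with ⟨-, h2⟩ | ⟨h1, h2⟩
  · exact h.inj (nonroots_subset hp) (nonroots_subset hq) h2
  · have h3 := h.inj (interior_subset (h.parent_mem hp)) (nonroots_subset hq) h1
    have h4 := h.inj (nonroots_subset hp) (interior_subset (h.parent_mem hq)) h2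
    have hp' := (Finset.mem_filter.1 hp).2
    have h5 := congrArg (fun q : Word m => q.2.length) h3
    have h6 := congrArg (fun q : Word m => q.2.length) h4
    simp only [Word.parent, List.length_tail] at h5 h6
    have := List.length_pos_iff.2 hp'
    omega

open Classical in
/-- The configuration `Q` modified so that the placed forest is explored, the edge above `p` having
label `t * s p`. -/
noncomputable def plug (J : ℕ) (θ : Placement m n) (t : ℝ) (s : Word m → ℝ)
    (Q : PairEdge (n + 1) → PointConfig) (a : PairEdge (n + 1)) : PointConfig :=
  if h : θ.IsEdge a then PointConfig.single (t * s h.choose)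
  else if θ.Touches J a then PointConfig.none else Q a

theorem Good.plug_edge (h : θ.Good J c) {t : ℝ} {s : Word m → ℝ}
    {Q : PairEdge (n + 1) → PointConfig} {a : PairEdge (n + 1)} {p : Word m} (hp : p ∈ θ.nonroots)
    (ha : a.1 = s(θ.pos p.parent, θ.pos p)) :
    θ.plug J t s Q a = PointConfig.single (t * s p) := by
  have he : θ.IsEdge a := ⟨p, hp, ha⟩
  have : he.choose = p := h.eq_of_edge he.choose_spec.1 hp (he.choose_spec.2.symm.trans ha)
  rw [plug, dif_pos he, this]

theorem plug_touches {t : ℝ} {s : Word m → ℝ} {Q : PairEdge (n + 1) → PointConfig}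
    {a : PairEdge (n + 1)} (he : ¬ θ.IsEdge a) (ht : θ.Touches J a) :
    θ.plug J t s Q a = PointConfig.none := by
  rw [plug, dif_neg he, if_pos ht]

theorem plug_rest {t : ℝ} {s : Word m → ℝ} {Q : PairEdge (n + 1) → PointConfig}
    {a : PairEdge (n + 1)} (he : ¬ θ.IsEdge a) (ht : ¬ θ.Touches J a) :
    θ.plug J t s Q a = Q a := by
  rw [plug, dif_neg he, if_neg ht]

theorem measurable_plug (J : ℕ) (θ : Placement m n) (t : ℝ) :
    Measurable fun x : (Word m → ℝ) × (PairEdge (n + 1) → PointConfig) =>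
      θ.plug J t x.1 x.2 := by
  refine measurable_pi_lambda _ fun a => ?_
  by_cases he : θ.IsEdge a
  · simp only [plug, dif_pos he]
    exact PointConfig.measurable_single.comp
      (measurable_const.mul ((measurable_pi_apply _).comp measurable_fst))
  · by_cases ht : θ.Touches J a
    · simp only [plug, dif_neg he, if_pos ht]
      exact measurable_const
    · simp only [plug, dif_neg he, if_neg ht]
      exact (measurable_pi_apply a).comp measurable_snd

open Classical in
/-- The law at the pair `a` of a configuration in which the placed forest has been plugged. -/
noncomputable def pairLaw (J : ℕ) (θ : Placement m n) (t : ℝ≥0)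
    (L : PairEdge (n + 1) → Measure PointConfig) (a : PairEdge (n + 1)) : Measure PointConfig :=
  if θ.IsEdge a then
    (volume.restrict (Set.Icc (0 : ℝ) 1)).map fun s => PointConfig.single ((t : ℝ) * s)
  else if θ.Touches J a then Measure.dirac PointConfig.none else L a

open Classical in
/-- The probability density of what is explored at the pair `a`. -/
noncomputable def pairFactor (J : ℕ) (θ : Placement m n) (r t : ℝ≥0) (a : PairEdge (n + 1)) :
    ℝ≥0∞ :=
  if θ.IsEdge a then ENNReal.ofReal (Real.exp (-(r * t : ℝ≥0))) * (r * t : ℝ≥0)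
  else if θ.Touches J a then ENNReal.ofReal (Real.exp (-(r * t : ℝ≥0))) else 1

theorem measurable_single_mul (t : ℝ≥0) :
    Measurable fun s : ℝ => PointConfig.single ((t : ℝ) * s) :=
  PointConfig.measurable_single.comp (measurable_const.mul measurable_id)

variable {r t : ℝ≥0} {L : PairEdge (n + 1) → Measure PointConfig}

instance isProbabilityMeasure_pairLaw [∀ a, IsProbabilityMeasure (L a)] (a : PairEdge (n + 1)) :
    IsProbabilityMeasure (θ.pairLaw J t L a) := by
  unfold pairLaw
  split_ifs
  · exact Measure.isProbabilityMeasure_map (measurable_single_mul t).aemeasurable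
  · infer_instance
  · infer_instance

-- The exploration event is a product over pairs. An edge pair must carry one point, which is then
-- uniform on `[0, t]`. The other touched pairs must be empty, and the remaining ones are free. Each
-- pair contributes its factor times its conditional law.
open Classical in
theorem restrict_explored [∀ a, IsProbabilityMeasure (L a)] (hL : ∀ a, IsTruncatedLaw r t (L a)) :
    (Measure.pi L).restrict {Q | θ.Explored J Q} =
      (∏ a, θ.pairFactor J r t a) • Measure.pi (θ.pairLaw J t L) := by
  let S : PairEdge (n + 1) → Set PointConfig := fun a =>
    if θ.IsEdge a then {c | c.count Set.univ = 1}
    else if θ.Touches J a then {c | c.count Set.univ = 0} else Set.univ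
  have hS : {Q | θ.Explored J Q} = Set.univ.pi S := by
    ext Q
    simp only [Set.mem_ofPred_eq, Set.mem_univ_pi, Explored, S]
    refine forall_congr' fun a => ?_
    by_cases he : θ.IsEdge a <;> by_cases ht : θ.Touches J a <;> simp [he, ht]
  have hR : ∀ a, (L a).restrict (S a) = θ.pairFactor J r t a • θ.pairLaw J t L a := by
    intro a
    ext B hB
    rw [Measure.restrict_apply hB, Measure.smul_apply, smul_eq_mul, Set.inter_comm]
    simp only [S, pairFactor, pairLaw]
    split_ifs with he ht
    · rw [(hL a).one B hB, Measure.map_apply (measurable_single_mul t) hB, mul_assoc]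
      rfl
    · rw [Measure.dirac_apply' _ hB]
      have h0 : {c : PointConfig | c.count Set.univ = 0} = {PointConfig.none} := by
        ext c; exact PointConfig.count_univ_eq_zero
      by_cases hn : PointConfig.none ∈ B
      · rw [Set.indicator_of_mem hn, Pi.one_apply, mul_one, ← (hL a).zero]
        congr 1
        rw [h0]
        exact Set.inter_eq_left.2 (Set.singleton_subset_iff.2 hn)
      · rw [Set.indicator_of_notMem hn, mul_zero, h0, Set.singleton_inter_eq_empty.2 hn,
          measure_empty]
    · rw [one_mul, Set.univ_inter]
  rw [hS, Measure.restrict_pi_pi]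
  refine Measure.pi_eq fun B hB => ?_
  rw [Measure.smul_apply, smul_eq_mul, Measure.pi_pi, ← Finset.prod_mul_distrib]
  exact Finset.prod_congr rfl fun a _ => by rw [hR, Measure.smul_apply, smul_eq_mul]

variable {Ω' : Type*} [MeasurableSpace Ω'] {ν : Measure Ω'}
  {ξ : Word m → Ω' → ℕ × ℝ}

theorem measurableSet_offspring (hξ : ∀ p, Measurable (ξ p)) (θ : Placement m n) (J : ℕ)
    (q : Word m → ℕ) : MeasurableSet {ω | ∀ p ∈ θ.interior J, (ξ p ω).1 = q p} := by
  have : {ω | ∀ p ∈ θ.interior J, (ξ p ω).1 = q p} =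
      ⋂ p ∈ θ.interior J, {ω | (ξ p ω).1 = q p} := by ext; simp
  rw [this]
  exact Finset.measurableSet_biInter _ fun p _ =>
    (measurable_fst.comp (hξ p)) (measurableSet_singleton (q p))

-- The marks are split into offspring numbers of interior words and labels of words that are not
-- roots. They are independent, and each label enters exactly one pair, so plugging produces the
-- product law `pairLaw` already met in `restrict_explored`.
open Classical in
theorem Good.map_plug_apply (h : θ.Good J c) [∀ a, IsProbabilityMeasure (L a)]
    (hξ : ∀ p, Measurable (ξ p))
    (hlaw : ∀ p, ν.map (ξ p) = (poissonMeasure t).prod (volume.restrict (Set.Icc (0 : ℝ) 1)))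
    (hind : iIndepFun ξ ν) (q : Word m → ℕ)
    {B : PairEdge (n + 1) → Set PointConfig} (hB : ∀ a, MeasurableSet (B a)) :
    ((ν.restrict {ω | ∀ p ∈ θ.interior J, (ξ p ω).1 = q p}).prod (Measure.pi L)).map
        (fun x => θ.plug J t (fun p => (ξ p x.1).2) x.2) (Set.univ.pi B) =
      (∏ p ∈ θ.interior J, poissonMeasure t {q p}) * ∏ a, θ.pairLaw J t L a (B a) := by
  set T := {ω | ∀ p ∈ θ.interior J, (ξ p ω).1 = q p} with hT
  have hTm : MeasurableSet T := measurableSet_offspring hξ θ J q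
  have hmeas : Measurable fun x : Ω' × (PairEdge (n + 1) → PointConfig) =>
      θ.plug J t (fun p => (ξ p x.1).2) x.2 :=
    (measurable_plug J θ t).comp ((measurable_pi_lambda _ fun p =>
      measurable_snd.comp ((hξ p).comp measurable_fst)).prodMk measurable_snd)
  rw [Measure.map_apply hmeas (MeasurableSet.univ_pi hB)]
  let D : Word m → Set ℝ := fun p =>
    {s | ∀ a : PairEdge (n + 1), a.1 = s(θ.pos p.parent, θ.pos p) →
      PointConfig.single ((t : ℝ) * s) ∈ B a}
  have hD : ∀ p, MeasurableSet (D p) := by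
    intro p
    have : D p = ⋂ a : PairEdge (n + 1), ⋂ _ : a.1 = s(θ.pos p.parent, θ.pos p),
        (fun s : ℝ => PointConfig.single ((t : ℝ) * s)) ⁻¹' B a := by ext; simp [D]
    rw [this]
    exact MeasurableSet.iInter fun a => MeasurableSet.iInter fun _ => measurable_single_mul t (hB a)
  let B' : PairEdge (n + 1) → Set PointConfig := fun a =>
    if θ.IsEdge a then Set.univ else if θ.Touches J a then {_c | PointConfig.none ∈ B a} else B a
  have hpre : (fun x : Ω' × (PairEdge (n + 1) → PointConfig) =>
      θ.plug J t (fun p => (ξ p x.1).2) x.2) ⁻¹' Set.univ.pi B =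
      {ω | ∀ p ∈ θ.nonroots, (ξ p ω).2 ∈ D p} ×ˢ Set.univ.pi B' := by
    ext ⟨ω, Q⟩
    simp only [Set.mem_preimage, Set.mem_univ_pi, Set.mem_prod, Set.mem_ofPred_eq]
    constructor
    · intro hx
      refine ⟨fun p hp a ha => ?_, fun a => ?_⟩
      · have := hx a
        rwa [h.plug_edge hp ha] at this
      · have := hx a
        simp only [B']
        split_ifs with he ht
        · trivial
        · rwa [plug_touches he ht] at this
        · rwa [plug_rest he ht] at this
    · rintro ⟨h1, h2⟩ a
      have h2a := h2 a
      simp only [B'] at h2a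
      by_cases he : θ.IsEdge a
      · obtain ⟨p, hp, ha⟩ := he
        rw [h.plug_edge hp ha]
        exact h1 p hp a ha
      · rw [if_neg he] at h2a
        by_cases ht : θ.Touches J a
        · rw [if_pos ht] at h2a
          rw [plug_touches he ht]; exact h2a
        · rw [if_neg ht] at h2a
          rw [plug_rest he ht]; exact h2a
  have hDm : MeasurableSet {ω | ∀ p ∈ θ.nonroots, (ξ p ω).2 ∈ D p} := by
    have : {ω | ∀ p ∈ θ.nonroots, (ξ p ω).2 ∈ D p} =
        ⋂ p ∈ θ.nonroots, {ω | (ξ p ω).2 ∈ D p} := by ext; simp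
    rw [this]
    exact Finset.measurableSet_biInter _ fun p _ => (measurable_snd.comp (hξ p)) (hD p)
  rw [hpre, Measure.prod_prod, Measure.restrict_apply hDm, Measure.pi_pi]
  let C : Word m → Set ℕ := fun p => if p.2.length < J then {q p} else Set.univ
  let D' : Word m → Set ℝ := fun p => if p.2 ≠ [] then D p else Set.univ
  have hev : {ω | ∀ p ∈ θ.nonroots, (ξ p ω).2 ∈ D p} ∩ T =
      ⋂ p ∈ θ.1, ξ p ⁻¹' (C p ×ˢ D' p) := by
    ext ω
    simp only [Set.mem_inter_iff, Set.mem_ofPred_eq, Set.mem_iInter, Set.mem_preimage, Set.mem_prod,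
      hT, nonroots, interior, Finset.mem_filter, C, D']
    constructor
    · rintro ⟨h1, h2⟩ p hp
      constructor
      · split_ifs with hl
        · exact h2 p ⟨hp, hl⟩
        · trivial
      · split_ifs with hl
        · exact h1 p ⟨hp, hl⟩
        · trivial
    · intro h1
      refine ⟨fun p hp => ?_, fun p hp => ?_⟩
      · have := (h1 p hp.1).2
        rwa [if_pos hp.2] at this
      · have := (h1 p hp.1).1
        rwa [if_pos hp.2] at this
  have hD' : ∀ p, MeasurableSet (D' p) := by
    intro p
    simp only [D']
    split_ifs
    exacts [hD p, MeasurableSet.univ]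
  rw [hev, measure_mark_rect hξ hlaw hind θ.1 C D' hD', mul_assoc]
  congr 1
  · rw [interior, Finset.prod_filter]
    refine Finset.prod_congr rfl fun p _ => ?_
    simp only [C]
    split_ifs
    exacts [rfl, measure_univ]
  · have h1 : ∏ p ∈ θ.1, (volume.restrict (Set.Icc (0 : ℝ) 1)) (D' p) =
        ∏ p ∈ θ.nonroots, (volume.restrict (Set.Icc (0 : ℝ) 1)) (D p) := by
      rw [nonroots, Finset.prod_filter]
      refine Finset.prod_congr rfl fun p _ => ?_
      simp only [D']
      split_ifs
      exacts [rfl, measure_univ]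
    have hedge : ∀ a, (he : θ.IsEdge a) → D he.choose =
        (fun s : ℝ => PointConfig.single ((t : ℝ) * s)) ⁻¹' B a := by
      intro a he
      ext s
      refine ⟨fun hs => hs a he.choose_spec.2, fun hs b hb => ?_⟩
      obtain rfl : b = a := Subtype.ext (hb.trans he.choose_spec.2.symm)
      exact hs
    have h2 : ∏ p ∈ θ.nonroots, (volume.restrict (Set.Icc (0 : ℝ) 1)) (D p) =
        ∏ a : PairEdge (n + 1) with θ.IsEdge a, θ.pairLaw J t L a (B a) := by
      symm
      refine Finset.prod_bij (fun a ha => (Finset.mem_filter.1 ha).2.choose)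
        (fun a ha => (Finset.mem_filter.1 ha).2.choose_spec.1) ?_ ?_ ?_
      · intro a ha b hb hab
        have h3 := (Finset.mem_filter.1 ha).2.choose_spec.2
        have h4 := (Finset.mem_filter.1 hb).2.choose_spec.2
        have hab' : (Finset.mem_filter.1 ha).2.choose = (Finset.mem_filter.1 hb).2.choose := hab
        rw [hab'] at h3
        exact Subtype.ext (h3.trans h4.symm)
      · intro p hp
        have he : θ.IsEdge ⟨s(θ.pos p.parent, θ.pos p), by
            rw [Sym2.mk_isDiag_iff]; exact h.pos_parent_ne hp⟩ := ⟨p, hp, rfl⟩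
        refine ⟨_, Finset.mem_filter.2 ⟨Finset.mem_univ _, he⟩, ?_⟩
        exact h.eq_of_edge he.choose_spec.1 hp he.choose_spec.2.symm
      · intro a ha
        have he := (Finset.mem_filter.1 ha).2
        rw [hedge a he, pairLaw, if_pos he, Measure.map_apply (measurable_single_mul t) (hB a)]
    rw [h1, h2, Finset.prod_filter, ← Finset.prod_mul_distrib]
    refine Finset.prod_congr rfl fun a _ => ?_
    simp only [B']
    by_cases he : θ.IsEdge a
    · rw [if_pos he, if_pos he, measure_univ, mul_one]
    · rw [if_neg he, if_neg he, one_mul, pairLaw, if_neg he]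
      by_cases ht : θ.Touches J a
      · rw [if_pos ht, if_pos ht, Measure.dirac_apply' _ (hB a)]
        by_cases hn : PointConfig.none ∈ B a <;> simp [hn]
      · rw [if_neg ht, if_neg ht]

open Classical in
theorem Good.map_plug (h : θ.Good J c) [∀ a, IsProbabilityMeasure (L a)]
    (hξ : ∀ p, Measurable (ξ p))
    (hlaw : ∀ p, ν.map (ξ p) = (poissonMeasure t).prod (volume.restrict (Set.Icc (0 : ℝ) 1)))
    (hind : iIndepFun ξ ν) (q : Word m → ℕ) :
    ((ν.restrict {ω | ∀ p ∈ θ.interior J, (ξ p ω).1 = q p}).prod (Measure.pi L)).map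
        (fun x => θ.plug J t (fun p => (ξ p x.1).2) x.2) =
      (∏ p ∈ θ.interior J, poissonMeasure t {q p}) • Measure.pi (θ.pairLaw J t L) := by
  set Z := ∏ p ∈ θ.interior J, poissonMeasure t {q p} with hZ
  have happ := fun (B : PairEdge (n + 1) → Set PointConfig) (hB : ∀ a, MeasurableSet (B a)) =>
    h.map_plug_apply (L := L) hξ hlaw hind q hB
  set M := ((ν.restrict {ω | ∀ p ∈ θ.interior J, (ξ p ω).1 = q p}).prod (Measure.pi L)).map
        (fun x => θ.plug J t (fun p => (ξ p x.1).2) x.2)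
  have hZtop : Z ≠ ∞ := ENNReal.prod_ne_top fun p _ => measure_ne_top _ _
  -- Product measures are characterised through probability laws, hence the normalisation by `Z`.
  -- When `Z = 0` both sides vanish.
  by_cases hZ0 : Z = 0
  · rw [hZ0, zero_smul, ← Measure.measure_univ_eq_zero]
    have := happ (fun _ => Set.univ) fun _ => MeasurableSet.univ
    rwa [Set.pi_univ, ← hZ, hZ0, zero_mul] at this
  · have : Measure.pi (θ.pairLaw J t L) = Z⁻¹ • M := by
      refine Measure.pi_eq fun B hB => ?_
      rw [Measure.smul_apply, smul_eq_mul, happ B hB, ← hZ, ← mul_assoc,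
        ENNReal.inv_mul_cancel hZ0 hZtop, one_mul]
    rw [this, smul_smul, ENNReal.mul_inv_cancel hZ0 hZtop, one_smul]

end Placement

theorem poissonMeasure_singleton_eq (t : ℝ≥0) (j : ℕ) :
    poissonMeasure t {j} =
      ENNReal.ofReal (Real.exp (-t)) * (t : ℝ≥0∞) ^ j * ((j.factorial : ℝ≥0∞))⁻¹ := by
  rw [poissonMeasure_singleton, ENNReal.ofReal_div_of_pos (by positivity),
    ENNReal.ofReal_mul (Real.exp_pos _).le, ENNReal.ofReal_pow t.coe_nonneg, ENNReal.ofReal_natCast,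
    div_eq_mul_inv]
  rw [ENNReal.ofReal_coe_nnreal]

namespace Placement

variable {m n : ℕ} {J : ℕ} {θ : Placement m n} {c : Word m → ℕ}

open Classical in
theorem Good.card_nonroots (h : θ.Good J θ.offspring) :
    θ.nonroots.card = ∑ p ∈ θ.interior J, θ.offspring p := by
  rw [Finset.card_eq_sum_card_fiberwise (f := Word.parent) (t := θ.interior J)
    fun p hp => h.parent_mem hp]
  refine Finset.sum_congr rfl fun p hp => ?_
  have : θ.nonroots.filter (fun q => q.parent = p) =
      (Finset.range (θ.offspring p)).image p.child := by
    ext q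
    simp only [Finset.mem_filter, Finset.mem_image, Finset.mem_range]
    constructor
    · rintro ⟨hq, rfl⟩
      obtain ⟨i, hi⟩ := Word.exists_eq_child (Finset.mem_filter.1 hq).2
      rw [hi, h.child_mem_nonroots] at hq
      exact ⟨i, hq.2, hi.symm⟩
    · rintro ⟨i, hi, rfl⟩
      exact ⟨h.child_mem_nonroots.2 ⟨hp, hi⟩, rfl⟩
  rw [this, Finset.card_image_of_injective _ (Word.child_injective p), Finset.card_range]

theorem Good.card_eq (h : θ.Good J c) : θ.1.card = m + θ.nonroots.card := by
  have h1 : θ.1.filter (fun p => ¬ p.2 ≠ []) = Finset.univ.image fun i : Fin m => ((i, []) : Word m) := by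
    ext ⟨a, u⟩
    simp only [Finset.mem_filter, Finset.mem_image, Finset.mem_univ, true_and, not_not]
    constructor
    · rintro ⟨-, rfl⟩
      exact ⟨a, rfl⟩
    · rintro ⟨i, hi⟩
      obtain ⟨rfl, rfl⟩ := Prod.mk.inj hi
      exact ⟨by rw [h.verts]; exact root_mem_forestVerts _ _ _, rfl⟩
  have h2 := Finset.card_filter_add_card_filter_not (s := θ.1) fun p : Word m => p.2 ≠ []
  rw [h1, Finset.card_image_of_injective _ fun i j hij => (Prod.mk.inj hij).1,
    Finset.card_univ, Fintype.card_fin] at h2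
  rw [nonroots]
  omega

open Classical in
theorem Good.card_isEdge (h : θ.Good J c) :
    (Finset.univ.filter fun a => θ.IsEdge a).card = θ.nonroots.card := by
  refine Finset.card_bij (fun a ha => (Finset.mem_filter.1 ha).2.choose)
    (fun a ha => (Finset.mem_filter.1 ha).2.choose_spec.1) ?_ ?_
  · intro a ha b hb hab
    have h3 := (Finset.mem_filter.1 ha).2.choose_spec.2
    have h4 := (Finset.mem_filter.1 hb).2.choose_spec.2
    have hab' : (Finset.mem_filter.1 ha).2.choose = (Finset.mem_filter.1 hb).2.choose := hab
    rw [hab'] at h3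
    exact Subtype.ext (h3.trans h4.symm)
  · intro p hp
    have he : θ.IsEdge ⟨s(θ.pos p.parent, θ.pos p), by
        rw [Sym2.mk_isDiag_iff]; exact h.pos_parent_ne hp⟩ := ⟨p, hp, rfl⟩
    exact ⟨_, Finset.mem_filter.2 ⟨Finset.mem_univ _, he⟩,
      h.eq_of_edge he.choose_spec.1 hp he.choose_spec.2.symm⟩

open Classical in
theorem card_touches_le (J : ℕ) (θ : Placement m n) :
    (Finset.univ.filter fun a => θ.Touches J a).card ≤ (θ.interior J).card * (n + 1) := by
  have h1 : (Finset.univ.filter fun a => θ.Touches J a).image Subtype.val ⊆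
      (θ.interior J ×ˢ Finset.univ).image fun x : Word m × Fin (n + 1) => s(θ.pos x.1, x.2) := by
    intro e he
    obtain ⟨a, ha, rfl⟩ := Finset.mem_image.1 he
    obtain ⟨p, hp, hpa⟩ := (Finset.mem_filter.1 ha).2
    obtain ⟨y, hy⟩ := hpa
    exact Finset.mem_image.2 ⟨(p, y), Finset.mem_product.2 ⟨hp, Finset.mem_univ _⟩, hy.symm⟩
  rw [← Finset.card_image_of_injective _ Subtype.val_injective]
  refine (Finset.card_le_card h1).trans (Finset.card_image_le.trans ?_)
  rw [Finset.card_product, Finset.card_univ, Fintype.card_fin]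

theorem Good.touches_of_isEdge (h : θ.Good J c) {a : PairEdge (n + 1)} (ha : θ.IsEdge a) :
    θ.Touches J a := by
  obtain ⟨p, hp, ha⟩ := ha
  exact ⟨p.parent, h.parent_mem hp, by rw [ha]; exact Sym2.mem_mk_left _ _⟩

/-- Write `ρ = 1 / (n + 1)` and `ε = exp (-ρ t)`, so that `ε ^ (n + 1) = exp (-t)`. With `I`
interior words and `E` edges, the Poisson probabilities give `ε ^ (I (n + 1)) * t ^ E * weight`, and
the pair factors give `ε ^ (touched pairs) * (ρ t) ^ E`. Since there are `m + E` words, the powers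
of `ρ` match. The inequality comes from `ε ≤ 1` and from the at most `I (n + 1)` touched pairs. -/
theorem Good.weight_le (h : θ.Good J θ.offspring) (t : ℝ≥0) :
    ((n : ℝ≥0∞) + 1)⁻¹ ^ θ.1.card * ∏ p ∈ θ.interior J, poissonMeasure t {θ.offspring p} ≤
      ((n : ℝ≥0∞) + 1)⁻¹ ^ m * θ.weight J *
        ∏ a, θ.pairFactor J (1 / ((n : ℝ≥0) + 1)) t a := by
  classical
  set r : ℝ≥0 := 1 / ((n : ℝ≥0) + 1) with hr
  set ρ : ℝ≥0∞ := ((n : ℝ≥0∞) + 1)⁻¹ with hρ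
  have hrρ : (r : ℝ≥0∞) = ρ := by
    rw [hr, one_div, ENNReal.coe_inv (by positivity)]
    push_cast
    rfl
  set ε : ℝ≥0∞ := ENNReal.ofReal (Real.exp (-(r * t : ℝ≥0))) with hε
  have hε1 : ε ≤ 1 := by
    rw [hε, ← ENNReal.ofReal_one]
    refine ENNReal.ofReal_le_ofReal ?_
    rw [Real.exp_le_one_iff, neg_nonpos]
    exact NNReal.coe_nonneg _
  have hεN : ε ^ (n + 1) = ENNReal.ofReal (Real.exp (-t)) := by
    rw [hε, ← ENNReal.ofReal_pow (Real.exp_pos _).le, ← Real.exp_nat_mul]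
    congr 2
    rw [hr]
    push_cast
    field_simp
  have hZ : ∏ p ∈ θ.interior J, poissonMeasure t {θ.offspring p} =
      ε ^ ((θ.interior J).card * (n + 1)) * (t : ℝ≥0∞) ^ θ.nonroots.card * θ.weight J := by
    simp only [poissonMeasure_singleton_eq, Finset.prod_mul_distrib]
    rw [Finset.prod_const, Finset.prod_pow_eq_pow_sum, ← h.card_nonroots, weight, ← hεN, ← pow_mul,
      mul_comm (n + 1)]
  have hK : ∏ a, θ.pairFactor J r t a =
      ε ^ (Finset.univ.filter fun a => θ.Touches J a).card * (ρ * t) ^ θ.nonroots.card := by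
    have : ∀ a, θ.pairFactor J r t a =
        (if θ.Touches J a then ε else 1) * (if θ.IsEdge a then ρ * t else 1) := by
      intro a
      by_cases he : θ.IsEdge a
      · simp only [pairFactor, if_pos he, if_pos (h.touches_of_isEdge he), ENNReal.coe_mul, hrρ]
        rfl
      · simp only [pairFactor, if_neg he, mul_one]
        rfl
    simp only [this, Finset.prod_mul_distrib, Finset.prod_ite, Finset.prod_const, one_pow, mul_one]
    rw [h.card_isEdge, mul_pow]
  rw [hZ, hK, h.card_eq]
  calc ρ ^ (m + θ.nonroots.card) * (ε ^ ((θ.interior J).card * (n + 1)) *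
        (t : ℝ≥0∞) ^ θ.nonroots.card * θ.weight J)
      ≤ ρ ^ (m + θ.nonroots.card) * (ε ^ (Finset.univ.filter fun a => θ.Touches J a).card *
        (t : ℝ≥0∞) ^ θ.nonroots.card * θ.weight J) := by
        refine mul_le_mul' le_rfl (mul_le_mul' (mul_le_mul' ?_ le_rfl) le_rfl)
        exact pow_le_pow_right_of_le_one' hε1 (card_touches_le J θ)
    _ = _ := by ring

variable {t : ℝ≥0} {L : PairEdge (n + 1) → Measure PointConfig} {Ω' : Type*} [MeasurableSpace Ω']
  {ν : Measure Ω'} {ξ : Word m → Ω' → ℕ × ℝ}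

theorem Good.lintegral_plug_le (h : θ.Good J θ.offspring) [∀ a, IsProbabilityMeasure (L a)]
    (hL : ∀ a, IsTruncatedLaw (1 / ((n : ℝ≥0) + 1)) t (L a)) (hξ : ∀ p, Measurable (ξ p))
    (hlaw : ∀ p, ν.map (ξ p) = (poissonMeasure t).prod (volume.restrict (Set.Icc (0 : ℝ) 1)))
    (hind : iIndepFun ξ ν) {G : (PairEdge (n + 1) → PointConfig) → ℝ≥0∞} (hG : Measurable G) :
    ((n : ℝ≥0∞) + 1)⁻¹ ^ θ.1.card *
        ∫⁻ ω in {ω | ∀ p ∈ θ.interior J, (ξ p ω).1 = θ.offspring p},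
          ∫⁻ Q, G (θ.plug J t (fun p => (ξ p ω).2) Q) ∂(Measure.pi L) ∂ν ≤
      ((n : ℝ≥0∞) + 1)⁻¹ ^ m * θ.weight J * ∫⁻ Q in {Q | θ.Explored J Q}, G Q ∂(Measure.pi L) := by
  have hmeas : Measurable fun x : Ω' × (PairEdge (n + 1) → PointConfig) =>
      θ.plug J t (fun p => (ξ p x.1).2) x.2 :=
    (measurable_plug J θ t).comp ((measurable_pi_lambda _ fun p =>
      measurable_snd.comp ((hξ p).comp measurable_fst)).prodMk measurable_snd)
  have h1 : ∫⁻ ω in {ω | ∀ p ∈ θ.interior J, (ξ p ω).1 = θ.offspring p},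
      ∫⁻ Q, G (θ.plug J t (fun p => (ξ p ω).2) Q) ∂(Measure.pi L) ∂ν =
      (∏ p ∈ θ.interior J, poissonMeasure t {θ.offspring p}) *
        ∫⁻ Q, G Q ∂(Measure.pi (θ.pairLaw J t L)) := by
    have := lintegral_prod (μ := ν.restrict {ω | ∀ p ∈ θ.interior J, (ξ p ω).1 = θ.offspring p})
      (ν := Measure.pi L) (fun x => G (θ.plug J t (fun p => (ξ p x.1).2) x.2))
      (hG.comp hmeas).aemeasurable
    rw [← this, ← lintegral_map hG hmeas, h.map_plug hξ hlaw hind, lintegral_smul_measure,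
      smul_eq_mul]
  rw [h1, restrict_explored hL, lintegral_smul_measure, smul_eq_mul, ← mul_assoc, ← mul_assoc]
  gcongr ?_ * _
  exact h.weight_le t

end Placement

/-! ### Averages over the placements of a forest -/

section Mean

variable {m n : ℕ} {t : ℝ≥0} {L : PairEdge (n + 1) → Measure PointConfig}
  {G : (PairEdge (n + 1) → PointConfig) → (Fin m → Fin (n + 1)) → ℝ≥0∞}

/-- The places of the roots. -/
def Placement.roots (θ : Placement m n) (i : Fin m) : Fin (n + 1) := θ.pos (i, [])

open Classical in
/-- The mean of `G` over the independent uniform placements of the forest with marks `M`, truncated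
at height `J`, in a configuration with law `Measure.pi L`. Placements that are not injective do not
contribute. -/
noncomputable def exploredMean (J : ℕ) (t : ℝ≥0) (L : PairEdge (n + 1) → Measure PointConfig)
    (G : (PairEdge (n + 1) → PointConfig) → (Fin m → Fin (n + 1)) → ℝ≥0∞) (M : Word m → ℕ × ℝ) :
    ℝ≥0∞ :=
  ∑' θ : Placement m n,
    if θ.Good J θ.offspring ∧ ∀ p ∈ θ.interior J, (M p).1 = θ.offspring p then
      ((n : ℝ≥0∞) + 1)⁻¹ ^ θ.1.card *
        ∫⁻ Q, G (θ.plug J t (fun p => (M p).2) Q) θ.roots ∂(Measure.pi L)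
    else 0

variable {Ω' : Type*} [MeasurableSpace Ω'] {ν : Measure Ω'} {ξ : Word m → Ω' → ℕ × ℝ}

open Classical in
theorem measurable_exploredMean_term [∀ a, IsProbabilityMeasure (L a)] (hξ : ∀ p, Measurable (ξ p))
    (hG : ∀ x, Measurable fun Q => G Q x) (J : ℕ) (θ : Placement m n) :
    Measurable fun ω =>
      if θ.Good J θ.offspring ∧ ∀ p ∈ θ.interior J, (ξ p ω).1 = θ.offspring p then
        ((n : ℝ≥0∞) + 1)⁻¹ ^ θ.1.card *
          ∫⁻ Q, G (θ.plug J t (fun p => (ξ p ω).2) Q) θ.roots ∂(Measure.pi L)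
      else 0 := by
  have hmeas : Measurable fun x : Ω' × (PairEdge (n + 1) → PointConfig) =>
      θ.plug J t (fun p => (ξ p x.1).2) x.2 :=
    (Placement.measurable_plug J θ t).comp ((measurable_pi_lambda _ fun p =>
      measurable_snd.comp ((hξ p).comp measurable_fst)).prodMk measurable_snd)
  refine Measurable.ite ?_ (((hG θ.roots).comp hmeas).lintegral_prod_right'.const_mul _)
    measurable_const
  by_cases h : θ.Good J θ.offspring
  · simpa only [h, true_and] using Placement.measurableSet_offspring hξ θ J θ.offspring
  · simp only [h, false_and]
    exact MeasurableSet.const _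

theorem measurable_exploredMean [∀ a, IsProbabilityMeasure (L a)] (hξ : ∀ p, Measurable (ξ p))
    (hG : ∀ x, Measurable fun Q => G Q x) (J : ℕ) :
    Measurable fun ω => exploredMean J t L G fun p => ξ p ω :=
  Measurable.tsum fun θ => measurable_exploredMean_term hξ hG J θ

theorem measurableSet_explored (J : ℕ) (θ : Placement m n) :
    MeasurableSet {Q | θ.Explored J Q} := by
  have h : ∀ (a : PairEdge (n + 1)) (j : ℕ∞),
      MeasurableSet {Q : PairEdge (n + 1) → PointConfig | (Q a).count Set.univ = j} := fun a j =>
    ((PointConfig.measurable_count MeasurableSet.univ).comp (measurable_pi_apply a))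
      (show MeasurableSet {j} from MeasurableSet.of_discrete)
  have : {Q | θ.Explored J Q} = ⋂ a, ((⋂ _ : θ.IsEdge a, {Q | (Q a).count Set.univ = 1}) ∩
      ⋂ _ : ¬ θ.IsEdge a, ⋂ _ : θ.Touches J a, {Q | (Q a).count Set.univ = 0}) := by
    ext Q; simp [Placement.Explored]
  rw [this]
  exact MeasurableSet.iInter fun a => (MeasurableSet.iInter fun _ => h a 1).inter
    (MeasurableSet.iInter fun _ => MeasurableSet.iInter fun _ => h a 0)

/-- Summing the comparison of laws over all placements and exchanging sum and integral leaves, for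
each configuration and each choice of roots, the total weight of the explored forests. It is at most
one by `tsum_weight_le`. The bound is uniform in `J`. -/
theorem lintegral_exploredMean_le [∀ a, IsProbabilityMeasure (L a)]
    (hL : ∀ a, IsTruncatedLaw (1 / ((n : ℝ≥0) + 1)) t (L a)) (hξ : ∀ p, Measurable (ξ p))
    (hlaw : ∀ p, ν.map (ξ p) = (poissonMeasure t).prod (volume.restrict (Set.Icc (0 : ℝ) 1)))
    (hind : iIndepFun ξ ν) (hG : ∀ x, Measurable fun Q => G Q x) (J : ℕ) :
    ∫⁻ ω, exploredMean J t L G (fun p => ξ p ω) ∂ν ≤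
      ((n : ℝ≥0∞) + 1)⁻¹ ^ m * ∑ x, ∫⁻ Q, G Q x ∂(Measure.pi L) := by
  classical
  have hterm : ∀ θ : Placement m n, ∫⁻ ω,
      (if θ.Good J θ.offspring ∧ ∀ p ∈ θ.interior J, (ξ p ω).1 = θ.offspring p then
        ((n : ℝ≥0∞) + 1)⁻¹ ^ θ.1.card *
          ∫⁻ Q, G (θ.plug J t (fun p => (ξ p ω).2) Q) θ.roots ∂(Measure.pi L)
      else 0) ∂ν ≤ ((n : ℝ≥0∞) + 1)⁻¹ ^ m * ∫⁻ Q, ∑ x, (if θ.Good J θ.offspring ∧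
        (∀ i, θ.pos (i, []) = x i) ∧ θ.Explored J Q then θ.weight J else 0) * G Q x
          ∂(Measure.pi L) := by
    intro θ
    by_cases h : θ.Good J θ.offspring
    · have h1 := h.lintegral_plug_le hL hξ hlaw hind (hG θ.roots)
      have hT := Placement.measurableSet_offspring hξ θ J θ.offspring
      have hmeas : Measurable fun x : Ω' × (PairEdge (n + 1) → PointConfig) =>
          θ.plug J t (fun p => (ξ p x.1).2) x.2 :=
        (Placement.measurable_plug J θ t).comp ((measurable_pi_lambda _ fun p =>
          measurable_snd.comp ((hξ p).comp measurable_fst)).prodMk measurable_snd)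
      calc _ = ((n : ℝ≥0∞) + 1)⁻¹ ^ θ.1.card *
            ∫⁻ ω in {ω | ∀ p ∈ θ.interior J, (ξ p ω).1 = θ.offspring p},
              ∫⁻ Q, G (θ.plug J t (fun p => (ξ p ω).2) Q) θ.roots ∂(Measure.pi L) ∂ν := by
            have hin : Measurable fun ω =>
                ∫⁻ Q, G (θ.plug J t (fun p => (ξ p ω).2) Q) θ.roots ∂(Measure.pi L) :=
              ((hG θ.roots).comp hmeas).lintegral_prod_right'
            rw [← lintegral_const_mul _ hin, ← lintegral_indicator hT]
            refine lintegral_congr fun ω => ?_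
            simp only [h, true_and, Set.indicator_apply, Set.mem_ofPred_eq]
        _ ≤ _ := h1
        _ = ((n : ℝ≥0∞) + 1)⁻¹ ^ m * ∫⁻ Q in {Q | θ.Explored J Q}, θ.weight J * G Q θ.roots
              ∂(Measure.pi L) := by
            rw [lintegral_const_mul _ (hG θ.roots), mul_assoc]
        _ ≤ _ := by
            refine mul_le_mul' le_rfl ?_
            rw [← lintegral_indicator (measurableSet_explored J θ)]
            refine lintegral_mono fun Q => ?_
            rw [Set.indicator_apply]
            split_ifs with hQ
            · refine le_trans (le_of_eq ?_) (Finset.single_le_sum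
                (f := fun x => (if θ.Good J θ.offspring ∧
                  (∀ i, θ.pos (i, []) = x i) ∧ θ.Explored J Q then θ.weight J else 0) * G Q x)
                (fun _ _ => zero_le) (Finset.mem_univ θ.roots))
              rw [if_pos ⟨h, fun _ => rfl, hQ⟩]
            · exact zero_le
    · simp [h]
  have hmeasQ : ∀ (θ : Placement m n) (x : Fin m → Fin (n + 1)), Measurable fun Q =>
      (if θ.Good J θ.offspring ∧ (∀ i, θ.pos (i, []) = x i) ∧ θ.Explored J Q
        then θ.weight J else 0) * G Q x := by
    intro θ x
    refine Measurable.mul (Measurable.ite ?_ measurable_const measurable_const) (hG x)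
    exact (MeasurableSet.const _).inter ((MeasurableSet.const _).inter (measurableSet_explored J θ))
  calc ∫⁻ ω, exploredMean J t L G (fun p => ξ p ω) ∂ν
      = _ := lintegral_tsum fun θ => (measurable_exploredMean_term hξ hG J θ).aemeasurable
    _ ≤ _ := ENNReal.tsum_le_tsum hterm
    _ = ((n : ℝ≥0∞) + 1)⁻¹ ^ m * ∫⁻ Q, ∑' θ : Placement m n, ∑ x, (if θ.Good J θ.offspring ∧
        (∀ i, θ.pos (i, []) = x i) ∧ θ.Explored J Q then θ.weight J else 0) * G Q x
          ∂(Measure.pi L) := by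
        rw [ENNReal.tsum_mul_left, lintegral_tsum fun θ =>
          (Finset.measurable_fun_sum _ fun x _ => hmeasQ θ x).aemeasurable]
    _ ≤ ((n : ℝ≥0∞) + 1)⁻¹ ^ m * ∫⁻ Q, ∑ x, G Q x ∂(Measure.pi L) := by
        refine mul_le_mul' le_rfl (lintegral_mono fun Q => ?_)
        rw [Summable.tsum_finsetSum fun _ _ => ENNReal.summable]
        refine Finset.sum_le_sum fun x _ => ?_
        rw [ENNReal.tsum_mul_right]
        exact (mul_le_mul' (Placement.tsum_weight_le J Q x) le_rfl).trans_eq (one_mul _)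
    _ = _ := by rw [lintegral_finsetSum _ fun x _ => hG x]

end Mean

/-! ### The true random configuration as a product law with uniform roots -/

section Law

variable {Ω : Type*} [MeasurableSpace Ω] {μ : Measure Ω} [IsProbabilityMeasure μ] {m n : ℕ}
  {P : PairEdge (n + 1) → Ω → PointConfig} {v : Fin m → Ω → Fin (n + 1)}

theorem map_trunc_eq_pi {t : ℝ} (hP : ∀ a, Measurable (P a)) (hPi : iIndepFun P μ) :
    μ.map (fun ω a => (P a ω).trunc t) = Measure.pi fun a => μ.map fun ω => (P a ω).trunc t :=
  (iIndepFun_iff_map_fun_eq_pi_map fun a =>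
      ((PointConfig.measurable_trunc t).comp (hP a)).aemeasurable).1
    (hPi.comp (fun _ => PointConfig.trunc t) fun _ => PointConfig.measurable_trunc t)

theorem lintegral_configuration {t : ℝ} (hP : ∀ a, Measurable (P a)) (hPi : iIndepFun P μ)
    (hv : ∀ i, Measurable (v i)) (hvu : ∀ i x, μ {ω | v i ω = x} = 1 / ((n : ℝ≥0∞) + 1))
    (hvi : iIndepFun v μ) (hPv : IndepFun (fun ω a => P a ω) (fun ω i => v i ω) μ)
    {G : (PairEdge (n + 1) → PointConfig) → (Fin m → Fin (n + 1)) → ℝ≥0∞}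
    (hG : ∀ x, Measurable fun Q => G Q x) :
    ∫⁻ ω, G (fun a => (P a ω).trunc t) (fun i => v i ω) ∂μ =
      ((n : ℝ≥0∞) + 1)⁻¹ ^ m *
        ∑ x, ∫⁻ Q, G Q x ∂(Measure.pi fun a => μ.map fun ω => (P a ω).trunc t) := by
  have hPt : ∀ a, Measurable fun ω => (P a ω).trunc t := fun a =>
    (PointConfig.measurable_trunc t).comp (hP a)
  have htr : Measurable fun (Q : PairEdge (n + 1) → PointConfig) a => (Q a).trunc t :=
    measurable_pi_lambda _ fun a => (PointConfig.measurable_trunc t).comp (measurable_pi_apply a)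
  have hind : IndepFun (fun ω a => (P a ω).trunc t) (fun ω i => v i ω) μ :=
    hPv.comp htr measurable_id
  have hX : Measurable fun ω a => (P a ω).trunc t := measurable_pi_lambda _ hPt
  have hV : Measurable fun ω i => v i ω := measurable_pi_lambda _ hv
  have hG' : Measurable fun x : (PairEdge (n + 1) → PointConfig) × (Fin m → Fin (n + 1)) =>
      G x.1 x.2 := measurable_from_prod_countable_left hG
  have hvx : ∀ x : Fin m → Fin (n + 1), μ.map (fun ω i => v i ω) {x} = ((n : ℝ≥0∞) + 1)⁻¹ ^ m := by
    intro x
    rw [(iIndepFun_iff_map_fun_eq_pi_map fun i => (hv i).aemeasurable).1 hvi,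
      ← Set.univ_pi_singleton, Measure.pi_pi]
    have : ∀ i, μ.map (v i) {x i} = ((n : ℝ≥0∞) + 1)⁻¹ := by
      intro i
      rw [Measure.map_apply (hv i) (measurableSet_singleton _), ← one_div]
      exact hvu i (x i)
    have hpi : ∀ i, IsProbabilityMeasure (μ.map (v i)) := fun i =>
      Measure.isProbabilityMeasure_map (hv i).aemeasurable
    simp only [this, Finset.prod_const, Finset.card_univ, Fintype.card_fin]
  have hprob : IsProbabilityMeasure (μ.map fun ω i => v i ω) :=
    Measure.isProbabilityMeasure_map hV.aemeasurable
  have hprob' : IsProbabilityMeasure (μ.map fun ω a => (P a ω).trunc t) :=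
    Measure.isProbabilityMeasure_map hX.aemeasurable
  calc ∫⁻ ω, G (fun a => (P a ω).trunc t) (fun i => v i ω) ∂μ
      = ∫⁻ x, G x.1 x.2 ∂(μ.map fun ω => ((fun a => (P a ω).trunc t), fun i => v i ω)) :=
        (lintegral_map hG' (hX.prodMk hV)).symm
    _ = ∫⁻ x, ∫⁻ Q, G Q x ∂(μ.map fun ω a => (P a ω).trunc t) ∂(μ.map fun ω i => v i ω) := by
        rw [(indepFun_iff_map_prod_eq_prod_map_map hX.aemeasurable hV.aemeasurable).1 hind,
          lintegral_prod_symm _ hG'.aemeasurable]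
    _ = _ := by
        rw [lintegral_fintype, map_trunc_eq_pi hP hPi, Finset.mul_sum]
        refine Finset.sum_congr rfl fun x _ => ?_
        rw [hvx, mul_comm]

end Law

/-! ### The graph of a configuration in which a forest is plugged -/

namespace Placement

variable {m n : ℕ} {J : ℕ} {θ : Placement m n} {c : Word m → ℕ} {t : ℝ≥0} {M : Word m → ℕ × ℝ}
  {Q : PairEdge (n + 1) → PointConfig}

/-- The labels at a pair where a forest is plugged. -/
theorem Good.mem_plug (h : θ.Good J c) {s : Word m → ℝ} {a : PairEdge (n + 1)} {x : ℝ}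
    (hx : x ∈ (θ.plug J t s Q a).1) :
    (∃ p ∈ θ.nonroots, a.1 = s(θ.pos p.parent, θ.pos p) ∧ x = t * s p) ∨
      (¬ θ.Touches J a ∧ x ∈ (Q a).1) := by
  by_cases he : θ.IsEdge a
  · obtain ⟨p, hp, ha⟩ := he
    rw [h.plug_edge hp ha] at hx
    exact Or.inl ⟨p, hp, ha, hx.1⟩
  · by_cases ht : θ.Touches J a
    · rw [plug_touches he ht] at hx
      exact absurd hx (Set.notMem_empty x)
    · rw [plug_rest he ht] at hx
      exact Or.inr ⟨ht, hx⟩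

theorem Good.distinctLabels_plug (h : θ.Good J c) {s : Word m → ℝ}
    (hs : ∀ p ∈ θ.nonroots, ∀ q ∈ θ.nonroots, (t : ℝ) * s p = t * s q → p = q)
    (hQ : (erGraph t Q).DistinctLabels) (hsQ : ∀ p a, (t : ℝ) * s p ∉ (Q a).1) :
    (erGraph t (θ.plug J t s Q)).DistinctLabels := by
  rintro ⟨e, x⟩ ⟨a, hea, hxa, hxt⟩ ⟨f, y⟩ ⟨b, hfb, hyb, hyt⟩ hxy
  change e = a.1 at hea
  change f = b.1 at hfb
  change x = y at hxy
  subst hxy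
  rcases h.mem_plug hxa with ⟨p, hp, hap, hx⟩ | ⟨-, hx⟩ <;>
    rcases h.mem_plug hyb with ⟨q, hq, hbq, hy⟩ | ⟨-, hy⟩
  · obtain rfl := hs p hp q hq (hx.symm.trans hy)
    rw [hea, hfb, hap, hbq]
  · exact absurd (hx ▸ hy) (hsQ p b)
  · exact absurd (hy ▸ hx) (hsQ q a)
  · exact hQ (e, x) ⟨a, hea, hx, hxt⟩ (f, x) ⟨b, hfb, hy, hyt⟩ rfl

/-- Plugging removes every point at the places of height less than `J` other than the labels of the
forest, which gives the interior condition. Marks in `[0, 1]` ensure that these labels are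
nonnegative and appear before time `t`. -/
theorem Good.levelEmbeds_plug (h : θ.Good J fun p => (M p).1)
    (hU : ∀ p, (M p).2 ∈ Set.Icc (0 : ℝ) 1)
    (hd : (erGraph t (θ.plug J t (fun p => (M p).2) Q)).DistinctLabels) (i : Fin m) :
    LGraph.LevelEmbeds (pgwTree t fun u => M (i, u)) List.length J
      (erGraph t (θ.plug J t (fun p => (M p).2) Q)) fun u => θ.pos (i, u) := by
  have hmem : ∀ u, u ∈ (pgwTree t fun u => M (i, u)).verts → u.length ≤ J →
      ((i, u) : Word m) ∈ θ.1 := by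
    intro u hu hl
    rw [h.verts]
    exact mem_forestVerts.2 ⟨hu, hl⟩
  have hedge : ∀ u, u ≠ [] → LEdge.map (fun u => θ.pos (i, u)) (wordEnds u, t * (M (i, u)).2) =
      (s(θ.pos (Word.parent (i, u)), θ.pos (i, u)), t * (M (i, u)).2) := fun u _ => rfl
  refine ⟨⟨Set.toFinite _, erGraph_edges_finite _ _⟩, hd, ?_, pgwTree_adj_length, ?_, ?_⟩
  · rintro u ⟨hu, hul⟩ w ⟨hw, hwl⟩ huw
    exact (Prod.mk.inj (h.inj (hmem u hu hul) (hmem w hw hwl) huw)).2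
  · rintro g hg w hw hwl
    obtain ⟨u, hu0, hu, rfl⟩ := pgwTree_mem_edges'.1 hg
    have hul : u.length ≤ J := by
      obtain ⟨j, u, rfl⟩ := List.exists_cons_of_ne_nil hu0
      rcases Sym2.mem_iff.1 hw with rfl | rfl
      · exact hwl
      · exact hwl.le
    have hp : ((i, u) : Word m) ∈ θ.nonroots := Finset.mem_filter.2 ⟨hmem u hu hul, hu0⟩
    rw [hedge u hu0]
    refine ⟨⟨s(θ.pos (Word.parent (i, u)), θ.pos (i, u)), ?_⟩, rfl, ?_, ?_⟩
    · rw [Sym2.mk_isDiag_iff]; exact h.pos_parent_ne hp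
    · rw [h.plug_edge hp rfl]
      exact ⟨rfl, mul_nonneg t.2 (hU _).1⟩
    · exact mul_le_of_le_one_right t.2 (hU _).2
  · rintro w hw hwl ⟨e, x⟩ ⟨a, hea, hxa, hxt⟩ hwe
    change e = a.1 at hea
    change θ.pos (i, w) ∈ e at hwe
    have hwi : ((i, w) : Word m) ∈ θ.interior J :=
      Finset.mem_filter.2 ⟨hmem w hw hwl.le, hwl⟩
    rcases h.mem_plug hxa with ⟨⟨j, u⟩, hp, hap, hx⟩ | ⟨ht, -⟩
    · have hu0 : u ≠ [] := (Finset.mem_filter.1 hp).2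
      rw [hea, hap] at hwe
      have hwu : ((i, w) : Word m) = Word.parent (j, u) ∨ ((i, w) : Word m) = (j, u) := by
        rcases Sym2.mem_iff.1 hwe with h1 | h1
        · exact Or.inl (h.inj (interior_subset hwi) (interior_subset (h.parent_mem hp)) h1)
        · exact Or.inr (h.inj (interior_subset hwi) (nonroots_subset hp) h1)
      obtain rfl : i = j := by
        rcases hwu with h1 | h1
        · exact (Prod.mk.inj h1).1
        · exact (Prod.mk.inj h1).1
      have hu : u ∈ (pgwTree t fun u => M (i, u)).verts := by
        have := nonroots_subset hp
        rw [h.verts] at this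
        exact (mem_forestVerts.1 this).1
      refine ⟨(wordEnds u, t * (M (i, u)).2), pgwTree_mem_edges'.2 ⟨u, hu0, hu, rfl⟩, ?_, ?_⟩
      · rcases hwu with h1 | h1
        · rw [(Prod.mk.inj h1).2]; exact Sym2.mem_mk_left _ _
        · rw [(Prod.mk.inj h1).2]; exact Sym2.mem_mk_right _ _
      · change x = t * (M (i, u)).2 at hx
        rw [hedge u hu0, hea, hap, hx]
    · exact absurd ⟨(i, w), hwi, hea ▸ hwe⟩ ht

end Placement

/-! ### Lower bounds for the averages over placements -/

section LowerBound

variable {m n : ℕ} {J : ℕ} {t : ℝ≥0} {M : Word m → ℕ × ℝ} {L : PairEdge (n + 1) → Measure PointConfig}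
  {G : (PairEdge (n + 1) → PointConfig) → (Fin m → Fin (n + 1)) → ℝ≥0∞}

/-- Only the injective placements of the forest with these marks are kept. They are counted by the
descending factorial, and each has probability `(n + 1)⁻¹` to the number of words. -/
theorem le_exploredMean [∀ a, IsProbabilityMeasure (L a)] {b : ℝ≥0∞}
    (hb : ∀ θ : Placement m n, (θ.Good J fun p => (M p).1) →
      ∀ᵐ Q ∂(Measure.pi L), b ≤ G (θ.plug J t (fun p => (M p).2) Q) θ.roots) :
    ((n + 1).descFactorial (forestVerts (fun p => (M p).1) J).card : ℝ≥0∞) *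
        ((n : ℝ≥0∞) + 1)⁻¹ ^ (forestVerts (fun p => (M p).1) J).card * b ≤
      exploredMean J t L G M := by
  classical
  set V := forestVerts (fun p => (M p).1) J with hV
  let e : (V ↪ Fin (n + 1)) → Placement m n := fun f => ⟨V, f⟩
  have he : Function.Injective e := by
    intro f g hfg
    exact DFunLike.coe_injective (eq_of_heq (Sigma.mk.inj hfg).2)
  have hgood : ∀ f, (e f).Good J fun p => (M p).1 := by
    intro f
    refine ⟨rfl, fun p hp q hq hpq => ?_⟩
    have hp' : p ∈ (e f).1 := hp
    have hq' : q ∈ (e f).1 := hq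
    simp only [Placement.pos, dif_pos hp', dif_pos hq'] at hpq
    exact congrArg Subtype.val (f.injective hpq)
  rw [exploredMean]
  refine le_trans ?_ (ENNReal.tsum_comp_le_tsum_of_injective he _)
  have hterm : ∀ f : V ↪ Fin (n + 1), ((n : ℝ≥0∞) + 1)⁻¹ ^ V.card * b ≤
      if (e f).Good J (e f).offspring ∧ ∀ p ∈ (e f).interior J, (M p).1 = (e f).offspring p then
        ((n : ℝ≥0∞) + 1)⁻¹ ^ (e f).1.card *
          ∫⁻ Q, G ((e f).plug J t (fun p => (M p).2) Q) (e f).roots ∂(Measure.pi L)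
      else 0 := by
    intro f
    rw [if_pos ⟨(hgood f).good_offspring, fun p hp => ((hgood f).offspring_eq hp).symm⟩]
    refine mul_le_mul' le_rfl ?_
    calc b = ∫⁻ _Q, b ∂(Measure.pi L) := by rw [lintegral_const, measure_univ, mul_one]
      _ ≤ _ := lintegral_mono_ae (hb _ (hgood f))
  refine le_trans (le_of_eq ?_) (ENNReal.tsum_le_tsum hterm)
  rw [tsum_fintype, Finset.sum_const, Finset.card_univ, Fintype.card_embedding_eq,
    Fintype.card_fin, Fintype.card_coe, nsmul_eq_mul, mul_assoc]

theorem tendsto_descFactorial_mul_inv (j : ℕ) :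
    Tendsto (fun n : ℕ => ((n + 1).descFactorial j : ℝ≥0∞) * ((n : ℝ≥0∞) + 1)⁻¹ ^ j) atTop (𝓝 1) := by
  have h1 : Tendsto (fun n : ℕ => ((n + 1).descFactorial j : ℝ) / ((n + 1 : ℕ) : ℝ) ^ j) atTop (𝓝 1) := by
    have := (Asymptotics.isEquivalent_iff_tendsto_one ?_).1 (isEquivalent_descFactorial j)
    · exact this.comp (tendsto_add_atTop_nat 1)
    · filter_upwards [eventually_gt_atTop 0] with n hn
      positivity
  have h2 := ENNReal.tendsto_ofReal h1
  rw [ENNReal.ofReal_one] at h2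
  refine h2.congr fun n => ?_
  rw [ENNReal.ofReal_div_of_pos (by positivity), ENNReal.ofReal_natCast,
    ENNReal.ofReal_pow (by positivity), ENNReal.ofReal_natCast, div_eq_mul_inv, ENNReal.inv_pow]
  push_cast
  rfl

end LowerBound

/-! ### Lower bound for the limit inferior of the means, by Fatou's lemma -/

section Limit

variable {m : ℕ} {k : ℕ∞} {t : ℝ≥0}

theorem erGraph_trunc {n : ℕ} (t : ℝ) (P : PairEdge n → PointConfig) :
    erGraph t (fun a => (P a).trunc t) = erGraph t P := by
  have : (erGraph t fun a => (P a).trunc t).edges = (erGraph t P).edges := by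
    ext e
    exact exists_congr fun a => and_congr_right fun _ =>
      ⟨fun h => ⟨h.1.1, h.2⟩, fun h => ⟨⟨h.1, h.2⟩, h.2⟩⟩
  exact LGraph.mk.injEq .. |>.mpr ⟨rfl, this⟩

theorem rootedForbiddenGraph_trunc {n : ℕ} (t : ℝ) (P : PairEdge n → PointConfig)
    (v : Fin m → Fin n) :
    rootedForbiddenGraph k t (fun a => (P a).trunc t) v = rootedForbiddenGraph k t P v := by
  have : forbiddenGraph k t (fun a => (P a).trunc t) = forbiddenGraph k t P := by
    unfold forbiddenGraph
    rw [erGraph_trunc]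
  unfold rootedForbiddenGraph
  congr 1

/-- For almost all marks, the means over placements are asymptotically bounded from below by the
value at the limit forest. -/
theorem le_liminf_exploredMean {M : Word m → ℕ × ℝ} {L : ∀ n, PairEdge (n + 1) → Measure PointConfig}
    [∀ n a, IsProbabilityMeasure (L n a)]
    (hLd : ∀ n, ∀ᵐ Q ∂(Measure.pi (L n)), (erGraph t Q).DistinctLabels)
    (hLs : ∀ n s a, ∀ᵐ Q ∂(Measure.pi (L n)), s ∉ (Q a).1)
    (hU : ∀ p, (M p).2 ∈ Set.Icc (0 : ℝ) 1) (hM : ∀ p q, p ≠ q → (M p).2 ≠ (M q).2)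
    (hM0 : t = 0 → ∀ p, (M p).1 = 0) (hΩ : ∀ i, (pgwTree t fun u => M (i, u)).IsOmegaPlus k)
    {F : RGraph m → ℝ} (hF : RGraph.LocallyContinuous F) (C : ℝ) :
    ENNReal.ofReal (F (rootedForbiddenForest k t fun i u => M (i, u)) + C) ≤
      liminf (fun J => liminf (fun n => exploredMean J t (L n)
        (fun Q x => ENNReal.ofReal (F (regularRootedGraph k t (Q, x)) + C)) M) atTop) atTop := by
  set Y := rootedForbiddenForest k t fun i u => M (i, u) with hY
  refine ENNReal.le_of_forall_pos_le_add fun ε hε _ => ?_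
  obtain ⟨d, hd⟩ := hF.exists_jIso Y (ε := ε) (by exact_mod_cast hε)
  obtain ⟨J₀, hJ₀⟩ := exists_jIso_level hΩ d
  have hle : ENNReal.ofReal (F Y + C) ≤ ENNReal.ofReal (F Y + C - ε) + ε := by
    have := ENNReal.ofReal_add_le (p := F Y + C - ε) (q := ε)
    rwa [sub_add_cancel, ENNReal.ofReal_coe_nnreal] at this
  refine hle.trans (add_le_add ?_ le_rfl)
  refine le_liminf_of_le (by isBoundedDefault) ?_
  -- With the marks and `J` fixed, the truncated forest has a fixed number of words, so the
  -- proportion of injective placements tends to one with `n`.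
  filter_upwards [eventually_ge_atTop J₀] with J hJ
  have hn : ∀ n : ℕ, ((n + 1).descFactorial (forestVerts (fun p => (M p).1) J).card : ℝ≥0∞) *
      ((n : ℝ≥0∞) + 1)⁻¹ ^ (forestVerts (fun p => (M p).1) J).card * ENNReal.ofReal (F Y + C - ε) ≤
      exploredMean J t (L n)
        (fun Q x => ENNReal.ofReal (F (regularRootedGraph k t (Q, x)) + C)) M := by
    intro n
    refine le_exploredMean fun θ hθ => ?_
    have hs : ∀ᵐ Q ∂(Measure.pi (L n)), ∀ (p : Word m) (a : PairEdge (n + 1)),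
        (t : ℝ) * (M p).2 ∉ (Q a).1 := ae_all_iff.2 fun p => ae_all_iff.2 fun a => hLs n _ a
    filter_upwards [hs, hLd n] with Q hQs hQd
    have hdist : (erGraph t (θ.plug J t (fun p => (M p).2) Q)).DistinctLabels := by
      refine hθ.distinctLabels_plug (fun p hp q _ hpq => ?_) hQd hQs
      by_contra hne
      by_cases ht : t = 0
      · obtain ⟨i, hi⟩ := Word.exists_eq_child (Finset.mem_filter.1 hp).2
        rw [hi, hθ.child_mem_nonroots] at hp
        have := hp.2
        rw [hM0 ht] at this
        exact absurd this (Nat.not_lt_zero _)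
      · exact hM p q hne (mul_left_cancel₀ (NNReal.coe_ne_zero.2 ht) hpq)
    have hiso : RGraph.JIso d Y
        (rootedForbiddenGraph k t (θ.plug J t (fun p => (M p).2) Q) θ.roots) := by
      refine hJ₀ J hJ (n + 1) _ θ.roots θ.pos (hθ.levelEmbeds_plug hU hdist) ?_ fun i => rfl
      rintro p ⟨hp, hpl⟩ q ⟨hq, hql⟩ hpq
      refine hθ.inj ?_ ?_ hpq
      · change p ∈ θ.1
        rw [hθ.verts]; exact mem_forestVerts.2 ⟨hp, hpl⟩
      · change q ∈ θ.1
        rw [hθ.verts]; exact mem_forestVerts.2 ⟨hq, hql⟩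
    rw [regularRootedGraph_eq (x := (θ.plug J t (fun p => (M p).2) Q, θ.roots)) hdist]
    refine ENNReal.ofReal_le_ofReal ?_
    have := (abs_lt.1 (hd _ hiso)).1
    linarith
  have hlim : Tendsto (fun n : ℕ => ((n + 1).descFactorial
      (forestVerts (fun p => (M p).1) J).card : ℝ≥0∞) *
      ((n : ℝ≥0∞) + 1)⁻¹ ^ (forestVerts (fun p => (M p).1) J).card * ENNReal.ofReal (F Y + C - ε))
      atTop (𝓝 (1 * ENNReal.ofReal (F Y + C - ε))) :=
    ENNReal.Tendsto.mul_const (tendsto_descFactorial_mul_inv _) (Or.inl one_ne_zero)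
  rw [one_mul] at hlim
  rw [← hlim.liminf_eq]
  exact liminf_le_liminf (Eventually.of_forall hn)

variable {Ω : ℕ → Type*} [∀ n, MeasurableSpace (Ω n)]
    {μ : ∀ n, Measure (Ω n)} [∀ n, IsProbabilityMeasure (μ n)]
    {P : ∀ n, PairEdge (n + 1) → Ω n → PointConfig} {v : ∀ n, Fin m → Ω n → Fin (n + 1)}
    {Ω' : Type*} [MeasurableSpace Ω'] {ν : Measure Ω'} [IsProbabilityMeasure ν]
    {ξ : Word m → Ω' → ℕ × ℝ}

/-- Fatou's lemma is applied to the means over placements, first in `J` on the outside and then in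
`n`. Their integrals are bounded by the mean for the true graph, which no longer depends on `J`, so
no rate or interchange of limits is required. -/
theorem lintegral_forest_le_liminf
    (hP : ∀ (n : ℕ) (a : PairEdge (n + 1)),
      IsPoissonProcess (1 / ((n : ℝ≥0) + 1)) (P n a) (μ n))
    (hPi : ∀ n, iIndepFun (P n) (μ n)) (hv : ∀ n i, Measurable (v n i))
    (hvu : ∀ n i x, μ n {ω | v n i ω = x} = 1 / ((n : ℝ≥0∞) + 1))
    (hvi : ∀ n, iIndepFun (v n) (μ n))
    (hPv : ∀ n, IndepFun (fun ω a => P n a ω) (fun ω i => v n i ω) (μ n))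
    (hξ : ∀ p, Measurable (ξ p))
    (hlaw : ∀ p, ν.map (ξ p) = (poissonMeasure t).prod (volume.restrict (Set.Icc (0 : ℝ) 1)))
    (hind : iIndepFun ξ ν)
    (hΩ : ∀ᵐ ω ∂ν, ∀ i, (pgwTree t fun u => ξ (i, u) ω).IsOmegaPlus k)
    {F : RGraph m → ℝ} (hFm : Measurable F) (hF : RGraph.LocallyContinuous F) (C : ℝ) :
    ∫⁻ ω, ENNReal.ofReal (F (rootedForbiddenForest k t fun i u => ξ (i, u) ω) + C) ∂ν ≤
      liminf (fun n => ∫⁻ ω, ENNReal.ofReal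
        (F (rootedForbiddenGraph k t (fun a => P n a ω) fun i => v n i ω) + C) ∂(μ n)) atTop := by
  let L : ∀ n, PairEdge (n + 1) → Measure PointConfig := fun n a =>
    (μ n).map fun ω => (P n a ω).trunc t
  have hPt : ∀ n a, Measurable fun ω => (P n a ω).trunc t := fun n a =>
    (PointConfig.measurable_trunc t).comp (hP n a).measurable
  have hLp : ∀ n a, IsProbabilityMeasure (L n a) := fun n a =>
    Measure.isProbabilityMeasure_map (hPt n a).aemeasurable
  have hLpi : ∀ n, Measure.pi (L n) = (μ n).map fun ω a => (P n a ω).trunc t := fun n =>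
    (map_trunc_eq_pi (fun a => (hP n a).measurable) (hPi n)).symm
  have hPtm : ∀ n, Measurable fun ω a => (P n a ω).trunc t := fun n =>
    measurable_pi_lambda _ (hPt n)
  have hdist : ∀ n, ∀ᵐ ω ∂(μ n), (erGraph (t : ℝ) fun a => P n a ω).DistinctLabels := fun n =>
    ae_distinctLabels (hP n) (hPi n) t
  have hLd : ∀ n, ∀ᵐ Q ∂(Measure.pi (L n)), (erGraph t Q).DistinctLabels := by
    intro n
    rw [hLpi, ae_map_iff (hPtm n).aemeasurable measurableSet_distinctLabels]
    filter_upwards [hdist n] with ω hω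
    rwa [erGraph_trunc]
  have hLs : ∀ n s a, ∀ᵐ Q ∂(Measure.pi (L n)), s ∉ (Q a).1 := by
    intro n s a
    have hm : MeasurableSet {Q : PairEdge (n + 1) → PointConfig | s ∉ (Q a).1} := by
      have h0 : {Q : PairEdge (n + 1) → PointConfig | s ∉ (Q a).1} =
          {Q | (Q a).count {s} = 0} := by
        ext Q
        simp [PointConfig.count, Set.inter_singleton_eq_empty]
      rw [h0]
      exact ((PointConfig.measurable_count (measurableSet_singleton s)).comp
        (measurable_pi_apply a)) (show MeasurableSet {(0 : ℕ∞)} from MeasurableSet.of_discrete)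
    rw [hLpi, ae_map_iff (hPtm n).aemeasurable hm]
    filter_upwards [(hP n a).ae_not_mem s] with ω hω
    exact fun h => hω h.1
  have hU : ∀ᵐ ω ∂ν, ∀ p, (ξ p ω).2 ∈ Set.Icc (0 : ℝ) 1 := by
    refine ae_all_iff.2 fun p => ae_of_ae_map (p := fun x : ℕ × ℝ => x.2 ∈ Set.Icc (0 : ℝ) 1)
      (hξ p).aemeasurable ?_
    rw [hlaw p]
    exact Measure.quasiMeasurePreserving_snd.ae (ae_restrict_mem measurableSet_Icc)
  have hM : ∀ᵐ ω ∂ν, ∀ p q, p ≠ q → (ξ p ω).2 ≠ (ξ q ω).2 :=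
    ae_all_iff.2 fun p => ae_all_iff.2 fun q => by
      by_cases hpq : p = q
      · exact Eventually.of_forall fun ω h => absurd hpq h
      · filter_upwards [ae_label_ne hξ hlaw hind hpq] with ω hω _ using hω
  have hM0 : ∀ᵐ ω ∂ν, t = 0 → ∀ p, (ξ p ω).1 = 0 := by
    by_cases ht : t = 0
    · subst ht
      filter_upwards [ae_all_iff.2 fun p => ae_offspring_eq_zero hξ hlaw p] with ω hω _ using hω
    · exact Eventually.of_forall fun ω h => absurd h ht
  let G : ∀ n, (PairEdge (n + 1) → PointConfig) → (Fin m → Fin (n + 1)) → ℝ≥0∞ := fun n Q x =>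
    ENNReal.ofReal (F (regularRootedGraph k t (Q, x)) + C)
  have hG : ∀ n x, Measurable fun Q => G n Q x := fun n x =>
    ((hFm.comp (measurable_regularRootedGraph.comp
      (measurable_id.prodMk measurable_const))).add_const C).ennreal_ofReal
  have hmean : ∀ n J, ∫⁻ ω, exploredMean J t (L n) (G n) (fun p => ξ p ω) ∂ν ≤
      ∫⁻ ω, ENNReal.ofReal
        (F (rootedForbiddenGraph k t (fun a => P n a ω) fun i => v n i ω) + C) ∂(μ n) := by
    intro n J
    refine (lintegral_exploredMean_le (fun a => (hP n a).isTruncatedLaw t) hξ hlaw hind (hG n)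
      J).trans_eq ?_
    rw [← lintegral_configuration (fun a => (hP n a).measurable) (hPi n) (hv n) (hvu n) (hvi n)
      (hPv n) (hG n)]
    refine lintegral_congr_ae ?_
    filter_upwards [hdist n] with ω hω
    simp only [G]
    rw [regularRootedGraph_eq (by rwa [erGraph_trunc]), rootedForbiddenGraph_trunc]
  have hmm : ∀ n J, Measurable fun ω => exploredMean J t (L n) (G n) fun p => ξ p ω := fun n J =>
    measurable_exploredMean hξ (hG n) J
  calc ∫⁻ ω, ENNReal.ofReal (F (rootedForbiddenForest k t fun i u => ξ (i, u) ω) + C) ∂ν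
      ≤ ∫⁻ ω, liminf (fun J => liminf (fun n =>
          exploredMean J t (L n) (G n) fun p => ξ p ω) atTop) atTop ∂ν := by
        refine lintegral_mono_ae ?_
        filter_upwards [hU, hM, hM0, hΩ] with ω h1 h2 h3 h4
        exact le_liminf_exploredMean hLd hLs h1 h2 h3 h4 hF C
    _ ≤ liminf (fun J => ∫⁻ ω, liminf (fun n =>
          exploredMean J t (L n) (G n) fun p => ξ p ω) atTop ∂ν) atTop :=
        lintegral_liminf_le fun J => .liminf fun n => hmm n J
    _ ≤ liminf (fun _ : ℕ => liminf (fun n => ∫⁻ ω, ENNReal.ofReal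
        (F (rootedForbiddenGraph k t (fun a => P n a ω) fun i => v n i ω) + C) ∂(μ n)) atTop)
          atTop :=
        liminf_le_liminf (Eventually.of_forall fun J =>
          (lintegral_liminf_le fun n => hmm n J).trans
            (liminf_le_liminf (Eventually.of_forall fun n => hmean n J)))
    _ = _ := liminf_const _

theorem aemeasurable_rootedForbiddenGraph {n : ℕ} {Ω : Type*} [MeasurableSpace Ω] {μ : Measure Ω}
    [IsProbabilityMeasure μ] {r : ℝ≥0} {P : PairEdge n → Ω → PointConfig}
    {v : Fin m → Ω → Fin n} (hP : ∀ a, IsPoissonProcess r (P a) μ) (hPi : iIndepFun P μ)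
    (hv : ∀ i, Measurable (v i)) :
    AEMeasurable (fun ω => rootedForbiddenGraph k t (fun a => P a ω) fun i => v i ω) μ := by
  refine ⟨fun ω => regularRootedGraph k t ((fun a => P a ω), fun i => v i ω),
    measurable_regularRootedGraph.comp ((measurable_pi_lambda _ fun a => (hP a).measurable).prodMk
      (measurable_pi_lambda _ hv)), ?_⟩
  filter_upwards [ae_distinctLabels hP hPi t] with ω hω
  exact (regularRootedGraph_eq (x := ((fun a => P a ω), fun i => v i ω)) hω).symm

end Limit

/-! ### From one-sided bounds to convergence of the means -/

theorem lintegral_ofReal_add {X : Type*} [MeasurableSpace X] {κ : Measure X}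
    [IsProbabilityMeasure κ] {u : X → ℝ} (hu : Integrable u κ) {C : ℝ} (hC : ∀ x, -C ≤ u x) :
    ∫⁻ x, ENNReal.ofReal (u x + C) ∂κ = ENNReal.ofReal (∫ x, u x ∂κ + C) := by
  have hi : Integrable (fun x => u x + C) κ := hu.add (integrable_const C)
  rw [← ofReal_integral_eq_lintegral_ofReal hi
    (Eventually.of_forall fun x => by have := hC x; change 0 ≤ u x + C; linarith),
    integral_add hu (integrable_const _), integral_const]
  simp

/-- Strict positivity of `b + c` keeps the comparison through `ENNReal.ofReal` strict. It is ensured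
below by shifting with `C + 1` instead of `C`. -/
theorem eventually_sub_lt_of_le_liminf {a : ℕ → ℝ} {b c : ℝ} (hb : 0 < b + c)
    (h : ENNReal.ofReal (b + c) ≤ liminf (fun n => ENNReal.ofReal (a n + c)) atTop) {ε : ℝ}
    (hε : 0 < ε) : ∀ᶠ n in atTop, b - ε < a n := by
  have h1 : ENNReal.ofReal (b - ε + c) < ENNReal.ofReal (b + c) :=
    (ENNReal.ofReal_lt_ofReal_iff hb).2 (by linarith)
  filter_upwards [eventually_lt_of_lt_liminf (h1.trans_le h)] with n hn
  have := (ENNReal.ofReal_lt_ofReal_iff').1 hn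
  linarith [this.1]

/-- Lower bounds for the limits inferior of the means of the two functions `C ± f` give
convergence. -/
theorem tendsto_integral_of_le_liminf {Ω : ℕ → Type*} [∀ n, MeasurableSpace (Ω n)]
    {μ : ∀ n, Measure (Ω n)} [∀ n, IsProbabilityMeasure (μ n)] {Ω' : Type*} [MeasurableSpace Ω']
    {ν : Measure Ω'} [IsProbabilityMeasure ν] {f : ∀ n, Ω n → ℝ} {g : Ω' → ℝ}
    (hf : ∀ n, AEMeasurable (f n) (μ n)) (hg : AEMeasurable g ν) {C : ℝ}
    (hfC : ∀ n ω, |f n ω| ≤ C) (hgC : ∀ ω, |g ω| ≤ C)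
    (h1 : ∫⁻ ω, ENNReal.ofReal (g ω + (C + 1)) ∂ν ≤
      liminf (fun n => ∫⁻ ω, ENNReal.ofReal (f n ω + (C + 1)) ∂(μ n)) atTop)
    (h2 : ∫⁻ ω, ENNReal.ofReal (-g ω + (C + 1)) ∂ν ≤
      liminf (fun n => ∫⁻ ω, ENNReal.ofReal (-f n ω + (C + 1)) ∂(μ n)) atTop) :
    Tendsto (fun n => ∫ ω, f n ω ∂(μ n)) atTop (𝓝 (∫ ω, g ω ∂ν)) := by
  have hfi : ∀ n, Integrable (f n) (μ n) := fun n =>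
    Integrable.of_bound (hf n).aestronglyMeasurable C (Eventually.of_forall (hfC n))
  have hgi : Integrable g ν :=
    Integrable.of_bound hg.aestronglyMeasurable C (Eventually.of_forall hgC)
  have hbound : |∫ ω, g ω ∂ν| ≤ C := by
    have := norm_integral_le_of_norm_le_const (μ := ν) (f := g) (Eventually.of_forall hgC)
    simpa using this
  obtain ⟨hb1, hb2⟩ := abs_le.1 hbound
  have hfl : ∀ n ω, -(C + 1) ≤ f n ω := fun n ω => by linarith [(abs_le.1 (hfC n ω)).1]
  have hfu : ∀ n ω, -(C + 1) ≤ -f n ω := fun n ω => by linarith [(abs_le.1 (hfC n ω)).2]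
  have hgl : ∀ ω, -(C + 1) ≤ g ω := fun ω => by linarith [(abs_le.1 (hgC ω)).1]
  have hgu : ∀ ω, -(C + 1) ≤ -g ω := fun ω => by linarith [(abs_le.1 (hgC ω)).2]
  rw [lintegral_ofReal_add hgi hgl] at h1
  rw [lintegral_ofReal_add (u := fun ω => -g ω) hgi.neg hgu, integral_neg] at h2
  simp only [lintegral_ofReal_add (hfi _) (hfl _)] at h1
  have h2' : (fun n => ∫⁻ ω, ENNReal.ofReal (-f n ω + (C + 1)) ∂(μ n)) =
      fun n => ENNReal.ofReal (-∫ ω, f n ω ∂(μ n) + (C + 1)) := by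
    funext n
    rw [lintegral_ofReal_add (u := fun ω => -f n ω) (hfi n).neg (hfu n), integral_neg]
  rw [h2'] at h2
  refine Metric.tendsto_nhds.2 fun ε hε => ?_
  filter_upwards [eventually_sub_lt_of_le_liminf (by linarith) h1 hε,
    eventually_sub_lt_of_le_liminf (by linarith) h2 hε] with n hn1 hn2
  rw [Real.dist_eq, abs_lt]
  constructor <;> linarith

end ForbiddenDegree

open ForbiddenDegree in
theorem theorem1p3 (k : ℕ∞) (t : ℝ≥0) (m : ℕ)
    -- for every `n`: the Poisson processes of the edges on `n + 1` vertices, and the roots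
    {Ω : ℕ → Type*} [∀ n, MeasurableSpace (Ω n)]
    (μ : ∀ n, Measure (Ω n)) [∀ n, IsProbabilityMeasure (μ n)]
    (P : ∀ n, PairEdge (n + 1) → Ω n → PointConfig)
    (hP : ∀ (n : ℕ) (a : PairEdge (n + 1)),
      IsPoissonProcess (1 / ((n : ℝ≥0) + 1)) (P n a) (μ n))
    (hP_indep : ∀ n, iIndepFun (P n) (μ n))
    (v : ∀ n, Fin m → Ω n → Fin (n + 1))
    (hv_meas : ∀ n i, Measurable (v n i))
    (hv_unif : ∀ n i x, μ n {ω | v n i ω = x} = 1 / ((n : ℝ≥0∞) + 1))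
    (hv_indep : ∀ n, iIndepFun (v n) (μ n))
    (hPv_indep : ∀ n, IndepFun (fun ω a => P n a ω) (fun ω i => v n i ω) (μ n))
    -- `m` independent families of independent marks: Poisson offspring numbers with mean `t`, and
    -- independent uniform variables on `[0, 1]`, which are multiplied by `t` to give the labels
    {Ω' : Type*} [MeasurableSpace Ω'] (ν : Measure Ω') [IsProbabilityMeasure ν]
    (ξ : Fin m → List ℕ → Ω' → ℕ × ℝ)
    (hξ_meas : ∀ i u, Measurable (ξ i u))
    (hξ_law : ∀ i u, ν.map (ξ i u) =
      (poissonMeasure t).prod (volume.restrict (Set.Icc (0 : ℝ) 1)))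
    (hξ_indep : iIndepFun (fun p : Fin m × List ℕ => ξ p.1 p.2) ν) :
    (∀ᵐ ω ∂ν, ∀ i, (pgwTree t (fun u => ξ i u ω)).IsOmegaMinus ∧
      (pgwTree t (fun u => ξ i u ω)).IsOmegaPlus k) ∧
    ConvergesLocally μ
      (fun n ω => rootedForbiddenGraph k t (fun a => P n a ω) (fun i => v n i ω))
      ν (fun ω => rootedForbiddenForest k t (fun i u => ξ i u ω)) := by
  have hξ : ∀ p : Word m, Measurable (ξ p.1 p.2) := fun p => hξ_meas p.1 p.2
  have hlaw : ∀ p : Word m, ν.map (ξ p.1 p.2) =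
      (poissonMeasure t).prod (volume.restrict (Set.Icc (0 : ℝ) 1)) := fun p => hξ_law p.1 p.2
  have hΩ : ∀ᵐ ω ∂ν, ∀ i, (pgwTree t (fun u => ξ i u ω)).IsOmegaMinus := by
    refine ae_all_iff.2 fun i => ae_isOmegaMinus (hξ_meas i) (hξ_law i) ?_
    exact hξ_indep.precomp (g := fun u : List ℕ => ((i, u) : Fin m × List ℕ))
      fun u w h => (Prod.mk.inj h).2
  have hΩ' : ∀ᵐ ω ∂ν, ∀ i, (pgwTree t (fun u => ξ i u ω)).IsOmegaPlus k :=
    hΩ.mono fun ω h i => (h i).isOmegaPlus k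
  have hX := fun n => aemeasurable_rootedForbiddenGraph (k := k) (t := t) (hP n) (hP_indep n)
    (hv_meas n)
  have hY := aemeasurable_rootedForbiddenForest (t := t) hξ_meas hΩ'
  refine ⟨hΩ.mono fun ω h i => ⟨h i, (h i).isOmegaPlus k⟩, hX, hY, fun F hFm ⟨C, hC⟩ hF => ?_⟩
  refine tendsto_integral_of_le_liminf (fun n => hFm.comp_aemeasurable (hX n))
    (hFm.comp_aemeasurable hY) (fun n ω => hC _) (fun ω => hC _) ?_ ?_
  · exact lintegral_forest_le_liminf hP hP_indep hv_meas hv_unif hv_indep hPv_indep hξ hlaw hξ_indep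
      hΩ' hFm hF (C + 1)
  -- The upper bound is the lower bound applied to `-F`.
  · have hF' : RGraph.LocallyContinuous fun x : RGraph m => -F x := by
      intro x ε hε
      obtain ⟨δ, hδ, h⟩ := hF x ε hε
      refine ⟨δ, hδ, fun y hy => ?_⟩
      rw [neg_sub_neg, abs_sub_comm]
      exact h y hy
    exact lintegral_forest_le_liminf hP hP_indep hv_meas hv_unif hv_indep hPv_indep hξ hlaw hξ_indep
      hΩ' hFm.neg hF' (C + 1)
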